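/- Let $\mathcal X_1,\mathcal X_2,\mathcal X_3$ be finite alphabets, let $(X_1,X_2,X_3)$ have joint pmf $p_{X_1X_2X_3}$, let $\hat{\mathcal X}_1,\hat{\mathcal X}_2$ be finite reconstruction alphabets, $d_j:\mathcal X_j\times\hat{\mathcal X}_j\to\mathbb R_{\ge 0}$ ($j=1,2$) distortion measures, extended to blocks by $d_j(x^n,y^n)=\frac1n\sum_{t=1}^n d_j(x_t,y_t)$, and let $D_{12},D_{31}\in\mathbb R$. Node $i\in\{1,2,3\}$ observes the block $X_i^n$, where $(X_{1,t},X_{2,t},X_{3,t})$, $1\le t\le n$, are i.i.d. copies of $(X_1,X_2,X_3)$. A $K$-round interactive code of length $n$ has finite message sets $\mathcal J_1^l,\mathcal J_2^l$ for $1\le l\le K$. In round $l$ node 1 first broadcasts a message in $\mathcal J_1^l$ that is a function of $X_1^n$ and of the messages node 2 sent in rounds $1,\dots,l-1$; then node 2 broadcasts a message in $\mathcal J_2^l$ that is a function of $X_2^n$ and of the messages node 1 sent in rounds $1,\dots,l$. Node 3 sends nothing. After $K$ rounds node 1 outputs $\hat X_{12}^n\in\hat{\mathcal X}_2^n$ as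 a function of $X_1^n$ and node 2's messages, node 2 outputs $\hat X_{21}^n\in\mathcal X_1^n$ as a function of $X_2^n$ and node 1's messages, and node 3 outputs $\hat X_{31}^n\in\hat{\mathcal X}_1^n$ and $\hat X_{32}^n\in\mathcal X_2^n$ as functions of $X_3^n$ and all messages. A pair $(R_1,R_2)\in\mathbb R^2$ is $K$-achievable if for every $\varepsilon>0$ there is $n_0$ such that for every $n>n_0$ there is such a code with $$\frac1n\sum_{l=1}^K\log|\mathcal J_i^l|\le R_i+\varepsilon\ (i=1,2),\quad \Pr(\hat X_{21}^n\ne X_1^n)\le\varepsilon,\quad \Pr(\hat X_{32}^n\ne X_2^n)\le\varepsilon,$$ $$\mathbb E[d_2(X_2^n,\hat X_{12}^n)]\le D_{12}+\varepsilon,\quad \mathbb E[d_1(X_1^n,\hat X_{31}^n)]\le D_{31}+\varepsilon.$$ Let $\mathcal R_K$ be the set of $K$-achievable pairs and $\mathcal R=\bigcup_{K\ge1}\mathcal R_K$. (Logarithms in rates and entropies have the same base.) Then $\mathcal R$ is the union, over all joint pmfs of $(X_1,X_2,X_3,U)$, $U$ in a finite alphabet $\mathcal U$, with $(X_1,X_2,X_3)$-marginal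 $p_{X_1X_2X_3}$, such that $U-(X_1,X_2)-X_3$ is a Markov chain and there are maps $g_{31}:\mathcal X_2\times\mathcal X_3\times\mathcal U\to\hat{\mathcal X}_1$ and $g_{12}:\mathcal X_1\times\mathcal U\to\hat{\mathcal X}_2$ with $$\mathbb E[d_1(X_1,g_{31}(X_2,X_3,U))]\le D_{31},\qquad \mathbb E[d_2(X_2,g_{12}(X_1,U))]\le D_{12},$$ of the sets of pairs $(R_1,R_2)$ satisfying $$R_1\ge H(X_1|X_2),\qquad R_2\ge I(U;X_2|X_1)+H(X_2|U X_1X_3),\qquad R_1+R_2\ge H(X_1X_2|X_3).$$ The union does not change if one only admits $\mathcal U$ with $|\mathcal U|\le|\mathcal X_1||\mathcal X_2|+3$. Moreover a single round suffices: $\mathcal R_K=\mathcal R$ for every $K\ge1$, in particular $\mathcal R_1=\mathcal R$. -/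

import Mathlib

noncomputable section

namespace ReversalDelivery

/-! ## Discrete information measures

A probability mass function on a finite type `Ω` is an element `q` of `stdSimplex ℝ Ω`; a random
variable is a map `X : Ω → A` into a finite type. Logarithms are natural, both in the entropies and
in the rates. -/

section Information

variable {Ω A B C : Type*} [Fintype Ω]

open Classical in
/-- `P(X = a)` under the probability mass function `q`. -/
def prob (q : Ω → ℝ) (X : Ω → A) (a : A) : ℝ :=
  ∑ ω with X ω = a, q ω

/-- Conditional entropy `H(X|Y) = - ∑ P(X = a, Y = b) log (P(X = a, Y = b) / P(Y = b))`. -/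
def condEntropy [Fintype A] [Fintype B] (q : Ω → ℝ) (X : Ω → A) (Y : Ω → B) : ℝ :=
  - ∑ a, ∑ b, prob q (fun ω => (X ω, Y ω)) (a, b) *
      Real.log (prob q (fun ω => (X ω, Y ω)) (a, b) / prob q Y b)

/-- Conditional mutual information `I(X;Y|Z) = H(X|Z) - H(X|YZ)`. -/
def condMutualInfo [Fintype A] [Fintype B] [Fintype C]
    (q : Ω → ℝ) (X : Ω → A) (Y : Ω → B) (Z : Ω → C) : ℝ :=
  condEntropy q X Z - condEntropy q X (fun ω => (Y ω, Z ω))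

/-- `X - Y - Z` is a Markov chain: `X` and `Z` are conditionally independent given `Y`. -/
def IsMarkovChain (q : Ω → ℝ) (X : Ω → A) (Y : Ω → B) (Z : Ω → C) : Prop :=
  ∀ a b c, prob q (fun ω => (X ω, Y ω, Z ω)) (a, b, c) * prob q Y b =
    prob q (fun ω => (X ω, Y ω)) (a, b) * prob q (fun ω => (Y ω, Z ω)) (b, c)

end Information

/-! ## Interactive codes -/

/-- A `K`-step interactive source code of block length `n` for two encoders (nodes 1 and 2, taking
turns in this order in each round and broadcasting noiselessly to the two other nodes) and three
decoders. `M₁ l`, `M₂ l` are the sizes of the message sets of nodes 1 and 2 in round `l`.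
Node 3 sends nothing. -/
structure InteractiveCode (X₁ X₂ X₃ Y₁ Y₂ : Type*) (n K : ℕ) where
  /-- sizes of the message sets of node 1 -/
  M₁ : Fin K → ℕ
  /-- sizes of the message sets of node 2 -/
  M₂ : Fin K → ℕ
  /-- encoder of node 1 in round `l`: it sees its source block and the messages that node 2 sent in
  the earlier rounds -/
  f₁ : ∀ l : Fin K, (Fin n → X₁) → (∀ k, k < l → Fin (M₂ k)) → Fin (M₁ l)
  /-- encoder of node 2 in round `l`: it sees its source block, the messages that node 1 sent in the
  earlier rounds, and the message that node 1 sent in the current round -/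
  f₂ : ∀ l : Fin K, (Fin n → X₂) → (∀ k, k < l → Fin (M₁ k)) → Fin (M₁ l) → Fin (M₂ l)
  /-- lossy reconstruction of the source of node 2 at node 1 -/
  g₁₂ : (Fin n → X₁) → (∀ l, Fin (M₂ l)) → (Fin n → Y₂)
  /-- lossless reconstruction of the source of node 1 at node 2 -/
  g₂₁ : (Fin n → X₂) → (∀ l, Fin (M₁ l)) → (Fin n → X₁)
  /-- lossy reconstruction of the source of node 1 at node 3 -/
  g₃₁ : (Fin n → X₃) → (∀ l, Fin (M₁ l)) → (∀ l, Fin (M₂ l)) → (Fin n → Y₁)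
  /-- lossless reconstruction of the source of node 2 at node 3 -/
  g₃₂ : (Fin n → X₃) → (∀ l, Fin (M₁ l)) → (∀ l, Fin (M₂ l)) → (Fin n → X₂)

namespace InteractiveCode

variable {X₁ X₂ X₃ Y₁ Y₂ : Type*} {n K : ℕ}

/-- The pair of messages sent in round `l` by nodes 1 and 2 when they observe the source blocks `x₁`
and `x₂`. -/
def messages (c : InteractiveCode X₁ X₂ X₃ Y₁ Y₂ n K) (x₁ : Fin n → X₁) (x₂ : Fin n → X₂)
    (l : Fin K) : Fin (c.M₁ l) × Fin (c.M₂ l) :=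
  let j₁ := c.f₁ l x₁ (fun k _ => (messages c x₁ x₂ k).2)
  (j₁, c.f₂ l x₂ (fun k _ => (messages c x₁ x₂ k).1) j₁)
termination_by l

/-- All messages sent by node 1 on the source block `x`. -/
def J₁ (c : InteractiveCode X₁ X₂ X₃ Y₁ Y₂ n K) (x : Fin n → X₁ × X₂ × X₃) (l : Fin K) :
    Fin (c.M₁ l) :=
  (c.messages (fun t => (x t).1) (fun t => (x t).2.1) l).1

/-- All messages sent by node 2 on the source block `x`. -/
def J₂ (c : InteractiveCode X₁ X₂ X₃ Y₁ Y₂ n K) (x : Fin n → X₁ × X₂ × X₃) (l : Fin K) :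
    Fin (c.M₂ l) :=
  (c.messages (fun t => (x t).1) (fun t => (x t).2.1) l).2

/-- The reconstruction of the source of node 2 that node 1 outputs. -/
def out₁₂ (c : InteractiveCode X₁ X₂ X₃ Y₁ Y₂ n K) (x : Fin n → X₁ × X₂ × X₃) : Fin n → Y₂ :=
  c.g₁₂ (fun t => (x t).1) (c.J₂ x)

/-- The reconstruction of the source of node 1 that node 2 outputs. -/
def out₂₁ (c : InteractiveCode X₁ X₂ X₃ Y₁ Y₂ n K) (x : Fin n → X₁ × X₂ × X₃) : Fin n → X₁ :=
  c.g₂₁ (fun t => (x t).2.1) (c.J₁ x)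

/-- The reconstruction of the source of node 1 that node 3 outputs. -/
def out₃₁ (c : InteractiveCode X₁ X₂ X₃ Y₁ Y₂ n K) (x : Fin n → X₁ × X₂ × X₃) : Fin n → Y₁ :=
  c.g₃₁ (fun t => (x t).2.2) (c.J₁ x) (c.J₂ x)

/-- The reconstruction of the source of node 2 that node 3 outputs. -/
def out₃₂ (c : InteractiveCode X₁ X₂ X₃ Y₁ Y₂ n K) (x : Fin n → X₁ × X₂ × X₃) : Fin n → X₂ :=
  c.g₃₂ (fun t => (x t).2.2) (c.J₁ x) (c.J₂ x)

end InteractiveCode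

/-! ## The operational rate-distortion region -/

section Operational

variable {X₁ X₂ X₃ Y₁ Y₂ : Type*} [Fintype X₁] [Fintype X₂] [Fintype X₃]

/-- The probability that the memoryless source with letter distribution `p` emits the block `x`. -/
def blockProb {S : Type*} (p : S → ℝ) {n : ℕ} (x : Fin n → S) : ℝ :=
  ∏ t, p (x t)

open Classical in
/-- The probability of a set `E` of source blocks of length `n`. -/
def blockPr {S : Type*} [Fintype S] (p : S → ℝ) {n : ℕ} (E : Set (Fin n → S)) : ℝ :=
  ∑ x with x ∈ E, blockProb p x

/-- The expectation of a function of the source block of length `n`. -/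
def blockExp {S : Type*} [Fintype S] (p : S → ℝ) {n : ℕ} (F : (Fin n → S) → ℝ) : ℝ :=
  ∑ x, blockProb p x * F x

/-- The average per-letter distortion between two blocks. -/
def blockDist {S T : Type*} (d : S → T → ℝ) {n : ℕ} (x : Fin n → S) (y : Fin n → T) : ℝ :=
  (1 / n : ℝ) * ∑ t, d (x t) (y t)

/-- `(R₁, R₂)` is achievable with `K` rounds for the source distribution `p`, the distortion measures
`d₁`, `d₂` and the distortion levels `D₃₁` (source 1 at node 3) and `D₁₂` (source 2 at node 1), where
node 2 recovers source 1 and node 3 recovers source 2 losslessly. -/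
def IsAchievable (p : X₁ × X₂ × X₃ → ℝ) (d₁ : X₁ → Y₁ → ℝ) (d₂ : X₂ → Y₂ → ℝ) (D₃₁ D₁₂ : ℝ)
    (K : ℕ) (R₁ R₂ : ℝ) : Prop :=
  ∀ ε : ℝ, 0 < ε → ∃ n₀ : ℕ, ∀ n : ℕ, n₀ < n →
    ∃ c : InteractiveCode X₁ X₂ X₃ Y₁ Y₂ n K,
      (1 / n : ℝ) * ∑ l, Real.log (c.M₁ l) ≤ R₁ + ε ∧
      (1 / n : ℝ) * ∑ l, Real.log (c.M₂ l) ≤ R₂ + ε ∧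
      blockExp p (fun x => blockDist d₂ (fun t => (x t).2.1) (c.out₁₂ x)) ≤ D₁₂ + ε ∧
      blockPr p {x | (fun t => (x t).1) ≠ c.out₂₁ x} ≤ ε ∧
      blockExp p (fun x => blockDist d₁ (fun t => (x t).1) (c.out₃₁ x)) ≤ D₃₁ + ε ∧
      blockPr p {x | (fun t => (x t).2.1) ≠ c.out₃₂ x} ≤ ε

/-- The rate-distortion region for `K` rounds. -/
def regionWithRounds (p : X₁ × X₂ × X₃ → ℝ) (d₁ : X₁ → Y₁ → ℝ) (d₂ : X₂ → Y₂ → ℝ) (D₃₁ D₁₂ : ℝ)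
    (K : ℕ) : Set (ℝ × ℝ) :=
  {R | IsAchievable p d₁ d₂ D₃₁ D₁₂ K R.1 R.2}

/-- The rate-distortion region: rate pairs that are achievable with some number `K ≥ 1` of rounds. -/
def rateDistortionRegion (p : X₁ × X₂ × X₃ → ℝ) (d₁ : X₁ → Y₁ → ℝ) (d₂ : X₂ → Y₂ → ℝ)
    (D₃₁ D₁₂ : ℝ) : Set (ℝ × ℝ) :=
  {R | ∃ K : ℕ, 1 ≤ K ∧ R ∈ regionWithRounds p d₁ d₂ D₃₁ D₁₂ K}

end Operational

/-! ## The single-letter region -/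

section SingleLetter

variable {X₁ X₂ X₃ Y₁ Y₂ : Type*} [Fintype X₁] [Fintype X₂] [Fintype X₃] {m : ℕ}

/-- The coordinate `X₁` of `(X₁, X₂, X₃, U)`. -/
def rvX₁ (ω : (X₁ × X₂ × X₃) × Fin m) : X₁ := ω.1.1

/-- The coordinate `X₂` of `(X₁, X₂, X₃, U)`. -/
def rvX₂ (ω : (X₁ × X₂ × X₃) × Fin m) : X₂ := ω.1.2.1

/-- The coordinate `X₃` of `(X₁, X₂, X₃, U)`. -/
def rvX₃ (ω : (X₁ × X₂ × X₃) × Fin m) : X₃ := ω.1.2.2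

/-- The coordinate `U` of `(X₁, X₂, X₃, U)`. -/
def rvU (ω : (X₁ × X₂ × X₃) × Fin m) : Fin m := ω.2

/-- `q` is a joint distribution of `(X₁, X₂, X₃, U)`, with `U` in an alphabet of `m` letters, such that
`(X₁, X₂, X₃)` has law `p`, `U - (X₁, X₂) - X₃` is a Markov chain, and there are reconstruction maps
that meet the two distortion constraints. -/
structure IsAdmissible (p : X₁ × X₂ × X₃ → ℝ) (d₁ : X₁ → Y₁ → ℝ) (d₂ : X₂ → Y₂ → ℝ) (D₃₁ D₁₂ : ℝ)
    (q : (X₁ × X₂ × X₃) × Fin m → ℝ) : Prop where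
  mem_simplex : q ∈ stdSimplex ℝ ((X₁ × X₂ × X₃) × Fin m)
  marginal : ∀ x, ∑ u, q (x, u) = p x
  markov : IsMarkovChain q rvU (fun ω => (rvX₁ ω, rvX₂ ω)) rvX₃
  dist₃₁ : ∃ g₃₁ : X₂ → X₃ → Fin m → Y₁,
    ∑ ω, q ω * d₁ (rvX₁ ω) (g₃₁ (rvX₂ ω) (rvX₃ ω) (rvU ω)) ≤ D₃₁
  dist₁₂ : ∃ g₁₂ : X₁ → Fin m → Y₂,
    ∑ ω, q ω * d₂ (rvX₂ ω) (g₁₂ (rvX₁ ω) (rvU ω)) ≤ D₁₂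

/-- The rate pairs `(R₁, R₂)` with `R₁ ≥ H(X₁|X₂)`, `R₂ ≥ I(U;X₂|X₁) + H(X₂|U X₁ X₃)` and
`R₁ + R₂ ≥ H(X₁ X₂|X₃)`. -/
def ratePairs (q : (X₁ × X₂ × X₃) × Fin m → ℝ) : Set (ℝ × ℝ) :=
  {R | condEntropy q rvX₁ rvX₂ ≤ R.1 ∧
    condMutualInfo q rvU rvX₂ rvX₁ +
      condEntropy q rvX₂ (fun ω => (rvU ω, rvX₁ ω, rvX₃ ω)) ≤ R.2 ∧
    condEntropy q (fun ω => (rvX₁ ω, rvX₂ ω)) rvX₃ ≤ R.1 + R.2}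

/-- The union of `ratePairs q` over all admissible `q` for which the alphabet of `U` has `m` letters,
for some `m` in the set `I`. -/
def singleLetterRegion (p : X₁ × X₂ × X₃ → ℝ) (d₁ : X₁ → Y₁ → ℝ) (d₂ : X₂ → Y₂ → ℝ) (D₃₁ D₁₂ : ℝ)
    (I : Set ℕ) : Set (ℝ × ℝ) :=
  {R | ∃ m ∈ I, ∃ q : (X₁ × X₂ × X₃) × Fin m → ℝ,
    IsAdmissible p d₁ d₂ D₃₁ D₁₂ q ∧ R ∈ ratePairs q}

end SingleLetter

end ReversalDelivery

end

noncomputable section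

namespace ReversalDelivery

open Finset

/-! ## Sums over blocks -/

section Blocks

variable {S T : Type*} {n : ℕ}

/-! Everything rests on the identity I(U;X₂|X₁) + H(X₂|U X₁ X₃) = H(X₂X₃|X₁) − H(X₃|U X₁), valid
when U − (X₁,X₂) − X₃ (`condInfo_add_condEntropy_eq`). So the bound on R₂ depends on U only through
H(X₃|U X₁).

Converse. The bounds on R₁ and R₁ + R₂ are Fano's inequality (`mul_condEntropy_le`): node 2 recovers
X₁ⁿ from node 1's messages, and node 3, once it has X₂ⁿ, can imitate node 2 and recover X₁ⁿ too. For
R₂, node 1's messages are functions of X₁ⁿ and of node 2's messages J₂, so X₂ⁿ is recoverable from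
(X₁ⁿ, J₂, X₃ⁿ). Hence nH(X₂X₃|X₁) ≤ log|J₂| + H(X₃ⁿ|X₁ⁿJ₂) up to a Fano term, whatever the number of
rounds (`sum_mul_log_le_massEntropy`).

The chain rule writes H(X₃ⁿ|X₁ⁿJ₂) as a sum over letters. In geometric form, the triple (law of
(X₁,X₂), entropy of X₃, distortion of X₂) of a block lies in the cone of the triples of single
letters (`block_mem_letterCone`). After division by n it lies in the convex hull of a compact set in
dimension |X₁||X₂| + 2. Carathéodory's theorem writes it with |X₁||X₂| + 3 points, whose index is U.
Since this number is fixed, compactness allows the passage ε → 0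
(`exists_convex_combination_nonpos`). Each point carries a single letter of X₁, so this U determines
X₁, and the constraint at node 3 reduces to the letterwise minimum of d₁.

Achievability, in one round. Node 1 sends a random bin of X₁ⁿ, from which node 2 decodes X₁ⁿ. Both
then know X₁ⁿ, so node 2 can quantize X₂ⁿ conditionally on it at rate I(U;X₂|X₁) without Wyner–Ziv
binning (`exists_quantizer`). It sends the index φ(X₁ⁿ,X₂ⁿ), shifted modulo the codebook size by a
random s(X₁ⁿ), together with a random bin of (X₁ⁿ,X₂ⁿ). Node 1 undoes the shift. For node 3, the
shift makes the index behave like a random bin against every competitor with another first word, so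
those are excluded by the sum rate R₁ + R₂. Competitors with the same first word must share the
index, hence the codeword of U, and there are about exp(nH(X₂|U X₁X₃)) of them, which the last bin
resolves (`exists_bins`, `exists_one_shot_code`). -/

lemma blockProb_nonneg {p : S → ℝ} (hp : ∀ s, 0 ≤ p s) (x : Fin n → S) : 0 ≤ blockProb p x :=
  Finset.prod_nonneg fun _ _ => hp _

variable [Fintype S]

lemma sum_prod_blocks (κ : Fin n → S → ℝ) :
    ∑ x : Fin n → S, ∏ t, κ t (x t) = ∏ t, ∑ s, κ t s := by
  classical
  rw [Finset.prod_univ_sum, Fintype.piFinset_univ]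

lemma sum_blocks_prod [Fintype T] {M : Type*} [AddCommMonoid M] (F : (Fin n → S × T) → M) :
    ∑ x, F x = ∑ a : Fin n → S, ∑ b : Fin n → T, F (fun t => (a t, b t)) := by
  rw [← Fintype.sum_prod_type' (f := fun (a : Fin n → S) (b : Fin n → T) => F fun t => (a t, b t))]
  exact Fintype.sum_equiv (Equiv.arrowProdEquivProdArrow _ _ _) _ _ (fun x => rfl)

lemma sum_blockProb {p : S → ℝ} (hp : p ∈ stdSimplex ℝ S) :
    ∑ x : Fin n → S, blockProb p x = 1 := by
  simp only [blockProb, sum_prod_blocks (fun _ => p), hp.2, Finset.prod_const_one]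

lemma prob_eq_sum_ite [DecidableEq T] (p : S → ℝ) (f : S → T) (z : T) :
    prob p f z = ∑ s, if f s = z then p s else 0 := by
  classical
  rw [prob, Finset.sum_filter]
  exact Finset.sum_congr rfl fun s _ => by congr

lemma prob_nonneg {p : S → ℝ} (hp : ∀ s, 0 ≤ p s) (f : S → T) (z : T) : 0 ≤ prob p f z :=
  Finset.sum_nonneg fun _ _ => hp _

lemma le_prob {p : S → ℝ} (hp : ∀ s, 0 ≤ p s) (f : S → T) (s : S) : p s ≤ prob p f (f s) := by
  classical
  exact Finset.single_le_sum (f := p) (fun _ _ => hp _) (by simp)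

lemma sum_mul_comp [Fintype T] (p : S → ℝ) (f : S → T) (F : T → ℝ) :
    ∑ s, p s * F (f s) = ∑ z, prob p f z * F z := by
  classical
  simp only [prob_eq_sum_ite, Finset.sum_mul, ite_mul, zero_mul]
  rw [Finset.sum_comm]
  simp

lemma sum_prob [Fintype T] (p : S → ℝ) (f : S → T) : ∑ z, prob p f z = ∑ s, p s := by
  simpa using (sum_mul_comp p f (fun _ => 1)).symm

lemma prob_mem_stdSimplex [Fintype T] {p : S → ℝ} (hp : p ∈ stdSimplex ℝ S) (f : S → T) :
    prob p f ∈ stdSimplex ℝ T :=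
  ⟨fun _ => prob_nonneg hp.1 _ _, by rw [sum_prob, hp.2]⟩

/-- The law of the letterwise image of a memoryless block is memoryless. -/
lemma sum_blockProb_comp [Fintype T] (p : S → ℝ) (f : S → T) (F : (Fin n → T) → ℝ) :
    ∑ x : Fin n → S, blockProb p x * F (fun t => f (x t)) =
      ∑ z : Fin n → T, blockProb (prob p f) z * F z := by
  classical
  rw [sum_mul_comp (blockProb p) (fun (x : Fin n → S) t => f (x t)) F]
  refine Finset.sum_congr rfl fun z _ => ?_
  congr 1
  simp only [prob_eq_sum_ite, blockProb]
  rw [← sum_prod_blocks (fun t s => if f s = z t then p s else 0)]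
  refine Finset.sum_congr rfl fun x _ => ?_
  by_cases h : (fun t => f (x t)) = z
  · rw [if_pos h]
    refine Finset.prod_congr rfl fun t _ => ?_
    rw [if_pos (congrFun h t)]
  · rw [if_neg h]
    obtain ⟨t, ht⟩ := Function.ne_iff.1 h
    exact (Finset.prod_eq_zero (Finset.mem_univ t) (if_neg ht)).symm

lemma sum_blockProb_letter {p : S → ℝ} (hp : p ∈ stdSimplex ℝ S) (f : S → ℝ) (t₀ : Fin n) :
    ∑ x : Fin n → S, blockProb p x * f (x t₀) = ∑ s, p s * f s := by
  have h := sum_prod_blocks (fun t s => if t = t₀ then p s * f s else p s)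
  have h1 : ∀ x : Fin n → S, (∏ t, if t = t₀ then p (x t) * f (x t) else p (x t)) =
      blockProb p x * f (x t₀) := by
    intro x
    rw [blockProb, ← Finset.mul_prod_erase _ _ (Finset.mem_univ t₀),
      ← Finset.mul_prod_erase _ (fun t => p (x t)) (Finset.mem_univ t₀), if_pos rfl,
      Finset.prod_congr rfl fun t ht => if_neg (Finset.ne_of_mem_erase ht)]
    ring
  simp only [h1] at h
  rw [h, ← Finset.mul_prod_erase _ _ (Finset.mem_univ t₀),
    Finset.prod_congr rfl fun t ht => Finset.sum_congr rfl fun s _ =>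
      if_neg (Finset.ne_of_mem_erase ht)]
  simp [hp.2]

lemma sum_blockProb_sum {p : S → ℝ} (hp : p ∈ stdSimplex ℝ S) (f : S → ℝ) :
    ∑ x : Fin n → S, blockProb p x * ∑ t, f (x t) = n * ∑ s, p s * f s := by
  simp only [Finset.mul_sum]
  rw [Finset.sum_comm]
  simp only [sum_blockProb_letter hp]
  simp [Finset.mul_sum]

lemma blockPr_eq_sum_ite (p : S → ℝ) (E : Set (Fin n → S)) [DecidablePred (· ∈ E)] :
    blockPr p E = ∑ x, if x ∈ E then blockProb p x else 0 := by
  classical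
  rw [blockPr, Finset.sum_filter]
  exact Finset.sum_congr rfl fun s _ => by congr

lemma blockPr_comp [Fintype T] (p : S → ℝ) (f : S → T) (E : Set (Fin n → T)) :
    blockPr p {x : Fin n → S | (fun t => f (x t)) ∈ E} = blockPr (prob p f) E := by
  classical
  rw [blockPr_eq_sum_ite, blockPr_eq_sum_ite]
  simpa using sum_blockProb_comp p f fun z : Fin n → T => if z ∈ E then 1 else 0

lemma blockPr_mono {p : S → ℝ} (hp : ∀ s, 0 ≤ p s) {E F : Set (Fin n → S)}
    (h : ∀ x, blockProb p x ≠ 0 → x ∈ E → x ∈ F) : blockPr p E ≤ blockPr p F := by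
  classical
  rw [blockPr_eq_sum_ite, blockPr_eq_sum_ite]
  refine Finset.sum_le_sum fun x _ => ?_
  have h0 := blockProb_nonneg hp x
  by_cases hx : blockProb p x = 0
  · simp [hx]
  · by_cases hE : x ∈ E
    · rw [if_pos hE, if_pos (h x hx hE)]
    · rw [if_neg hE]; split_ifs <;> simp [h0]

lemma blockPr_union_le {p : S → ℝ} (hp : ∀ s, 0 ≤ p s) (E F : Set (Fin n → S)) :
    blockPr p (E ∪ F) ≤ blockPr p E + blockPr p F := by
  classical
  rw [blockPr_eq_sum_ite, blockPr_eq_sum_ite, blockPr_eq_sum_ite, ← Finset.sum_add_distrib]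
  refine Finset.sum_le_sum fun x _ => ?_
  have h0 := blockProb_nonneg hp x
  by_cases hE : x ∈ E <;> by_cases hF : x ∈ F <;> simp [hE, hF, h0]

/-- A Chernoff bound: sums of independent letters of negative mean are negative, up to an
exponentially small probability. -/
lemma exists_blockPr_le_pow {p : S → ℝ} (hp : p ∈ stdSimplex ℝ S) (g : S → ℝ)
    (hg : ∑ s, p s * g s < 0) :
    ∃ ρ : ℝ, 0 ≤ ρ ∧ ρ < 1 ∧ ∀ n : ℕ,
      blockPr p {x : Fin n → S | 0 ≤ ∑ t, g (x t)} ≤ ρ ^ n := by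
  classical
  set m := ∑ s, p s * g s with hm
  obtain ⟨C, hC1, hC⟩ : ∃ C : ℝ, 1 ≤ C ∧ ∀ s, |g s| ≤ C := by
    refine ⟨1 + ∑ s, |g s|, ?_, fun s => ?_⟩
    · have : 0 ≤ ∑ s, |g s| := Finset.sum_nonneg fun _ _ => abs_nonneg _
      linarith
    · have := Finset.single_le_sum (f := fun s => |g s|) (fun _ _ => abs_nonneg _)
        (Finset.mem_univ s)
      linarith
  have hC0 : 0 < C := by linarith
  have hm1 : -C ≤ m := by
    have : ∑ s, p s * (-C) ≤ m := Finset.sum_le_sum fun s _ =>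
      mul_le_mul_of_nonneg_left (abs_le.1 (hC s)).1 (hp.1 s)
    rw [← Finset.sum_mul, hp.2] at this
    linarith
  -- The minimizer of 1 + l m + l²C², which bounds the moment generating function as long as l C ≤
  -- 1; the minimum is 1 + l m / 2 < 1.
  set l : ℝ := -m / (2 * C ^ 2) with hl
  have hl0 : 0 < l := by have : 0 < -m := by linarith
                         positivity
  have hlC : l * C ≤ 1 := by
    rw [hl, div_mul_eq_mul_div, div_le_one (by positivity)]
    nlinarith
  refine ⟨∑ s, p s * Real.exp (l * g s),
    Finset.sum_nonneg fun s _ => mul_nonneg (hp.1 s) (Real.exp_pos _).le, ?_, fun n => ?_⟩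
  · have hb : ∀ s, Real.exp (l * g s) ≤ 1 + l * g s + l ^ 2 * C ^ 2 := by
      intro s
      have h1 : |l * g s| ≤ 1 := by
        rw [abs_mul, abs_of_pos hl0]
        exact (mul_le_mul_of_nonneg_left (hC s) hl0.le).trans hlC
      have h2 := (abs_le.1 (Real.abs_exp_sub_one_sub_id_le h1)).2
      have h3 : (g s) ^ 2 ≤ C ^ 2 := sq_le_sq' (abs_le.1 (hC s)).1 (abs_le.1 (hC s)).2
      have h4 : l ^ 2 * (g s) ^ 2 ≤ l ^ 2 * C ^ 2 := mul_le_mul_of_nonneg_left h3 (sq_nonneg l)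
      rw [mul_pow] at h2
      linarith
    calc ∑ s, p s * Real.exp (l * g s)
        ≤ ∑ s, p s * (1 + l * g s + l ^ 2 * C ^ 2) :=
          Finset.sum_le_sum fun s _ => mul_le_mul_of_nonneg_left (hb s) (hp.1 s)
      _ = (∑ s, p s) * (1 + l ^ 2 * C ^ 2) + l * m := by
          rw [hm, Finset.mul_sum, Finset.sum_mul, ← Finset.sum_add_distrib]
          exact Finset.sum_congr rfl fun s _ => by ring
      _ = 1 + l * (l * C ^ 2 + m) := by rw [hp.2]; ring
      _ < 1 := by
          have : l * C ^ 2 = -m / 2 := by rw [hl]; field_simp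
          rw [this]; nlinarith
  · rw [blockPr_eq_sum_ite]
    calc ∑ x : Fin n → S, (if x ∈ {x : Fin n → S | 0 ≤ ∑ t, g (x t)} then blockProb p x else 0)
        ≤ ∑ x : Fin n → S, ∏ t, p (x t) * Real.exp (l * g (x t)) := by
          refine Finset.sum_le_sum fun x _ => ?_
          rw [Finset.prod_mul_distrib, ← Real.exp_sum, ← Finset.mul_sum]
          have h0 := blockProb_nonneg hp.1 x
          split_ifs with hx
          · exact le_mul_of_one_le_right h0
              (Real.one_le_exp (mul_nonneg hl0.le hx))
          · exact mul_nonneg h0 (Real.exp_pos _).le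
      _ = (∑ s, p s * Real.exp (l * g s)) ^ n := by
          rw [sum_prod_blocks (fun _ s => p s * Real.exp (l * g s))]; simp

lemma exists_forall_blockPr_le {p : S → ℝ} (hp : p ∈ stdSimplex ℝ S) (g : S → ℝ)
    (hg : ∑ s, p s * g s < 0) {δ : ℝ} (hδ : 0 < δ) :
    ∃ n₀ : ℕ, ∀ n : ℕ, n₀ ≤ n →
      blockPr p {x : Fin n → S | 0 ≤ ∑ t, g (x t)} ≤ δ := by
  obtain ⟨ρ, h0, h1, h⟩ := exists_blockPr_le_pow hp g hg
  obtain ⟨n₀, hn₀⟩ := exists_pow_lt_of_lt_one hδ h1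
  exact ⟨n₀, fun n hn => (h n).trans ((pow_le_pow_of_le_one h0 h1.le hn).trans hn₀.le)⟩

/-- The typical behaviour of a product of letter weights. -/
lemma exists_forall_blockPr_prod_le {p : S → ℝ} (hp : p ∈ stdSimplex ℝ S) (k : S → ℝ)
    (hk : ∀ s, p s ≠ 0 → 0 < k s) (h ε : ℝ) (hε : 0 < ε) (hh : -∑ s, p s * Real.log (k s) ≤ h)
    {δ : ℝ} (hδ : 0 < δ) :
    ∃ n₀ : ℕ, ∀ n : ℕ, n₀ ≤ n →
      blockPr p {x : Fin n → S | ∏ t, k (x t) < Real.exp (-(n * (h + ε)))} ≤ δ := by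
  obtain ⟨n₀, hn₀⟩ := exists_forall_blockPr_le hp (fun s => -Real.log (k s) - (h + ε)) (by
    have : ∑ s, p s * (-Real.log (k s) - (h + ε)) =
        -∑ s, p s * Real.log (k s) - (∑ s, p s) * (h + ε) := by
      rw [Finset.sum_mul, ← Finset.sum_neg_distrib, ← Finset.sum_sub_distrib]
      exact Finset.sum_congr rfl fun s _ => by ring
    rw [this, hp.2]; linarith) hδ
  refine ⟨n₀, fun n hn => (blockPr_mono hp.1 fun x hx hxE => ?_).trans (hn₀ n hn)⟩
  have hpos : ∀ t, 0 < k (x t) := fun t =>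
    hk _ ((Finset.prod_ne_zero_iff.1 hx) t (Finset.mem_univ t))
  have h1 : Real.log (∏ t, k (x t)) < -(n * (h + ε)) := by
    rw [Real.log_lt_iff_lt_exp (Finset.prod_pos fun t _ => hpos t)]; exact hxE
  rw [Real.log_prod (fun t _ => (hpos t).ne')] at h1
  simp only [Set.mem_ofPred_eq, Finset.sum_sub_distrib, Finset.sum_neg_distrib, Finset.sum_const,
    Finset.card_univ, Fintype.card_fin, nsmul_eq_mul]
  linarith

end Blocks

/-! ## Entropy -/

section Entropy

variable {Ω Ω' A B C : Type*} [Fintype Ω]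

/-- The entropy of a random variable. -/
def jointEntropy [Fintype A] (q : Ω → ℝ) (X : Ω → A) : ℝ :=
  ∑ a, Real.negMulLog (prob q X a)

lemma prob_prob [Fintype A] (q : Ω → ℝ) (f : Ω → A) (g : A → B) :
    prob (prob q f) g = prob q (fun ω => g (f ω)) := by
  classical
  funext b
  rw [prob_eq_sum_ite, prob_eq_sum_ite]
  have := sum_mul_comp q f (fun a => if g a = b then 1 else 0)
  simpa using this.symm

lemma prob_pair_le [Fintype A] {q : Ω → ℝ} (hq : ∀ ω, 0 ≤ q ω) (X : Ω → A) (Y : Ω → B) (a : A)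
    (b : B) : prob q (fun ω => (X ω, Y ω)) (a, b) ≤ prob q Y b := by
  classical
  rw [prob_eq_sum_ite, prob_eq_sum_ite]
  refine Finset.sum_le_sum fun ω _ => ?_
  by_cases h : Y ω = b
  · simp only [Prod.mk.injEq, h, and_true, if_true]
    split_ifs
    · exact le_rfl
    · exact hq ω
  · simp [h]

lemma sum_prob_pair [Fintype A] (q : Ω → ℝ) (X : Ω → A) (Y : Ω → B) (b : B) :
    ∑ a, prob q (fun ω => (X ω, Y ω)) (a, b) = prob q Y b := by
  classical
  simp only [prob_eq_sum_ite, Prod.mk.injEq]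
  rw [Finset.sum_comm]
  refine Finset.sum_congr rfl fun ω _ => ?_
  by_cases h : Y ω = b <;> simp [h]

lemma condEntropy_eq_sub [Fintype A] [Fintype B] {q : Ω → ℝ} (hq : ∀ ω, 0 ≤ q ω) (X : Ω → A)
    (Y : Ω → B) :
    condEntropy q X Y = jointEntropy q (fun ω => (X ω, Y ω)) - jointEntropy q Y := by
  have h : ∀ a b, prob q (fun ω => (X ω, Y ω)) (a, b) *
      Real.log (prob q (fun ω => (X ω, Y ω)) (a, b) / prob q Y b) =
      -Real.negMulLog (prob q (fun ω => (X ω, Y ω)) (a, b)) -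
        prob q (fun ω => (X ω, Y ω)) (a, b) * Real.log (prob q Y b) := by
    intro a b
    by_cases h0 : prob q (fun ω => (X ω, Y ω)) (a, b) = 0
    · simp [h0]
    · have h1 : prob q Y b ≠ 0 := fun h1 => h0 (le_antisymm
        ((prob_pair_le hq X Y a b).trans h1.le) (prob_nonneg hq _ _))
      rw [Real.log_div h0 h1, Real.negMulLog]
      ring
  simp only [condEntropy, h, jointEntropy, Fintype.sum_prod_type]
  simp only [Finset.sum_sub_distrib, Finset.sum_neg_distrib]
  rw [Finset.sum_comm (f := fun a b => prob q (fun ω => (X ω, Y ω)) (a, b) *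
    Real.log (prob q Y b))]
  simp only [← Finset.sum_mul, sum_prob_pair, Real.negMulLog]
  simp only [neg_mul, Finset.sum_neg_distrib]
  ring

lemma condEntropy_eq_sum [Fintype A] [Fintype B] (q : Ω → ℝ) (X : Ω → A) (Y : Ω → B) :
    condEntropy q X Y = -∑ ω, q ω *
      Real.log (prob q (fun ω => (X ω, Y ω)) (X ω, Y ω) / prob q Y (Y ω)) := by
  rw [condEntropy, sum_mul_comp q (fun ω => (X ω, Y ω))
    (fun z => Real.log (prob q (fun ω => (X ω, Y ω)) z / prob q Y z.2)), Fintype.sum_prod_type]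

lemma condEntropy_prob [Fintype Ω'] [Fintype A] [Fintype B] (q : Ω → ℝ) (f : Ω → Ω')
    (X : Ω' → A) (Y : Ω' → B) :
    condEntropy (prob q f) X Y = condEntropy q (fun ω => X (f ω)) (fun ω => Y (f ω)) := by
  simp only [condEntropy, prob_prob]

/-- The entropy of a nonnegative function, relative to its mass: if `f` is the law of `X` on an
event `E`, this is `P(E) H(X | E)`. -/
def massEntropy [Fintype C] (f : C → ℝ) : ℝ :=
  ∑ c, Real.negMulLog (f c) - Real.negMulLog (∑ c, f c)

lemma massEntropy_eq [Fintype C] {f : C → ℝ} (hf : ∀ c, 0 ≤ f c) :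
    massEntropy f = ∑ c, f c * Real.log ((∑ c, f c) / f c) := by
  have h : ∀ c, f c * Real.log ((∑ c, f c) / f c) =
      f c * Real.log (∑ c, f c) + Real.negMulLog (f c) := by
    intro c
    by_cases h0 : f c = 0
    · simp [h0]
    · have h1 : ∑ c, f c ≠ 0 := fun h1 =>
        h0 ((Finset.sum_eq_zero_iff_of_nonneg fun c _ => hf c).1 h1 c (Finset.mem_univ c))
      rw [Real.log_div h1 h0, Real.negMulLog]
      ring
  simp only [h, Finset.sum_add_distrib, ← Finset.sum_mul, massEntropy, Real.negMulLog]
  ring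

/-- Homogeneity allows work with unnormalized laws on events, so that conditional entropies become
plain sums without division by probabilities. -/
lemma massEntropy_smul [Fintype C] (f : C → ℝ) (w : ℝ) :
    massEntropy (fun c => w * f c) = w * massEntropy f := by
  simp only [massEntropy, ← Finset.mul_sum, Real.negMulLog_mul, Finset.sum_add_distrib,
    ← Finset.sum_mul]
  ring

/-- The chain rule for entropy; the fibres need no weights because each already carries its mass. -/
lemma massEntropy_prod [Fintype A] [Fintype B] (f : A × B → ℝ) :
    massEntropy f = massEntropy (fun a => ∑ b, f (a, b)) +
      ∑ a, massEntropy (fun b => f (a, b)) := by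
  simp only [massEntropy, Fintype.sum_prod_type, Finset.sum_sub_distrib]
  ring

lemma massEntropy_comp_equiv [Fintype A] [Fintype B] (f : A → ℝ) (e : B ≃ A) :
    massEntropy (fun b => f (e b)) = massEntropy f := by
  simp only [massEntropy]
  rw [e.sum_comp, e.sum_comp (fun a => Real.negMulLog (f a))]

/-! ## Converse bounds of Fano type -/

/-- Fano's inequality in the form of a bound on a relative entropy. -/
lemma sum_mul_log_div_le {P V : Ω → ℝ} (hP : P ∈ stdSimplex ℝ Ω) (hV : ∀ ω, 0 ≤ V ω)
    (hPV : ∀ ω, P ω ≠ 0 → V ω ≠ 0) (E : Ω → Prop) [DecidablePred E] {N L : ℝ} (hN : 1 ≤ N)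
    (hL : 0 < L) (hVN : ∑ ω, (if E ω then V ω else 0) ≤ N)
    (hVL : ∑ ω, (if E ω then 0 else V ω) ≤ L) :
    ∑ ω, P ω * Real.log (V ω / P ω) ≤
      Real.log 2 + Real.log N + (∑ ω, if E ω then 0 else P ω) * Real.log L := by
  have hN0 : 0 < N := by linarith
  have key : ∀ ω, P ω * Real.log (V ω / P ω) ≤
      P ω * Real.log 2 + P ω * Real.log N + (if E ω then 0 else P ω) * Real.log L +
        ((if E ω then V ω else 0) / (2 * N) + (if E ω then 0 else V ω) / (2 * L) - P ω) := by
    intro ω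
    have hp := hP.1 ω
    rcases hp.eq_or_lt with h0 | h0
    · rw [← h0]
      have := hV ω
      have h1 : 0 ≤ (if E ω then V ω else 0) := by split_ifs <;> simp [this]
      have h2 : 0 ≤ (if E ω then 0 else V ω) := by split_ifs <;> simp [this]
      simp only [zero_mul, ite_self, zero_add, sub_zero]
      positivity
    · have hv : 0 < V ω := lt_of_le_of_ne (hV ω) (Ne.symm (hPV ω h0.ne'))
      -- This is log x ≤ x − 1 at x = V/(2DP). With D = N on `E` and D = L off `E`, the measure
      -- V/(2D) has total mass at most 1, so the linear terms sum to at most 0. The factor 2 shares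
      -- the mass between the two parts and produces the log 2.
      have gen : ∀ D : ℝ, 0 < D → P ω * Real.log (V ω / P ω) ≤
          P ω * Real.log 2 + P ω * Real.log D + (V ω / (2 * D) - P ω) := by
        intro D hD
        have h1 : Real.log (V ω / (2 * D) / P ω) ≤ V ω / (2 * D) / P ω - 1 :=
          Real.log_le_sub_one_of_pos (by positivity)
        have h2 : Real.log (V ω / (2 * D) / P ω) =
            Real.log (V ω / P ω) - (Real.log 2 + Real.log D) := by
          rw [Real.log_div (by positivity) h0.ne', Real.log_div hv.ne' (by positivity),
            Real.log_div hv.ne' h0.ne', Real.log_mul two_ne_zero hD.ne']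
          ring
        rw [h2] at h1
        have h3 := mul_le_mul_of_nonneg_left h1 h0.le
        have h4 : P ω * (V ω / (2 * D) / P ω - 1) = V ω / (2 * D) - P ω := by
          field_simp
        rw [h4] at h3
        linarith
      by_cases hE : E ω
      · simp only [hE, if_true, zero_mul, add_zero, zero_div]
        exact gen N hN0
      · simp only [hE, if_false, zero_div, zero_add]
        have h5 := gen L hL
        have h6 : 0 ≤ P ω * Real.log N := mul_nonneg h0.le (Real.log_nonneg hN)
        linarith
  have hs := Finset.sum_le_sum fun ω (_ : ω ∈ Finset.univ) => key ω
  simp only [Finset.sum_add_distrib, Finset.sum_sub_distrib, ← Finset.sum_mul, ← Finset.sum_div,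
    hP.2, one_mul] at hs
  have h1 : (∑ ω, if E ω then V ω else 0) / (2 * N) ≤ 1 / 2 := by
    rw [div_le_iff₀ (by positivity)]; linarith
  have h2 : (∑ ω, if E ω then 0 else V ω) / (2 * L) ≤ 1 / 2 := by
    rw [div_le_iff₀ (by positivity)]; linarith
  linarith

/-- The log-likelihood ratio of a memoryless block against a letterwise marginal. -/
lemma sum_blockProb_mul_log [Fintype A] [Fintype B] {n : ℕ} {r : Ω → ℝ} (hr : r ∈ stdSimplex ℝ Ω)
    (X : Ω → A) (Y : Ω → B) (hX : Function.Injective fun ω => (X ω, Y ω)) :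
    ∑ z : Fin n → Ω, blockProb r z *
      Real.log (blockProb (prob r Y) (fun t => Y (z t)) / blockProb r z) =
      n * condEntropy r X Y := by
  classical
  have hne : ∀ s, r s ≠ 0 → prob r Y (Y s) ≠ 0 := fun s hs =>
    (lt_of_lt_of_le (lt_of_le_of_ne (hr.1 s) (Ne.symm hs)) (le_prob hr.1 Y s)).ne'
  have hlog : ∀ z : Fin n → Ω, blockProb r z *
      Real.log (blockProb (prob r Y) (fun t => Y (z t)) / blockProb r z) =
      blockProb r z * ∑ t, -Real.log (r (z t) / prob r Y (Y (z t))) := by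
    intro z
    by_cases hz : blockProb r z = 0
    · simp [hz]
    have hz' : ∀ t, r (z t) ≠ 0 := fun t => Finset.prod_ne_zero_iff.1 hz t (Finset.mem_univ t)
    congr 1
    simp only [blockProb]
    rw [← Finset.prod_div_distrib,
      Real.log_prod (fun t _ => div_ne_zero (hne _ (hz' t)) (hz' t))]
    exact Finset.sum_congr rfl fun t _ => by rw [← Real.log_inv, inv_div]
  rw [Finset.sum_congr rfl fun z _ => hlog z,
    sum_blockProb_sum hr (fun s => -Real.log (r s / prob r Y (Y s))), condEntropy_eq_sum]
  simp only [mul_neg, Finset.sum_neg_distrib]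
  have : ∀ s, prob r (fun ω => (X ω, Y ω)) (X s, Y s) = r s := by
    intro s
    rw [prob_eq_sum_ite]
    simp only [hX.eq_iff (b := s)]
    simp
  simp only [this]

/-- The converse of lossless source coding with side information at the decoder. -/
lemma mul_condEntropy_le {T G 𝒥 : Type*} [Fintype T] [Fintype G] [Fintype 𝒥] {n : ℕ}
    {r : T × G → ℝ} (hr : r ∈ stdSimplex ℝ (T × G)) (J : (Fin n → T × G) → 𝒥)
    (D : (Fin n → G) → 𝒥 → (Fin n → T)) {ε : ℝ}
    (herr : blockPr r {z | (fun t => (z t).1) ≠ D (fun t => (z t).2) (J z)} ≤ ε) :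
    n * condEntropy r Prod.fst Prod.snd ≤
      Real.log 2 + Real.log (Fintype.card 𝒥) + ε * (n * Real.log (Fintype.card T)) := by
  classical
  obtain ⟨⟨t₀, g₀⟩⟩ : Nonempty (T × G) := by
    by_contra h
    rw [not_nonempty_iff] at h
    have := hr.2
    simp at this
  have hT : 1 ≤ Fintype.card T := Fintype.card_pos_iff.2 ⟨t₀⟩
  have h𝒥 : 1 ≤ Fintype.card 𝒥 := Fintype.card_pos_iff.2 ⟨J fun _ => (t₀, g₀)⟩
  have hblk : blockProb r (n := n) ∈ stdSimplex ℝ (Fin n → T × G) :=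
    ⟨blockProb_nonneg hr.1, sum_blockProb hr⟩
  have hG := prob_mem_stdSimplex hr (Prod.snd : T × G → G)
  -- The law of the side information times counting measure on words. For given side information at
  -- most |𝒥| words are decoded correctly, so success has mass at most |𝒥|; the total mass is |T|ⁿ.
  set V : (Fin n → T × G) → ℝ := fun z => blockProb (prob r Prod.snd) (fun t => (z t).2) with hVdef
  have hV : ∀ z, 0 ≤ V z := fun z => blockProb_nonneg hG.1 _
  have hne : ∀ s, r s ≠ 0 → prob r Prod.snd s.2 ≠ 0 := fun s hs =>
    (lt_of_lt_of_le (lt_of_le_of_ne (hr.1 s) (Ne.symm hs)) (le_prob hr.1 Prod.snd s)).ne'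
  have hVsum : ∑ z, V z = (Fintype.card T : ℝ) ^ n := by
    rw [sum_blocks_prod]
    simp [hVdef, sum_blockProb hG]
  have hmain := sum_mul_log_div_le hblk hV (fun z hz => Finset.prod_ne_zero_iff.2 fun t ht =>
      hne _ (Finset.prod_ne_zero_iff.1 hz t ht))
    (fun z => (fun t => (z t).1) = D (fun t => (z t).2) (J z))
    (N := Fintype.card 𝒥) (L := (Fintype.card T : ℝ) ^ n) (by exact_mod_cast h𝒥)
    (by positivity) ?_ ?_
  · rw [sum_blockProb_mul_log hr Prod.fst Prod.snd fun _ _ h => h] at hmain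
    refine hmain.trans ?_
    rw [Real.log_pow]
    have hl : 0 ≤ n * Real.log (Fintype.card T) :=
      mul_nonneg (Nat.cast_nonneg n) (Real.log_nonneg (by exact_mod_cast hT))
    have he : (∑ z : Fin n → T × G,
        if (fun t => (z t).1) = D (fun t => (z t).2) (J z) then 0 else blockProb r z) ≤ ε := by
      refine le_trans (le_of_eq ?_) herr
      rw [blockPr_eq_sum_ite]
      exact Finset.sum_congr rfl fun z _ => by simp [ite_not]
    have := mul_le_mul_of_nonneg_right he hl
    linarith
  · rw [sum_blocks_prod, Finset.sum_comm]
    calc _ ≤ ∑ g : Fin n → G, ∑ j : 𝒥, blockProb (prob r Prod.snd) g := by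
          refine Finset.sum_le_sum fun g _ => ?_
          have hv := blockProb_nonneg hG.1 g
          calc _ ≤ ∑ x : Fin n → T, ∑ j : 𝒥,
                if x = D g j then blockProb (prob r Prod.snd) g else 0 := by
                refine Finset.sum_le_sum fun x _ => ?_
                split_ifs with h
                · refine le_trans ?_ (Finset.single_le_sum (f := fun j =>
                    if x = D g j then blockProb (prob r Prod.snd) g else 0)
                    (fun j _ => ?_) (Finset.mem_univ (J fun t => (x t, g t))))
                  · exact le_of_eq (if_pos h).symm
                  · split_ifs <;> simp [hv]
                · exact Finset.sum_nonneg fun j _ => by split_ifs <;> simp [hv]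
            _ = _ := by rw [Finset.sum_comm]; simp
      _ = Fintype.card 𝒥 := by
          rw [Finset.sum_comm]; simp [sum_blockProb hG]
  · rw [← hVsum]
    refine Finset.sum_le_sum fun z _ => ?_
    have := hV z
    split_ifs <;> simp [this]

/-- A lower bound on the entropy of `C` given `A` and a message `J`, computed from `(A, B)`, from
which `B` can be recovered with the help of `A` and `C`. -/
lemma sum_mul_log_le_massEntropy {𝒥 : Type*} [Fintype A] [Fintype B] [Fintype C] [Fintype 𝒥]
    [DecidableEq 𝒥] [DecidableEq B] {P : A → B → C → ℝ} (hP : ∀ a b c, 0 ≤ P a b c)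
    (hP1 : ∑ a, ∑ b, ∑ c, P a b c = 1) (J : A → B → 𝒥) (D : A → 𝒥 → C → B) :
    ∑ a, ∑ b, ∑ c, P a b c * Real.log ((∑ b, ∑ c, P a b c) / P a b c) ≤
      Real.log 2 + Real.log (Fintype.card 𝒥) +
        (∑ a, ∑ b, ∑ c, if b = D a (J a b) c then 0 else P a b c) * Real.log (Fintype.card B) +
        ∑ a, ∑ j, massEntropy (fun c => ∑ b, if J a b = j then P a b c else 0) := by
  classical
  obtain ⟨a₀, b₀⟩ : Nonempty A ∧ Nonempty B := by
    constructor <;>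
    · by_contra h
      rw [not_nonempty_iff] at h
      simp at hP1
  have h𝒥 : 1 ≤ Fintype.card 𝒥 := Fintype.card_pos_iff.2 ⟨J a₀.some b₀.some⟩
  have hB : 1 ≤ Fintype.card B := Fintype.card_pos
  set PA : A → ℝ := fun a => ∑ b, ∑ c, P a b c with hPA
  set PJ : A → 𝒥 → C → ℝ := fun a j c => ∑ b, if J a b = j then P a b c else 0 with hPJ
  have hPA0 : ∀ a, 0 ≤ PA a := fun a =>
    Finset.sum_nonneg fun b _ => Finset.sum_nonneg fun c _ => hP a b c
  have hPJ0 : ∀ a j c, 0 ≤ PJ a j c := fun a j c =>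
    Finset.sum_nonneg fun b _ => by split_ifs <;> simp [hP]
  have hPJs : ∀ a j, 0 ≤ ∑ c, PJ a j c := fun a j => Finset.sum_nonneg fun c _ => hPJ0 a j c
  have hle1 : ∀ a b c, P a b c ≤ PJ a (J a b) c := by
    intro a b c
    refine le_trans (le_of_eq ?_) (Finset.single_le_sum
      (f := fun b' => if J a b' = J a b then P a b' c else 0) (fun b' _ => ?_) (Finset.mem_univ b))
    · simp
    · split_ifs <;> simp [hP]
  have hle2 : ∀ a j c, PJ a j c ≤ ∑ c, PJ a j c := fun a j c =>
    Finset.single_le_sum (fun c _ => hPJ0 a j c) (Finset.mem_univ c)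
  have hle3 : ∀ a b c, P a b c ≤ PA a := fun a b c =>
    (Finset.single_le_sum (fun c _ => hP a b c) (Finset.mem_univ c)).trans
      (Finset.single_le_sum (f := fun b => ∑ c, P a b c)
        (fun b _ => Finset.sum_nonneg fun c _ => hP a b c) (Finset.mem_univ b))
  -- The comparison measure P(a) P(c | a, J(a,b)). Correct decoding leaves one b for each (a, j, c),
  -- so success has mass at most |𝒥|; summing over all b gives at most |B|. The second factor is
  -- what turns into the entropy of C given A and J.
  set V : A × B × C → ℝ := fun z =>
    PA z.1 * (PJ z.1 (J z.1 z.2.1) z.2.2 / ∑ c, PJ z.1 (J z.1 z.2.1) c) with hV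
  have hV0 : ∀ z, 0 ≤ V z := fun z =>
    mul_nonneg (hPA0 _) (div_nonneg (hPJ0 _ _ _) (hPJs _ _))
  have hfrac : ∀ a j, ∑ c, PA a * (PJ a j c / ∑ c, PJ a j c) ≤ PA a := by
    intro a j
    rw [← Finset.mul_sum, ← Finset.sum_div]
    exact mul_le_of_le_one_right (hPA0 a) (div_self_le_one _)
  have hpos : ∀ a b c, P a b c ≠ 0 →
      0 < PA a ∧ 0 < PJ a (J a b) c ∧ 0 < ∑ c, PJ a (J a b) c := by
    intro a b c h
    have h0 : 0 < P a b c := lt_of_le_of_ne (hP a b c) (Ne.symm h)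
    exact ⟨h0.trans_le (hle3 a b c), h0.trans_le (hle1 a b c),
      h0.trans_le ((hle1 a b c).trans (hle2 a _ c))⟩
  have hmain := sum_mul_log_div_le (P := fun z : A × B × C => P z.1 z.2.1 z.2.2) (V := V)
    ⟨fun z => hP _ _ _, by simpa only [Fintype.sum_prod_type] using hP1⟩ hV0
    (fun z hz => (mul_pos (hpos _ _ _ hz).1
      (div_pos (hpos _ _ _ hz).2.1 (hpos _ _ _ hz).2.2)).ne')
    (fun z => z.2.1 = D z.1 (J z.1 z.2.1) z.2.2)
    (N := Fintype.card 𝒥) (L := Fintype.card B) (by exact_mod_cast h𝒥) (by positivity) ?_ ?_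
  · simp only [Fintype.sum_prod_type] at hmain
    have hsplit : ∀ a b c, P a b c * Real.log (V (a, b, c) / P a b c) =
        P a b c * Real.log (PA a / P a b c) -
          P a b c * Real.log ((∑ c, PJ a (J a b) c) / PJ a (J a b) c) := by
      intro a b c
      by_cases h : P a b c = 0
      · simp [h]
      obtain ⟨h1, h2, h3⟩ := hpos a b c h
      rw [hV]
      simp only
      rw [Real.log_div (by positivity) h, Real.log_mul h1.ne' (by positivity),
        Real.log_div h2.ne' h3.ne', Real.log_div h1.ne' h, Real.log_div h3.ne' h2.ne']
      ring
    simp only [hsplit, Finset.sum_sub_distrib] at hmain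
    have hH : ∑ a, ∑ b, ∑ c, P a b c * Real.log ((∑ c, PJ a (J a b) c) / PJ a (J a b) c) =
        ∑ a, ∑ j, massEntropy (PJ a j) := by
      refine Finset.sum_congr rfl fun a _ => ?_
      simp only [fun j => massEntropy_eq (hPJ0 a j)]
      rw [Finset.sum_comm, Finset.sum_comm (s := (Finset.univ : Finset 𝒥))]
      refine Finset.sum_congr rfl fun c _ => ?_
      simp only [hPJ, Finset.sum_mul]
      rw [Finset.sum_comm]
      refine Finset.sum_congr rfl fun b _ => ?_
      simp only [ite_mul, zero_mul]
      rw [Finset.sum_ite_eq]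
      simp
    rw [hH] at hmain
    linarith
  · simp only [Fintype.sum_prod_type]
    calc _ ≤ ∑ a, ∑ b, ∑ c, ∑ j : 𝒥, (if b = D a j c then
          PA a * (PJ a j c / ∑ c, PJ a j c) else 0) := by
          refine Finset.sum_le_sum fun a _ => Finset.sum_le_sum fun b _ =>
            Finset.sum_le_sum fun c _ => ?_
          have hn : ∀ j ∈ (Finset.univ : Finset 𝒥), 0 ≤ (if b = D a j c then
              PA a * (PJ a j c / ∑ c, PJ a j c) else 0) := by
            intro j _
            have h1 := mul_nonneg (hPA0 a) (div_nonneg (hPJ0 a j c) (hPJs a j))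
            split_ifs
            · exact h1
            · exact le_rfl
          exact Finset.single_le_sum hn (Finset.mem_univ (J a b))
      _ = ∑ a, ∑ j : 𝒥, ∑ c, PA a * (PJ a j c / ∑ c, PJ a j c) := by
          refine Finset.sum_congr rfl fun a _ => ?_
          rw [Finset.sum_comm, Finset.sum_comm (s := (Finset.univ : Finset 𝒥))]
          refine Finset.sum_congr rfl fun c _ => ?_
          rw [Finset.sum_comm]
          simp
      _ ≤ ∑ a, ∑ j : 𝒥, PA a :=
          Finset.sum_le_sum fun a _ => Finset.sum_le_sum fun j _ => hfrac a j
      _ = Fintype.card 𝒥 := by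
          rw [Finset.sum_comm]; simp [hP1]
  · simp only [Fintype.sum_prod_type]
    calc _ ≤ ∑ a, ∑ b : B, ∑ c, PA a * (PJ a (J a b) c / ∑ c, PJ a (J a b) c) := by
          refine Finset.sum_le_sum fun a _ => Finset.sum_le_sum fun b _ =>
            Finset.sum_le_sum fun c _ => ?_
          have := hV0 (a, b, c)
          split_ifs
          · exact this
          · exact le_rfl
      _ ≤ ∑ a, ∑ b : B, PA a :=
          Finset.sum_le_sum fun a _ => Finset.sum_le_sum fun b _ => hfrac a _
      _ = Fintype.card B := by
          rw [Finset.sum_comm]; simp [hP1]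

end Entropy

/-! ## Convex hulls in finite dimension -/

section Convex

variable {E : Type*} [AddCommGroup E] [Module ℝ E] [FiniteDimensional ℝ E] {S : Set E}

/-- Carathéodory's theorem, padded with zero weights on an arbitrary point of S. An index type
independent of x is what makes a compactness argument over all combinations possible. -/
lemma exists_fin_of_mem_convexHull {x : E} (hx : x ∈ convexHull ℝ S) :
    ∃ w ∈ stdSimplex ℝ (Fin (Module.finrank ℝ E + 1)),
      ∃ z : Fin (Module.finrank ℝ E + 1) → E, (∀ i, z i ∈ S) ∧ ∑ i, w i • z i = x := by
  classical
  obtain ⟨s₀, hs₀⟩ : S.Nonempty := convexHull_nonempty_iff.1 ⟨x, hx⟩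
  obtain ⟨ι, hι, z, w, hz, hind, hw, hw1, hx⟩ := eq_pos_convex_span_of_mem_convexHull hx
  have hcard : Fintype.card ι ≤ Module.finrank ℝ E + 1 :=
    hind.card_le_finrank_succ.trans (Nat.succ_le_succ (Submodule.finrank_le _))
  obtain ⟨f⟩ : Nonempty (ι ↪ Fin (Module.finrank ℝ E + 1)) :=
    Function.Embedding.nonempty_of_card_le (by simpa using hcard)
  have hsum : ∑ j, Function.extend f w (fun _ => (0 : ℝ)) j = ∑ i, w i :=
    (Fintype.sum_of_injective f f.injective w _
      (fun j hj => (Function.extend_apply' w _ j hj).trans rfl)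
      (fun i => (f.injective.extend_apply w _ i).symm)).symm
  refine ⟨Function.extend f w fun _ => (0 : ℝ), ⟨fun j => ?_, ?_⟩,
    Function.extend f z fun _ => s₀, fun j => ?_, ?_⟩
  · by_cases hj : ∃ i, f i = j
    · obtain ⟨i, rfl⟩ := hj
      rw [f.injective.extend_apply]; exact (hw i).le
    · rw [Function.extend_apply' _ _ _ hj]
  · rw [hsum, hw1]
  · by_cases hj : ∃ i, f i = j
    · obtain ⟨i, rfl⟩ := hj
      rw [f.injective.extend_apply]; exact hz ⟨i, rfl⟩
    · rw [Function.extend_apply' _ _ _ hj]; exact hs₀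
  · rw [← hx]
    refine (Fintype.sum_of_injective f f.injective _ _ (fun j hj => ?_) (fun i => ?_)).symm
    · rw [Function.extend_apply' _ _ _ hj]; simp
    · rw [f.injective.extend_apply, f.injective.extend_apply]

/-- If `f` takes arbitrarily small positive values on the convex hull of the compact set `S`, then
it takes a nonpositive value at some convex combination of at most `dim E + 1` points of `S`. -/
lemma exists_convex_combination_nonpos [TopologicalSpace E] [IsTopologicalAddGroup E]
    [ContinuousSMul ℝ E] (hS : IsCompact S) {F : Set E} (hF : IsClosed F) {f : E → ℝ}
    (hf : Continuous f) (h : ∀ ε > 0, ∃ v ∈ convexHull ℝ S, v ∈ F ∧ f v ≤ ε) :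
    ∃ w ∈ stdSimplex ℝ (Fin (Module.finrank ℝ E + 1)),
      ∃ z : Fin (Module.finrank ℝ E + 1) → E, (∀ i, z i ∈ S) ∧ ∑ i, w i • z i ∈ F ∧
        f (∑ i, w i • z i) ≤ 0 := by
  set N := Module.finrank ℝ E + 1
  set K : Set ((Fin N → ℝ) × (Fin N → E)) := stdSimplex ℝ (Fin N) ×ˢ Set.univ.pi fun _ => S
  have hK : IsCompact K := (isCompact_stdSimplex ℝ (Fin N)).prod (isCompact_univ_pi fun _ => hS)
  set comb : (Fin N → ℝ) × (Fin N → E) → E := fun u => ∑ i, u.1 i • u.2 i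
  have hcomb : Continuous comb := by fun_prop
  have hK' : IsCompact (K ∩ comb ⁻¹' F) := hK.inter_right (hF.preimage hcomb)
  have hex : ∀ ε > 0, ∃ u ∈ K ∩ comb ⁻¹' F, f (comb u) ≤ ε := by
    intro ε hε
    obtain ⟨v, hv, hvF, hfv⟩ := h ε hε
    obtain ⟨w, hw, z, hz, rfl⟩ := exists_fin_of_mem_convexHull hv
    exact ⟨(w, z), ⟨⟨hw, fun i _ => hz i⟩, hvF⟩, hfv⟩
  obtain ⟨u₁, hu₁, -⟩ := hex 1 one_pos
  -- Weights and points range over a compact set, so the infimum of f is attained; it lies below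
  -- every ε > 0.
  obtain ⟨u, hu, hmin⟩ := hK'.exists_isMinOn ⟨u₁, hu₁⟩ (hf.comp hcomb).continuousOn
  refine ⟨u.1, hu.1.1, u.2, fun i => hu.1.2 i (Set.mem_univ i), hu.2, ?_⟩
  refine le_of_forall_pos_le_add fun ε hε => ?_
  obtain ⟨u', hu', hfu'⟩ := hex ε hε
  have := isMinOn_iff.1 hmin u' hu'
  simp only [Function.comp] at this
  rw [zero_add]
  exact this.trans hfu'

end Convex

/-! ## Single-letterization -/

section Cone

variable {X₁ X₂ X₃ Y₂ : Type*} [Fintype X₂] [Fintype X₃]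

open Classical in
/-- For a letter `x` of the first source, a mass distribution `r` of the second source and a
reconstruction letter `y`: the mass distribution of the pair, the entropy of the output of the
channel `k x` on the input `r`, and the distortion. -/
def letterPoint (k : X₁ → X₂ → X₃ → ℝ) (d₂ : X₂ → Y₂ → ℝ) (x : X₁) (r : X₂ → ℝ) (y : Y₂) :
    (X₁ × X₂ → ℝ) × ℝ × ℝ :=
  (fun z => ∑ b, r b * (if (x, b) = z then 1 else 0),
    massEntropy fun c => ∑ b, r b * k x b c, ∑ b, r b * d₂ b y)

/-- The points `letterPoint k d₂ x r y` for probability mass functions `r`. -/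
def letterPoints (k : X₁ → X₂ → X₃ → ℝ) (d₂ : X₂ → Y₂ → ℝ) : Set ((X₁ × X₂ → ℝ) × ℝ × ℝ) :=
  {v | ∃ x y, ∃ r ∈ stdSimplex ℝ X₂, letterPoint k d₂ x r y = v}

/-- The cone of the points `letterPoint k d₂ x r y` for nonnegative `r`. -/
def letterCone (k : X₁ → X₂ → X₃ → ℝ) (d₂ : X₂ → Y₂ → ℝ) :
    AddSubmonoid ((X₁ × X₂ → ℝ) × ℝ × ℝ) :=
  AddSubmonoid.closure {v | ∃ x y r, (∀ b, 0 ≤ r b) ∧ letterPoint k d₂ x r y = v}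

lemma letterPoint_smul (k : X₁ → X₂ → X₃ → ℝ) (d₂ : X₂ → Y₂ → ℝ) (x : X₁) (r : X₂ → ℝ) (y : Y₂)
    (w : ℝ) : letterPoint k d₂ x (fun b => w * r b) y = w • letterPoint k d₂ x r y := by
  simp only [letterPoint, mul_assoc, ← Finset.mul_sum, massEntropy_smul, Prod.smul_mk, smul_eq_mul]
  rfl

lemma isCompact_letterPoints [Finite X₁] [Finite Y₂] (k : X₁ → X₂ → X₃ → ℝ) (d₂ : X₂ → Y₂ → ℝ) :
    IsCompact (letterPoints k d₂) := by
  have : letterPoints k d₂ =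
      ⋃ x, ⋃ y, (fun r => letterPoint k d₂ x r y) '' stdSimplex ℝ X₂ := by
    ext v; simp [letterPoints]
  rw [this]
  refine isCompact_iUnion fun x => isCompact_iUnion fun y =>
    (isCompact_stdSimplex ℝ X₂).image ?_
  simp only [letterPoint, massEntropy]
  have := Real.continuous_negMulLog
  fun_prop

/-- A letter point of a nonnegative r is the total mass of r times the point of the normalized r.
The mass is the sum of the first coordinate, hence additive on the cone, and it is the scaling
factor. When it vanishes, any point of the hull serves. -/
lemma exists_smul_of_mem_letterCone [Fintype X₁] [Nonempty X₁] [Nonempty X₂] [Nonempty Y₂]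
    {k : X₁ → X₂ → X₃ → ℝ} {d₂ : X₂ → Y₂ → ℝ} {v : (X₁ × X₂ → ℝ) × ℝ × ℝ}
    (hv : v ∈ letterCone k d₂) :
    ∃ u ∈ convexHull ℝ (letterPoints k d₂), 0 ≤ ∑ z, v.1 z ∧ v = (∑ z, v.1 z) • u := by
  classical
  obtain ⟨u₀, hu₀⟩ : (letterPoints k d₂).Nonempty :=
    ⟨_, Classical.arbitrary _, Classical.arbitrary _, _,
      single_mem_stdSimplex ℝ (Classical.arbitrary X₂), rfl⟩
  have hu₀ := subset_convexHull ℝ _ hu₀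
  induction hv using AddSubmonoid.closure_induction with
  | mem v hv =>
    obtain ⟨x, y, r, hr, rfl⟩ := hv
    have hmass : ∑ z, (letterPoint k d₂ x r y).1 z = ∑ b, r b := by
      simp only [letterPoint]
      rw [Finset.sum_comm]
      simp
    have h0 : 0 ≤ ∑ b, r b := Finset.sum_nonneg fun b _ => hr b
    rw [hmass]
    rcases h0.eq_or_lt with h | h
    · refine ⟨u₀, hu₀, h0, ?_⟩
      have hr0 : r = fun b => 0 * r b := by
        funext b
        rw [zero_mul]
        exact (Finset.sum_eq_zero_iff_of_nonneg fun b _ => hr b).1 h.symm b (Finset.mem_univ b)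
      rw [← h, hr0, letterPoint_smul, zero_smul, zero_smul]
    · refine ⟨letterPoint k d₂ x (fun b => (∑ b, r b)⁻¹ * r b) y, subset_convexHull ℝ _
        ⟨x, y, _, ⟨fun b => mul_nonneg (inv_nonneg.2 h0) (hr b), ?_⟩, rfl⟩, h0, ?_⟩
      · rw [← Finset.mul_sum, inv_mul_cancel₀ h.ne']
      · rw [letterPoint_smul, smul_smul, mul_inv_cancel₀ h.ne', one_smul]
  | zero => exact ⟨u₀, hu₀, by simp, by simp⟩
  | add v₁ v₂ _ _ h₁ h₂ =>
    obtain ⟨u₁, hu₁, hw₁, he₁⟩ := h₁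
    obtain ⟨u₂, hu₂, hw₂, he₂⟩ := h₂
    have hsum : ∑ z, (v₁ + v₂).1 z = ∑ z, v₁.1 z + ∑ z, v₂.1 z := by
      simp [Finset.sum_add_distrib]
    rw [hsum]
    set w₁ := ∑ z, v₁.1 z
    set w₂ := ∑ z, v₂.1 z
    rcases (add_nonneg hw₁ hw₂).eq_or_lt with h | h
    · have h₁ : w₁ = 0 := by linarith
      have h₂ : w₂ = 0 := by linarith
      refine ⟨u₀, hu₀, by linarith, ?_⟩
      rw [he₁, he₂, h₁, h₂]; simp
    · refine ⟨(w₁ / (w₁ + w₂)) • u₁ + (w₂ / (w₁ + w₂)) • u₂,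
        convex_convexHull ℝ _ hu₁ hu₂ (by positivity) (by positivity) (by field_simp), h.le, ?_⟩
      rw [smul_add, smul_smul, smul_smul, mul_div_cancel₀ _ h.ne', mul_div_cancel₀ _ h.ne',
        ← he₁, ← he₂]

lemma sum_cons {S M : Type*} [Fintype S] [AddCommMonoid M] {n : ℕ} (F : (Fin (n + 1) → S) → M) :
    ∑ b, F b = ∑ b₀ : S, ∑ b : Fin n → S, F (Fin.cons b₀ b) := by
  rw [← (Fin.consEquiv fun _ => S).sum_comp, Fintype.sum_prod_type]
  rfl

open Classical in
/-- The letterwise chain rule. -/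
lemma block_mem_letterCone {k : X₁ → X₂ → X₃ → ℝ} (hk : ∀ x b c, 0 ≤ k x b c)
    (hk1 : ∀ x b, ∑ c, k x b c = 1) (d₂ : X₂ → Y₂ → ℝ) :
    ∀ {n : ℕ} (x : Fin n → X₁) (y : Fin n → Y₂) (s : (Fin n → X₂) → ℝ) (_ : ∀ b, 0 ≤ s b),
      ((fun z => ∑ b, s b * ∑ t, if (x t, b t) = z then 1 else 0,
        massEntropy fun c : Fin n → X₃ => ∑ b, s b * ∏ t, k (x t) (b t) (c t),
        ∑ b, s b * ∑ t, d₂ (b t) (y t)) : (X₁ × X₂ → ℝ) × ℝ × ℝ) ∈ letterCone k d₂ := by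
  intro n
  induction n with
  | zero =>
    intro x y s hs
    refine Set.mem_of_eq_of_mem (Prod.ext ?_ (Prod.ext ?_ ?_)) (zero_mem (letterCone k d₂))
    · funext z; simp
    · simp [massEntropy]
    · simp
  | succ n ih =>
    intro x y s hs
    -- The first letter contributes through its marginal r. For each value c₀ of its channel output,
    -- the remaining letters form a block with mass s' c₀, to which the induction hypothesis
    -- applies: this is conditioning on the past of X₃.
    set r : X₂ → ℝ := fun b₀ => ∑ b : Fin n → X₂, s (Fin.cons b₀ b) with hr
    set s' : X₃ → (Fin n → X₂) → ℝ := fun c₀ b =>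
      ∑ b₀, s (Fin.cons b₀ b) * k (x 0) b₀ c₀ with hs'
    have h1 : letterPoint k d₂ (x 0) r (y 0) ∈ letterCone k d₂ :=
      AddSubmonoid.subset_closure ⟨_, _, r, fun b₀ => Finset.sum_nonneg fun b _ => hs _, rfl⟩
    have h2 := sum_mem (t := Finset.univ) fun c₀ (_ : c₀ ∈ Finset.univ) =>
      ih (fun t => x t.succ) (fun t => y t.succ) (s' c₀)
        fun b => Finset.sum_nonneg fun b₀ _ => mul_nonneg (hs _) (hk _ _ _)
    -- Summing over c₀ undoes the conditioning, so the two coordinates linear in s are simply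
    -- additive over letters. Only the entropy coordinate needs the chain rule.
    have hmarg : ∀ Q : (Fin n → X₂) → ℝ,
        ∑ c₀, ∑ b, s' c₀ b * Q b = ∑ b₀, ∑ b, s (Fin.cons b₀ b) * Q b := by
      intro Q
      simp only [hs', Finset.sum_mul]
      rw [Finset.sum_comm, Finset.sum_comm (s := (Finset.univ : Finset X₂))]
      refine Finset.sum_congr rfl fun b _ => ?_
      rw [Finset.sum_comm]
      refine Finset.sum_congr rfl fun b₀ _ => ?_
      simp only [mul_right_comm _ _ (Q b)]
      rw [← Finset.mul_sum, hk1, mul_one]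
    convert add_mem h1 h2 using 1
    refine Prod.ext ?_ (Prod.ext ?_ ?_)
    · funext z
      simp only [Prod.fst_add, Prod.fst_sum, Pi.add_apply, Finset.sum_apply, hmarg, letterPoint]
      rw [sum_cons, ← Finset.sum_add_distrib]
      refine Finset.sum_congr rfl fun b₀ _ => ?_
      rw [hr, Finset.sum_mul, ← Finset.sum_add_distrib]
      refine Finset.sum_congr rfl fun b _ => ?_
      rw [Fin.sum_univ_succ, mul_add]
      simp
    · simp only [Prod.fst_add, Prod.fst_sum, Prod.snd_add, Prod.snd_sum, letterPoint]
      rw [← massEntropy_comp_equiv _ (Fin.consEquiv fun _ => X₃), massEntropy_prod]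
      have hf : ∀ c₀ (c : Fin n → X₃), (∑ b : Fin (n + 1) → X₂, s b * ∏ t, k (x t) (b t)
          (((Fin.consEquiv fun _ => X₃) (c₀, c) : Fin (n + 1) → X₃) t)) =
          ∑ b, s' c₀ b * ∏ t, k (x t.succ) (b t) (c t) := by
        intro c₀ c
        rw [sum_cons, Finset.sum_comm]
        refine Finset.sum_congr rfl fun b _ => ?_
        rw [hs', Finset.sum_mul]
        refine Finset.sum_congr rfl fun b₀ _ => ?_
        rw [Fin.prod_univ_succ, ← mul_assoc]
        simp [Fin.consEquiv]
      simp only [hf]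
      congr 2
      funext c₀
      rw [Finset.sum_comm]
      simp only [← Finset.mul_sum,
        fun b : Fin n → X₂ => sum_prod_blocks fun t => k (x (Fin.succ t)) (b t), hk1,
        Finset.prod_const_one, mul_one]
      rw [hs', Finset.sum_comm]
      simp only [hr, Finset.sum_mul]
    · simp only [Prod.snd_add, Prod.snd_sum, hmarg, letterPoint]
      rw [sum_cons, ← Finset.sum_add_distrib]
      refine Finset.sum_congr rfl fun b₀ _ => ?_
      rw [hr, Finset.sum_mul, ← Finset.sum_add_distrib]
      refine Finset.sum_congr rfl fun b _ => ?_
      rw [Fin.sum_univ_succ, mul_add]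
      simp

end Cone

/-! ## Test channels -/

section TestChannel

variable {X₁ X₂ X₃ Y₁ Y₂ : Type*} [Fintype X₁] [Fintype X₂] [Fintype X₃]

/-- The law of `(X₁, X₂)`. -/
def pairLaw (p : X₁ × X₂ × X₃ → ℝ) : X₁ × X₂ → ℝ :=
  prob p fun x => (x.1, x.2.1)

lemma pairLaw_eq_sum (p : X₁ × X₂ × X₃ → ℝ) (a : X₁) (b : X₂) :
    pairLaw p (a, b) = ∑ c, p (a, b, c) := by
  classical
  rw [pairLaw, prob_eq_sum_ite]
  simp only [Fintype.sum_prod_type, Prod.mk.injEq, ite_and]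
  rw [Finset.sum_eq_single a (fun a' _ ha => by simp [ha]) (by simp),
    Finset.sum_eq_single b (fun b' _ hb => by simp [hb]) (by simp)]
  simp only [if_true]

/-- The conditional law of X₃ given (X₁,X₂), set to uniform at pairs of probability zero so that all
rows sum to one. -/
lemma exists_channel [Nonempty X₃] {p : X₁ × X₂ × X₃ → ℝ} (hp : ∀ x, 0 ≤ p x) :
    ∃ k : X₁ → X₂ → X₃ → ℝ, (∀ a b c, 0 ≤ k a b c) ∧ (∀ a b, ∑ c, k a b c = 1) ∧
      ∀ a b c, p (a, b, c) = pairLaw p (a, b) * k a b c := by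
  classical
  have h0 : ∀ a b, 0 ≤ pairLaw p (a, b) := fun a b => prob_nonneg hp _ _
  refine ⟨fun a b c => if pairLaw p (a, b) = 0 then (Fintype.card X₃ : ℝ)⁻¹ else
    p (a, b, c) / pairLaw p (a, b), fun a b c => ?_, fun a b => ?_, fun a b c => ?_⟩
  · dsimp only
    split_ifs
    · positivity
    · exact div_nonneg (hp _) (h0 a b)
  · by_cases h : pairLaw p (a, b) = 0
    · simp [h]
    · simp only [h, if_false]
      rw [← Finset.sum_div, ← pairLaw_eq_sum, div_self h]
  · by_cases h : pairLaw p (a, b) = 0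
    · rw [h, zero_mul]
      rw [pairLaw_eq_sum] at h
      exact (Finset.sum_eq_zero_iff_of_nonneg fun c _ => hp _).1 h c (Finset.mem_univ c)
    · simp only [h, if_false]
      field_simp

variable {m : ℕ}

lemma prob_fst_of_marginal {p : X₁ × X₂ × X₃ → ℝ} {q : (X₁ × X₂ × X₃) × Fin m → ℝ}
    (h : ∀ x, ∑ u, q (x, u) = p x) : prob q Prod.fst = p := by
  classical
  funext x
  rw [prob_eq_sum_ite, ← h x, Fintype.sum_prod_type, Finset.sum_comm]
  simp

variable {θ : X₁ → X₂ → Fin m → ℝ} {k : X₁ → X₂ → X₃ → ℝ}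

/-- The rate of node 2 equals H(X₂X₃|X₁) − H(X₃|U X₁). The first term does not involve U and the
second is linear in the mixture over U, which is what the convexity argument needs. -/
lemma condInfo_add_condEntropy_eq {p : X₁ × X₂ × X₃ → ℝ} (hp : ∀ x, 0 ≤ p x)
    (hk1 : ∀ a b, ∑ c, k a b c = 1) (hpk : ∀ a b c, p (a, b, c) = pairLaw p (a, b) * k a b c)
    (hθp : ∀ a b, ∑ u, θ a b u = pairLaw p (a, b)) {q : (X₁ × X₂ × X₃) × Fin m → ℝ}
    (hq0 : ∀ ω, 0 ≤ q ω) (hq : ∀ a b c u, q ((a, b, c), u) = θ a b u * k a b c) :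
    condMutualInfo q rvU rvX₂ rvX₁ + condEntropy q rvX₂ (fun ω => (rvU ω, rvX₁ ω, rvX₃ ω)) =
      condEntropy p Prod.snd Prod.fst -
        ∑ u, ∑ a, massEntropy (fun c => ∑ b, θ a b u * k a b c) := by
  classical
  have hfst : prob q Prod.fst = p := by
    refine prob_fst_of_marginal fun ⟨a, b, c⟩ => ?_
    simp only [hq, ← Finset.sum_mul, hθp, ← hpk]
  have hsum : ∀ F : (X₁ × X₂ × X₃) × Fin m → ℝ,
      ∑ ω, F ω = ∑ u, ∑ a, ∑ b, ∑ c, F ((a, b, c), u) := by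
    intro F
    rw [Fintype.sum_prod_type_right]
    simp only [Fintype.sum_prod_type]
  have e₁ : jointEntropy q rvX₁ = jointEntropy p Prod.fst := by
    rw [← hfst, jointEntropy, jointEntropy, prob_prob]; rfl
  have e₂ : jointEntropy q (fun ω => (rvX₂ ω, rvX₁ ω)) =
      ∑ a, ∑ b, Real.negMulLog (pairLaw p (a, b)) := by
    rw [jointEntropy, Fintype.sum_prod_type, Finset.sum_comm]
    refine Finset.sum_congr rfl fun a _ => Finset.sum_congr rfl fun b _ => ?_
    rw [pairLaw, ← hfst, prob_prob, prob_eq_sum_ite, prob_eq_sum_ite]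
    simp only [rvX₁, rvX₂, Prod.mk.injEq, and_comm]
  have e₃ : jointEntropy q (fun ω => (rvU ω, rvX₂ ω, rvX₁ ω)) =
      ∑ u, ∑ a, ∑ b, Real.negMulLog (θ a b u) := by
    rw [jointEntropy, Fintype.sum_prod_type]
    refine Finset.sum_congr rfl fun u _ => ?_
    rw [Fintype.sum_prod_type, Finset.sum_comm]
    refine Finset.sum_congr rfl fun a _ => Finset.sum_congr rfl fun b _ => ?_
    rw [prob_eq_sum_ite, hsum]
    simp only [rvU, rvX₁, rvX₂, Prod.mk.injEq, ite_and, Finset.sum_ite_irrel,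
      Finset.sum_const_zero, Finset.sum_ite_eq', Finset.mem_univ, if_true, hq, ← Finset.mul_sum,
      hk1, mul_one]
  have e₄ : jointEntropy q (fun ω => (rvX₂ ω, rvU ω, rvX₁ ω, rvX₃ ω)) =
      ∑ u, ∑ a, ∑ b, ∑ c, Real.negMulLog (θ a b u * k a b c) := by
    rw [jointEntropy, Fintype.sum_prod_type, Finset.sum_comm, Fintype.sum_prod_type]
    refine Finset.sum_congr rfl fun u _ => ?_
    rw [Fintype.sum_prod_type]
    refine Finset.sum_congr rfl fun a _ => ?_
    rw [Finset.sum_comm]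
    refine Finset.sum_congr rfl fun b _ => Finset.sum_congr rfl fun c _ => ?_
    rw [prob_eq_sum_ite, hsum]
    simp only [rvU, rvX₁, rvX₂, rvX₃, Prod.mk.injEq, ite_and, Finset.sum_ite_irrel,
      Finset.sum_const_zero, Finset.sum_ite_eq', Finset.mem_univ, if_true, hq]
  have e₅ : jointEntropy q (fun ω => (rvU ω, rvX₁ ω, rvX₃ ω)) - jointEntropy q
      (fun ω => (rvU ω, rvX₁ ω)) =
      ∑ u, ∑ a, massEntropy (fun c => ∑ b, θ a b u * k a b c) := by
    simp only [jointEntropy, Fintype.sum_prod_type]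
    rw [← Finset.sum_sub_distrib]
    refine Finset.sum_congr rfl fun u _ => ?_
    rw [← Finset.sum_sub_distrib]
    refine Finset.sum_congr rfl fun a _ => ?_
    have h1 : ∀ c, prob q (fun ω => (rvU ω, rvX₁ ω, rvX₃ ω)) (u, a, c) =
        ∑ b, θ a b u * k a b c := by
      intro c
      rw [prob_eq_sum_ite, hsum]
      simp only [rvU, rvX₁, rvX₃, Prod.mk.injEq, ite_and, Finset.sum_ite_irrel,
        Finset.sum_const_zero, Finset.sum_ite_eq', Finset.mem_univ, if_true, hq]
    have h2 : prob q (fun ω => (rvU ω, rvX₁ ω)) (u, a) = ∑ c, ∑ b, θ a b u * k a b c := by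
      rw [prob_eq_sum_ite, hsum, Finset.sum_comm (s := (Finset.univ : Finset X₃))]
      simp only [rvU, rvX₁, Prod.mk.injEq, ite_and, Finset.sum_ite_irrel,
        Finset.sum_const_zero, Finset.sum_ite_eq', Finset.mem_univ, if_true, hq]
    rw [h2, massEntropy]
    simp only [h1]
  have e₆ : jointEntropy p (fun x => (x.2, x.1)) =
      ∑ a, ∑ b, ∑ c, Real.negMulLog (pairLaw p (a, b) * k a b c) := by
    simp only [← hpk]
    rw [jointEntropy, Fintype.sum_prod_type, Finset.sum_comm]
    refine Finset.sum_congr rfl fun a _ => ?_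
    rw [Fintype.sum_prod_type]
    refine Finset.sum_congr rfl fun b _ => Finset.sum_congr rfl fun c _ => ?_
    rw [prob_eq_sum_ite]
    simp only [Fintype.sum_prod_type, Prod.mk.injEq, ite_and, Finset.sum_ite_eq', Finset.mem_univ,
      if_true]
  -- The Markov chain enters here: H(X₃|U X₁X₂) = H(X₃|X₁X₂), as both equal the mean entropy of the
  -- channel rows.
  have e₇ : ∑ u, ∑ a, ∑ b, ∑ c, Real.negMulLog (θ a b u * k a b c) -
      ∑ u, ∑ a, ∑ b, Real.negMulLog (θ a b u) =
      ∑ a, ∑ b, ∑ c, Real.negMulLog (pairLaw p (a, b) * k a b c) -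
        ∑ a, ∑ b, Real.negMulLog (pairLaw p (a, b)) := by
    have hs : ∀ (x : ℝ) a b, ∑ c, Real.negMulLog (x * k a b c) =
        Real.negMulLog x + x * ∑ c, Real.negMulLog (k a b c) := by
      intro x a b
      simp only [Real.negMulLog_mul, Finset.sum_add_distrib, ← Finset.sum_mul, ← Finset.mul_sum,
        hk1, one_mul]
    simp only [hs, Finset.sum_add_distrib, add_sub_cancel_left]
    rw [Finset.sum_comm]
    refine Finset.sum_congr rfl fun a _ => ?_
    rw [Finset.sum_comm]
    refine Finset.sum_congr rfl fun b _ => ?_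
    rw [← Finset.sum_mul, hθp]
  have hp' := condEntropy_eq_sub hp (Prod.snd : X₁ × X₂ × X₃ → X₂ × X₃) Prod.fst
  rw [condMutualInfo, condEntropy_eq_sub hq0, condEntropy_eq_sub hq0, condEntropy_eq_sub hq0, hp',
    ← e₅]
  linarith

/-- A mixture of letter distributions with the right marginal defines an admissible auxiliary
random variable. -/
lemma exists_admissible {p : X₁ × X₂ × X₃ → ℝ} (hp : p ∈ stdSimplex ℝ (X₁ × X₂ × X₃))
    (hk : ∀ a b c, 0 ≤ k a b c) (hk1 : ∀ a b, ∑ c, k a b c = 1)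
    (hpk : ∀ a b c, p (a, b, c) = pairLaw p (a, b) * k a b c)
    {d₁ : X₁ → Y₁ → ℝ} {d₂ : X₂ → Y₂ → ℝ} {D₃₁ D₁₂ R₁ R₂ : ℝ} (g : X₁ → Y₁)
    (hg : ∑ x, p x * d₁ x.1 (g x.1) ≤ D₃₁) {w : Fin m → ℝ} (hw : w ∈ stdSimplex ℝ (Fin m))
    (x : Fin m → X₁) (r : Fin m → X₂ → ℝ) (hr : ∀ u, r u ∈ stdSimplex ℝ X₂) (y : Fin m → Y₂)
    (hmarg : (∑ u, w u • letterPoint k d₂ (x u) (r u) (y u)).1 = pairLaw p)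
    (hdist : (∑ u, w u • letterPoint k d₂ (x u) (r u) (y u)).2.2 ≤ D₁₂)
    (hR₂ : condEntropy p Prod.snd Prod.fst -
      (∑ u, w u • letterPoint k d₂ (x u) (r u) (y u)).2.1 ≤ R₂)
    (hR₁ : condEntropy p (fun x => x.1) (fun x => x.2.1) ≤ R₁)
    (hR₁₂ : condEntropy p (fun x => (x.1, x.2.1)) (fun x => x.2.2) ≤ R₁ + R₂) :
    ∃ q : (X₁ × X₂ × X₃) × Fin m → ℝ,
      IsAdmissible p d₁ d₂ D₃₁ D₁₂ q ∧ (R₁, R₂) ∈ ratePairs q := by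
  classical
  -- The joint law of (X₁, X₂, U) with U the index of the point: given U = u, X₁ equals x u and X₂
  -- has law r u.
  set θ : X₁ → X₂ → Fin m → ℝ := fun a b u => w u * (if x u = a then r u b else 0) with hθ
  have hθ0 : ∀ a b u, 0 ≤ θ a b u := by
    intro a b u
    have h1 := hw.1 u
    have h2 := (hr u).1 b
    simp only [hθ]
    split_ifs
    · exact mul_nonneg h1 h2
    · simp
  have hθp : ∀ a b, ∑ u, θ a b u = pairLaw p (a, b) := by
    intro a b
    rw [← hmarg]
    simp only [Prod.fst_sum, Finset.sum_apply, Prod.smul_fst, Pi.smul_apply, smul_eq_mul,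
      letterPoint, hθ]
    refine Finset.sum_congr rfl fun u _ => ?_
    congr 1
    by_cases h : x u = a <;> simp [h]
  set q : (X₁ × X₂ × X₃) × Fin m → ℝ := fun ω =>
    θ ω.1.1 ω.1.2.1 ω.2 * k ω.1.1 ω.1.2.1 ω.1.2.2 with hq
  have hq0 : ∀ ω, 0 ≤ q ω := fun ω => mul_nonneg (hθ0 _ _ _) (hk _ _ _)
  have hmg : ∀ x, ∑ u, q (x, u) = p x := by
    rintro ⟨a, b, c⟩
    simp only [hq, ← Finset.sum_mul, hθp, ← hpk]
  have hfst := prob_fst_of_marginal hmg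
  have hsum : ∀ F : (X₁ × X₂ × X₃) × Fin m → ℝ,
      ∑ ω, F ω = ∑ u, ∑ a, ∑ b, ∑ c, F ((a, b, c), u) := by
    intro F
    rw [Fintype.sum_prod_type_right]
    simp only [Fintype.sum_prod_type]
  -- Since u determines X₁, node 3 may apply g to X₁ itself, and node 1 uses the reconstruction
  -- letter stored in the point.
  refine ⟨q, ⟨⟨hq0, ?_⟩, hmg, ?_, ⟨fun b c u => g (x u), ?_⟩, ⟨fun a u => y u, ?_⟩⟩, ?_, ?_, ?_⟩
  · rw [Fintype.sum_prod_type]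
    simp only [hmg, hp.2]
  · rintro u ⟨a, b⟩ c
    have h1 : prob q (fun ω => (rvU ω, (rvX₁ ω, rvX₂ ω), rvX₃ ω)) (u, (a, b), c) =
        θ a b u * k a b c := by
      rw [prob_eq_sum_ite, hsum]
      simp only [rvU, rvX₁, rvX₂, rvX₃, Prod.mk.injEq, ite_and, Finset.sum_ite_irrel,
        Finset.sum_const_zero, Finset.sum_ite_eq', Finset.mem_univ, if_true, hq]
    have h2 : prob q (fun ω => (rvU ω, (rvX₁ ω, rvX₂ ω))) (u, (a, b)) = θ a b u := by
      rw [prob_eq_sum_ite, hsum]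
      simp only [rvU, rvX₁, rvX₂, Prod.mk.injEq, ite_and, Finset.sum_ite_irrel,
        Finset.sum_const_zero, Finset.sum_ite_eq', Finset.mem_univ, if_true, hq,
        ← Finset.mul_sum, hk1, mul_one]
    have h3 : prob q (fun ω => (rvX₁ ω, rvX₂ ω)) (a, b) = pairLaw p (a, b) := by
      rw [pairLaw, ← hfst, prob_prob]; rfl
    have h4 : prob q (fun ω => ((rvX₁ ω, rvX₂ ω), rvX₃ ω)) ((a, b), c) = p (a, b, c) := by
      have : prob q (fun ω => ((rvX₁ ω, rvX₂ ω), rvX₃ ω)) =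
          prob p (fun x => ((x.1, x.2.1), x.2.2)) := by
        rw [← hfst, prob_prob]; rfl
      rw [this, prob_eq_sum_ite]
      simp only [Fintype.sum_prod_type, Prod.mk.injEq, ite_and, Finset.sum_ite_irrel,
        Finset.sum_const_zero, Finset.sum_ite_eq', Finset.mem_univ, if_true]
    rw [h1, h2, h3, h4, hpk]
    ring
  · refine le_trans (le_of_eq ?_) hg
    rw [Fintype.sum_prod_type]
    refine Finset.sum_congr rfl fun z _ => ?_
    rw [← hmg z, Finset.sum_mul]
    refine Finset.sum_congr rfl fun u _ => ?_
    simp only [rvX₁, rvU, hq, hθ]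
    by_cases h : x u = z.1 <;> simp [h]
  · refine le_trans (le_of_eq ?_) hdist
    rw [hsum]
    simp only [Prod.snd_sum, Prod.smul_snd, smul_eq_mul, letterPoint, hq, rvX₂, rvU]
    refine Finset.sum_congr rfl fun u _ => ?_
    simp only [mul_right_comm _ (k _ _ _), ← Finset.mul_sum, hk1, mul_one]
    rw [Finset.sum_comm, Finset.mul_sum]
    refine Finset.sum_congr rfl fun b _ => ?_
    simp only [hθ, mul_ite, mul_zero, ite_mul, zero_mul, Finset.sum_ite_eq, Finset.mem_univ,
      if_true, mul_assoc]
  · refine le_trans (le_of_eq ?_) hR₁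
    conv_rhs => rw [← hfst, condEntropy_prob]
    rfl
  · refine le_trans (le_of_eq ?_) hR₂
    rw [condInfo_add_condEntropy_eq hp.1 hk1 hpk hθp hq0 fun a b c u => rfl]
    congr 1
    simp only [Prod.snd_sum, Prod.fst_sum, Prod.smul_snd, Prod.smul_fst, smul_eq_mul, letterPoint]
    refine Finset.sum_congr rfl fun u _ => ?_
    simp only [hθ, mul_assoc, ← Finset.mul_sum, massEntropy_smul]
    congr 1
    rw [Finset.sum_eq_single (x u)]
    · simp
    · intro a _ ha
      simp [Ne.symm ha, massEntropy]
    · simp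
  · refine le_trans (le_of_eq ?_) hR₁₂
    conv_rhs => rw [← hfst, condEntropy_prob]
    rfl

end TestChannel

/-! ## The converse -/

section Converse

variable {X₁ X₂ X₃ Y₁ Y₂ : Type*} {n K : ℕ}

/-- Given node 1's block, its messages add nothing to those of node 2. This is why the bound on R₂
involves neither R₁ nor the number of rounds. -/
lemma InteractiveCode.J₁_eq (c : InteractiveCode X₁ X₂ X₃ Y₁ Y₂ n K) (x : Fin n → X₁ × X₂ × X₃) :
    c.J₁ x = fun l => c.f₁ l (fun t => (x t).1) fun k _ => c.J₂ x k := by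
  funext l
  rw [InteractiveCode.J₁, InteractiveCode.messages]
  rfl

lemma log_card_pi {M : Fin K → ℕ} (hM : ∀ l, 0 < M l) :
    Real.log (Fintype.card (∀ l, Fin (M l))) = ∑ l, Real.log (M l) := by
  rw [Fintype.card_pi]
  push_cast
  simp only [Fintype.card_fin]
  exact Real.log_prod fun l _ => by exact_mod_cast (hM l).ne'

lemma nonempty_of_mem_stdSimplex {S : Type*} [Fintype S] {p : S → ℝ} (hp : p ∈ stdSimplex ℝ S) :
    Nonempty S := by
  by_contra h
  rw [not_nonempty_iff] at h
  simpa using hp.2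

variable [Fintype X₁] [Fintype X₂] [Fintype X₃] {p : X₁ × X₂ × X₃ → ℝ}

lemma mul_condEntropy_fst_le (hp : p ∈ stdSimplex ℝ (X₁ × X₂ × X₃))
    (c : InteractiveCode X₁ X₂ X₃ Y₁ Y₂ n K) {ε : ℝ}
    (h : blockPr p {x | (fun t => (x t).1) ≠ c.out₂₁ x} ≤ ε) :
    n * condEntropy p (fun x => x.1) (fun x => x.2.1) ≤
      Real.log 2 + ∑ l, Real.log (c.M₁ l) + ε * (n * Real.log (Fintype.card X₁)) := by
  obtain ⟨x₀⟩ := nonempty_of_mem_stdSimplex hp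
  rw [← log_card_pi fun l => Fin.pos (c.J₁ (fun _ => x₀) l)]
  have hb := mul_condEntropy_le (prob_mem_stdSimplex hp fun x => (x.1, x.2.1))
    (fun z : Fin n → X₁ × X₂ => fun l => (c.messages (fun t => (z t).1) (fun t => (z t).2) l).1)
    c.g₂₁ (ε := ε) ?_
  · rwa [condEntropy_prob] at hb
  · rw [← blockPr_comp]
    exact h

/-- Node 3 sees all messages; having recovered X₂ⁿ, it runs node 2's decoder to get X₁ⁿ. The two
error probabilities add up, whence 2ε. -/
lemma mul_condEntropy_pair_le (hp : p ∈ stdSimplex ℝ (X₁ × X₂ × X₃))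
    (c : InteractiveCode X₁ X₂ X₃ Y₁ Y₂ n K) {ε : ℝ}
    (h₁ : blockPr p {x | (fun t => (x t).1) ≠ c.out₂₁ x} ≤ ε)
    (h₂ : blockPr p {x | (fun t => (x t).2.1) ≠ c.out₃₂ x} ≤ ε) :
    n * condEntropy p (fun x => (x.1, x.2.1)) (fun x => x.2.2) ≤
      Real.log 2 + (∑ l, Real.log (c.M₁ l) + ∑ l, Real.log (c.M₂ l)) +
        2 * ε * (n * Real.log (Fintype.card (X₁ × X₂))) := by
  obtain ⟨x₀⟩ := nonempty_of_mem_stdSimplex hp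
  have hM₁ := fun l => Fin.pos (c.J₁ (fun _ => x₀) l)
  have hM₂ := fun l => Fin.pos (c.J₂ (fun _ => x₀) l)
  have hcard : Real.log (Fintype.card ((∀ l, Fin (c.M₁ l)) × (∀ l, Fin (c.M₂ l)))) =
      ∑ l, Real.log (c.M₁ l) + ∑ l, Real.log (c.M₂ l) := by
    rw [← log_card_pi hM₁, ← log_card_pi hM₂, Fintype.card_prod, Nat.cast_mul, Real.log_mul]
    · have : Nonempty (∀ l, Fin (c.M₁ l)) := ⟨c.J₁ fun _ => x₀⟩
      exact_mod_cast Fintype.card_ne_zero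
    · have : Nonempty (∀ l, Fin (c.M₂ l)) := ⟨c.J₂ fun _ => x₀⟩
      exact_mod_cast Fintype.card_ne_zero
  rw [← hcard]
  have hb := mul_condEntropy_le (prob_mem_stdSimplex hp fun x => ((x.1, x.2.1), x.2.2))
    (fun z : Fin n → (X₁ × X₂) × X₃ =>
      (fun l => (c.messages (fun t => (z t).1.1) (fun t => (z t).1.2) l).1,
        fun l => (c.messages (fun t => (z t).1.1) (fun t => (z t).1.2) l).2))
    (fun g j t => (c.g₂₁ (c.g₃₂ g j.1 j.2) j.1 t, c.g₃₂ g j.1 j.2 t)) (ε := 2 * ε) ?_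
  · rwa [condEntropy_prob] at hb
  · rw [← blockPr_comp]
    refine (blockPr_mono (F := {x | (fun t => (x t).1) ≠ c.out₂₁ x} ∪
      {x | (fun t => (x t).2.1) ≠ c.out₃₂ x}) hp.1 fun x _ hx => ?_).trans
      ((blockPr_union_le hp.1 _ _).trans (by linarith))
    by_contra hcon
    simp only [Set.mem_union, Set.mem_ofPred_eq, not_or, not_not] at hcon
    refine hx ?_
    have e₂ : (fun t => (x t).2.1) = c.g₃₂ (fun t => (x t).2.2) (c.J₁ x) (c.J₂ x) := hcon.2
    have e₁ : (fun t => (x t).1) = c.g₂₁ (fun t => (x t).2.1) (c.J₁ x) := hcon.1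
    funext t
    refine Prod.ext ?_ (congrFun e₂ t)
    change (x t).1 = c.g₂₁ (c.g₃₂ (fun t => (x t).2.2) (c.J₁ x) (c.J₂ x)) (c.J₁ x) t
    rw [← e₂]
    exact congrFun e₁ t

/-- The point of the convex hull of the letter points that a code for the blocks defines. -/
lemma exists_mem_convexHull_of_code [Nonempty Y₂] (hp : p ∈ stdSimplex ℝ (X₁ × X₂ × X₃))
    (c : InteractiveCode X₁ X₂ X₃ Y₁ Y₂ n K)
    (hn : 0 < n) {k : X₁ → X₂ → X₃ → ℝ}
    (hk : ∀ a b c, 0 ≤ k a b c) (hk1 : ∀ a b, ∑ c, k a b c = 1)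
    (hpk : ∀ a b c, p (a, b, c) = pairLaw p (a, b) * k a b c) (d₂ : X₂ → Y₂ → ℝ) :
    ∃ u ∈ convexHull ℝ (letterPoints k d₂), u.1 = pairLaw p ∧
      u.2.2 = blockExp p (fun x => blockDist d₂ (fun t => (x t).2.1) (c.out₁₂ x)) ∧
      n * condEntropy p Prod.snd Prod.fst ≤ Real.log 2 + ∑ l, Real.log (c.M₂ l) +
        blockPr p {x | (fun t => (x t).2.1) ≠ c.out₃₂ x} * (n * Real.log (Fintype.card X₂)) +
        n * u.2.1 := by
  classical
  obtain ⟨x₀⟩ := nonempty_of_mem_stdSimplex hp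
  have hX₁ : Nonempty X₁ := ⟨x₀.1⟩
  have hX₂ : Nonempty X₂ := ⟨x₀.2.1⟩
  have hn' : (n : ℝ) ≠ 0 := by exact_mod_cast hn.ne'
  have hpl : pairLaw p ∈ stdSimplex ℝ (X₁ × X₂) := prob_mem_stdSimplex hp _
  set J : (Fin n → X₁) → (Fin n → X₂) → (∀ l, Fin (c.M₂ l)) := fun a b l =>
    (c.messages a b l).2 with hJ
  set s : (Fin n → X₁) → (∀ l, Fin (c.M₂ l)) → (Fin n → X₂) → ℝ := fun a j b =>
    if J a b = j then blockProb (pairLaw p) (fun t => (a t, b t)) else 0 with hs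
  have hs0 : ∀ a j b, 0 ≤ s a j b := by
    intro a j b
    simp only [hs]
    split_ifs
    · exact blockProb_nonneg hpl.1 _
    · exact le_rfl
  have hsj : ∀ (a : Fin n → X₁) (Q : (Fin n → X₂) → (∀ l, Fin (c.M₂ l)) → ℝ),
      ∑ j, ∑ b, s a j b * Q b j =
        ∑ b, blockProb (pairLaw p) (fun t => (a t, b t)) * Q b (J a b) := by
    intro a Q
    rw [Finset.sum_comm]
    refine Finset.sum_congr rfl fun b _ => ?_
    simp only [hs, ite_mul, zero_mul]
    rw [Finset.sum_ite_eq]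
    simp
  -- Sum over the events {X₁ⁿ = a, J₂ = j}, on each of which node 1's output is a fixed word. The
  -- middle coordinate is H(X₃ⁿ|X₁ⁿJ₂).
  set v := ∑ a, ∑ j, (((fun z => ∑ b, s a j b * ∑ t, if (a t, b t) = z then 1 else 0,
        massEntropy fun c : Fin n → X₃ => ∑ b, s a j b * ∏ t, k (a t) (b t) (c t),
        ∑ b, s a j b * ∑ t, d₂ (b t) (c.g₁₂ a j t)) : (X₁ × X₂ → ℝ) × ℝ × ℝ)) with hv
  have hmem : v ∈ letterCone k d₂ := sum_mem fun a _ => sum_mem fun j _ =>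
    block_mem_letterCone hk hk1 d₂ a (c.g₁₂ a j) (s a j) (hs0 a j)
  obtain ⟨u, hu, -, huv⟩ := exists_smul_of_mem_letterCone hmem
  have hv1 : v.1 = fun z => n * pairLaw p z := by
    funext z
    simp only [hv, Prod.fst_sum, Finset.sum_apply]
    simp only [fun a : Fin n → X₁ => hsj a fun b _ => ∑ t, if (a t, b t) = z then (1 : ℝ) else 0]
    rw [← sum_blocks_prod (fun x : Fin n → X₁ × X₂ => blockProb (pairLaw p) x *
      ∑ t, if x t = z then (1 : ℝ) else 0),
      sum_blockProb_sum hpl fun y => if y = z then (1 : ℝ) else 0]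
    simp
  -- Each of the n letters contributes total mass one, so normalizing the cone point is averaging
  -- over time.
  have hmass : ∑ z, v.1 z = n := by
    rw [hv1, ← Finset.mul_sum, hpl.2, mul_one]
  rw [hmass] at huv
  have hu1 : u.1 = pairLaw p := by
    funext z
    have := congrFun (congrArg Prod.fst huv) z
    rw [hv1] at this
    simp only [Prod.smul_fst, Pi.smul_apply, smul_eq_mul] at this
    exact (mul_left_cancel₀ hn' this).symm
  have hblock : ∀ (a : Fin n → X₁) (b : Fin n → X₂) (c : Fin n → X₃),
      blockProb p (fun t => (a t, b t, c t)) =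
        blockProb (pairLaw p) (fun t => (a t, b t)) * ∏ t, k (a t) (b t) (c t) := by
    intro a b c
    simp only [blockProb, hpk, Finset.prod_mul_distrib]
  have hsum3 : ∀ F : (Fin n → X₁ × X₂ × X₃) → ℝ, ∑ x, F x =
      ∑ a : Fin n → X₁, ∑ b : Fin n → X₂, ∑ c : Fin n → X₃, F (fun t => (a t, b t, c t)) := by
    intro F
    rw [sum_blocks_prod]
    refine Finset.sum_congr rfl fun a _ => ?_
    rw [sum_blocks_prod]
  refine ⟨u, hu, hu1, ?_, ?_⟩
  · have h2 : v.2.2 = n * u.2.2 := by rw [huv]; rfl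
    have h3 : v.2.2 = ∑ a : Fin n → X₁, ∑ b, blockProb (pairLaw p) (fun t => (a t, b t)) *
        ∑ t, d₂ (b t) (c.g₁₂ a (J a b) t) := by
      simp only [hv, Prod.snd_sum]
      exact Finset.sum_congr rfl fun a _ => hsj a fun b j => ∑ t, d₂ (b t) (c.g₁₂ a j t)
    rw [← sum_blocks_prod (fun x : Fin n → X₁ × X₂ => blockProb (pairLaw p) x *
      ∑ t, d₂ (x t).2 (c.g₁₂ (fun t => (x t).1)
        (J (fun t => (x t).1) (fun t => (x t).2)) t)), pairLaw,
      ← sum_blockProb_comp p (fun x => (x.1, x.2.1)) (fun x => ∑ t, d₂ (x t).2 (c.g₁₂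
        (fun t => (x t).1) (J (fun t => (x t).1) (fun t => (x t).2)) t))] at h3
    rw [eq_div_of_mul_eq hn' ((mul_comm _ _).trans (h2.symm.trans h3)), blockExp]
    simp only [blockDist, mul_left_comm _ (1 / (n : ℝ)) _, ← Finset.mul_sum]
    rw [div_eq_mul_one_div, mul_comm]
    rfl
  · have h2 : v.2.1 = n * u.2.1 := by rw [huv]; rfl
    have h3 : v.2.1 = ∑ a, ∑ j, massEntropy (fun c : Fin n → X₃ =>
        ∑ b, if J a b = j then blockProb p (fun t => (a t, b t, c t)) else 0) := by
      simp only [hv, Prod.snd_sum, Prod.fst_sum, hs, ite_mul, zero_mul, hblock]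
    have hmarg : ∀ a : Fin n → X₁, ∑ b : Fin n → X₂, ∑ c : Fin n → X₃,
        blockProb p (fun t => (a t, b t, c t)) = blockProb (prob p Prod.fst) a := by
      intro a
      rw [← sum_blocks_prod (fun z : Fin n → X₂ × X₃ => blockProb p (fun t => (a t, z t)))]
      simp only [blockProb]
      rw [sum_prod_blocks fun t s => p (a t, s)]
      refine Finset.prod_congr rfl fun t _ => ?_
      rw [prob_eq_sum_ite, Fintype.sum_prod_type fun s => if s.1 = a t then p s else 0,
        Finset.sum_comm (s := (Finset.univ : Finset X₁))]
      simp
    -- The decoder is that of node 3, with node 1's messages recomputed from a and j.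
    have hmain := sum_mul_log_le_massEntropy
      (P := fun (a : Fin n → X₁) (b : Fin n → X₂) (c : Fin n → X₃) =>
        blockProb p (fun t => (a t, b t, c t))) (fun a b c => blockProb_nonneg hp.1 _)
      (by rw [← hsum3, sum_blockProb hp]) J
      (fun a j z => c.g₃₂ z (fun l => c.f₁ l a fun k _ => j k) j)
    simp only [hmarg] at hmain
    rw [← hsum3 fun x => blockProb p x * Real.log
      (blockProb (prob p Prod.fst) (fun t => (x t).1) / blockProb p x),
      sum_blockProb_mul_log hp Prod.snd Prod.fst
        (fun x y h => Prod.ext (congrArg Prod.snd h) (congrArg Prod.fst h)), ← h3, h2,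
      log_card_pi fun l => Fin.pos (c.J₂ (fun _ => x₀) l)] at hmain
    refine hmain.trans (le_of_eq ?_)
    congr 3
    · rw [blockPr_eq_sum_ite, hsum3]
      refine Finset.sum_congr rfl fun a _ => Finset.sum_congr rfl fun b _ =>
        Finset.sum_congr rfl fun z _ => ?_
      have hiff : b = c.g₃₂ z (fun l => c.f₁ l a fun k _ => J a b k) (J a b) ↔
          (fun t => (a t, b t, z t)) ∉ {x : Fin n → X₁ × X₂ × X₃ |
            (fun t => (x t).2.1) ≠ c.out₃₂ x} := by
        rw [Set.mem_ofPred_eq, not_not, InteractiveCode.out₃₂, InteractiveCode.J₁_eq]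
        rfl
      by_cases hb : b = c.g₃₂ z (fun l => c.f₁ l a fun k _ => J a b k) (J a b)
      · rw [if_pos hb, if_neg (hiff.1 hb)]
      · rw [if_neg hb, if_pos (by_contra fun hc => hb (hiff.2 hc))]
    · rw [Fintype.card_pi]
      simp [Real.log_pow]

lemma blockExp_mono (hp : ∀ x, 0 ≤ p x) {F G : (Fin n → X₁ × X₂ × X₃) → ℝ}
    (h : ∀ x, F x ≤ G x) : blockExp p F ≤ blockExp p G :=
  Finset.sum_le_sum fun x _ => mul_le_mul_of_nonneg_left (h x) (blockProb_nonneg hp x)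

lemma blockExp_blockDist_letter (hp : p ∈ stdSimplex ℝ (X₁ × X₂ × X₃))
    (hn : 0 < n) {S T : Type*} (f : X₁ × X₂ × X₃ → S)
    (g : X₁ × X₂ × X₃ → T) (d : S → T → ℝ) :
    blockExp p (fun x : Fin n → X₁ × X₂ × X₃ => blockDist d (fun t => f (x t)) fun t => g (x t)) =
      ∑ x, p x * d (f x) (g x) := by
  have hn' : (n : ℝ) ≠ 0 := by exact_mod_cast hn.ne'
  simp only [blockExp, blockDist, mul_left_comm _ (1 / (n : ℝ)) _, ← Finset.mul_sum]
  rw [sum_blockProb_sum hp fun x => d (f x) (g x)]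
  field_simp

/-- The conditions free of U are closed and survive ε → 0 directly. Those on the rate of node 2 and
on its distortion at node 1 must hold for one common U, so they are combined into a maximum that is
minimized over convex combinations. -/
theorem mem_singleLetterRegion_of_isAchievable [Fintype Y₁] [Fintype Y₂]
    (hp : p ∈ stdSimplex ℝ (X₁ × X₂ × X₃)) {d₁ : X₁ → Y₁ → ℝ}
    {d₂ : X₂ → Y₂ → ℝ} {D₃₁ D₁₂ R₁ R₂ : ℝ} (h : IsAchievable p d₁ d₂ D₃₁ D₁₂ K R₁ R₂) :
    (R₁, R₂) ∈ singleLetterRegion p d₁ d₂ D₃₁ D₁₂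
      {m | m ≤ Fintype.card X₁ * Fintype.card X₂ + 3} := by
  classical
  obtain ⟨x₀⟩ := nonempty_of_mem_stdSimplex hp
  have hX₃ : Nonempty X₃ := ⟨x₀.2.2⟩
  obtain ⟨n₁, hn₁⟩ := h 1 one_pos
  obtain ⟨c₀, -⟩ := hn₁ (n₁ + 1) (Nat.lt_succ_self _)
  have hY₂ : Nonempty Y₂ := ⟨c₀.out₁₂ (fun _ => x₀) 0⟩
  have hY₁ : Nonempty Y₁ := ⟨c₀.out₃₁ (fun _ => x₀) 0⟩
  obtain ⟨k, hk, hk1, hpk⟩ := exists_channel hp.1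
  choose g hg using fun a => Finite.exists_min (d₁ a)
  have hlog₁ : 0 ≤ Real.log (Fintype.card X₁) := Real.log_natCast_nonneg _
  have hlog₂ : 0 ≤ Real.log (Fintype.card X₂) := Real.log_natCast_nonneg _
  have hlog₁₂ : 0 ≤ Real.log (Fintype.card (X₁ × X₂)) := Real.log_natCast_nonneg _
  -- Dominates the coefficients of ε in all the Fano estimates, so that ε = η / L gives slack at
  -- most η in each of them.
  set L := 3 + Real.log (Fintype.card X₁) + Real.log (Fintype.card X₂) +
    2 * Real.log (Fintype.card (X₁ × X₂)) with hL
  have hL0 : 0 < L := by positivity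
  have hall : ∀ η > 0, condEntropy p (fun x => x.1) (fun x => x.2.1) ≤ R₁ + η ∧
      condEntropy p (fun x => (x.1, x.2.1)) (fun x => x.2.2) ≤ R₁ + R₂ + η ∧
      ∑ x, p x * d₁ x.1 (g x.1) ≤ D₃₁ + η ∧
      ∃ v ∈ convexHull ℝ (letterPoints k d₂), v ∈ {v : (X₁ × X₂ → ℝ) × ℝ × ℝ | v.1 = pairLaw p} ∧
        max (condEntropy p Prod.snd Prod.fst - v.2.1 - R₂) (v.2.2 - D₁₂) ≤ η := by
    intro η hη
    set ε := η / L with hε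
    have hε0 : 0 < ε := by positivity
    have hεL : ε * L = η := by rw [hε]; field_simp
    obtain ⟨n₀, hn₀⟩ := h ε hε0
    obtain ⟨n₂, hn₂⟩ := exists_nat_gt (Real.log 2 / ε)
    set n := max n₀ n₂ + 1 with hn
    obtain ⟨c, hR₁, hR₂, hD₂, he₁, hD₁, he₂⟩ := hn₀ n (by omega)
    have hnpos : 0 < n := by omega
    have hn0 : (0 : ℝ) < n := by exact_mod_cast hnpos
    have hlog2 : Real.log 2 ≤ n * ε := by
      have : (n₂ : ℝ) ≤ n := by exact_mod_cast (by omega)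
      rw [div_lt_iff₀ hε0] at hn₂
      nlinarith
    have hM₁ : ∑ l, Real.log (c.M₁ l) ≤ n * (R₁ + ε) := by
      rw [one_div, inv_mul_le_iff₀ hn0] at hR₁; exact hR₁
    have hM₂ : ∑ l, Real.log (c.M₂ l) ≤ n * (R₂ + ε) := by
      rw [one_div, inv_mul_le_iff₀ hn0] at hR₂; exact hR₂
    have hεη : ε ≤ η := by
      rw [← hεL]; nlinarith
    refine ⟨?_, ?_, ?_, ?_⟩
    · have := mul_condEntropy_fst_le hp c he₁
      refine le_of_mul_le_mul_left (this.trans ?_) hn0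
      calc _ ≤ n * ε + n * (R₁ + ε) + ε * (n * Real.log (Fintype.card X₁)) := by linarith
        _ = n * (R₁ + ε * (2 + Real.log (Fintype.card X₁))) := by ring
        _ ≤ n * (R₁ + η) := by
          rw [← hεL]; gcongr; rw [hL]; linarith
    · have := mul_condEntropy_pair_le hp c he₁ he₂
      refine le_of_mul_le_mul_left (this.trans ?_) hn0
      calc _ ≤ n * ε + (n * (R₁ + ε) + n * (R₂ + ε)) +
            2 * ε * (n * Real.log (Fintype.card (X₁ × X₂))) := by linarith
        _ = n * (R₁ + R₂ + ε * (3 + 2 * Real.log (Fintype.card (X₁ × X₂)))) := by ring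
        _ ≤ n * (R₁ + R₂ + η) := by
          rw [← hεL]; gcongr; rw [hL]; linarith
    · rw [← blockExp_blockDist_letter hp hnpos Prod.fst (fun x => g x.1) d₁]
      refine (blockExp_mono hp.1 fun x => ?_).trans (hD₁.trans (by linarith))
      simp only [blockDist]
      gcongr
      exact hg _ _
    · obtain ⟨v, hv, hv1, hv2, hv3⟩ := exists_mem_convexHull_of_code hp c hnpos hk hk1 hpk d₂
      refine ⟨v, hv, hv1, max_le ?_ (by rw [hv2]; linarith)⟩
      have h4 : blockPr p {x | (fun t => (x t).2.1) ≠ c.out₃₂ x} *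
          (n * Real.log (Fintype.card X₂)) ≤ ε * (n * Real.log (Fintype.card X₂)) := by
        gcongr
      have h5 : n * condEntropy p Prod.snd Prod.fst ≤ n * (v.2.1 + R₂ + η) := by
        calc _ ≤ n * ε + n * (R₂ + ε) + ε * (n * Real.log (Fintype.card X₂)) + n * v.2.1 := by
              linarith
          _ = n * (v.2.1 + R₂ + ε * (2 + Real.log (Fintype.card X₂))) := by ring
          _ ≤ n * (v.2.1 + R₂ + η) := by
            rw [← hεL]; gcongr; rw [hL]; linarith
      have := le_of_mul_le_mul_left h5 hn0
      linarith
  obtain ⟨w, hw, z, hz, hzF, hf⟩ := exists_convex_combination_nonpos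
    (isCompact_letterPoints k d₂)
    (isClosed_eq continuous_fst continuous_const :
      IsClosed {v : (X₁ × X₂ → ℝ) × ℝ × ℝ | v.1 = pairLaw p})
    (f := fun v => max (condEntropy p Prod.snd Prod.fst - v.2.1 - R₂) (v.2.2 - D₁₂))
    (by fun_prop) fun η hη => (hall η hη).2.2.2
  choose x y r hr hzr using hz
  simp only [← hzr] at hzF hf
  have hf₁ := (le_max_left _ _).trans hf
  have hf₂ := (le_max_right _ _).trans hf
  obtain ⟨q, hq, hR⟩ := exists_admissible (R₁ := R₁) (R₂ := R₂) (D₃₁ := D₃₁) (D₁₂ := D₁₂) hp hk hk1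
    hpk g (le_of_forall_pos_le_add fun η hη => (hall η hη).2.2.1) hw x r hr y hzF (by linarith)
    (by linarith) (le_of_forall_pos_le_add fun η hη => (hall η hη).1)
    (le_of_forall_pos_le_add fun η hη => (hall η hη).2.1)
  refine ⟨_, ?_, q, hq, hR⟩
  -- The dimension is |X₁||X₂| + 2, and Carathéodory's theorem adds one.
  simp [Module.finrank_prod, Fintype.card_prod]

end Converse

/-! ## Random coding: covering -/

section Covering

/-- The random coding principle: some codebook does at least as well as the average. -/
lemma exists_le_of_weighted_sum_le {ι : Type*} [Fintype ι] {w : ι → ℝ} (hw : w ∈ stdSimplex ℝ ι)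
    {F : ι → ℝ} {c : ℝ} (h : ∑ i, w i * F i ≤ c) : ∃ i, F i ≤ c := by
  by_contra! hcon
  have h1 : ∑ i, w i * c < ∑ i, w i * F i := by
    refine Finset.sum_lt_sum (fun i _ => mul_le_mul_of_nonneg_left (hcon i).le (hw.1 i)) ?_
    by_contra! h0
    have : ∀ i, w i = 0 := fun i => le_antisymm (not_lt.1 fun hi =>
      (h0 i (Finset.mem_univ i)).not_gt (mul_lt_mul_of_pos_left (hcon i) hi)) (hw.1 i)
    have h2 := hw.2
    simp [this] at h2
  rw [← Finset.sum_mul, hw.2, one_mul] at h1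
  exact (h1.trans_le h).false

/-- Bound (1 − g)^M by exp(−Meθ), then use convexity of exp between 0 and −Me. For g the chance that
one random codeword is good and θ its chance under the test channel, this separates the failure of
the test channel from the finite size of the codebook. -/
lemma one_sub_pow_le {g e θ : ℝ} (hg : g ≤ 1) (hθ0 : 0 ≤ θ) (hθ1 : θ ≤ 1) (h : e * θ ≤ g)
    (M : ℕ) : (1 - g) ^ M ≤ 1 - θ + Real.exp (-(M * e)) := by
  have h1 : (1 - g) ^ M ≤ Real.exp (-(M * e) * θ) := by
    calc (1 - g) ^ M ≤ Real.exp (-g) ^ M :=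
          pow_le_pow_left₀ (by linarith) (Real.one_sub_le_exp_neg g) M
      _ = Real.exp (M * -g) := by rw [← Real.exp_nat_mul]
      _ ≤ Real.exp (-(M * e) * θ) := by
          refine Real.exp_le_exp.2 ?_
          have := mul_le_mul_of_nonneg_left h (Nat.cast_nonneg (α := ℝ) M)
          linarith
  have h2 := convexOn_exp.2 (Set.mem_univ (0 : ℝ)) (Set.mem_univ (-(M * e)))
    (sub_nonneg.2 hθ1) hθ0 (by ring)
  simp only [smul_eq_mul, mul_zero, zero_add, Real.exp_zero, mul_one] at h2
  rw [mul_comm θ] at h2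
  have h3 : θ * Real.exp (-(M * e)) ≤ Real.exp (-(M * e)) :=
    mul_le_of_le_one_left (Real.exp_pos _).le hθ1
  linarith

open Classical in
/-- The covering lemma, for a codebook of `M` independent words. -/
lemma exists_codebook {U ι : Type*} [Fintype U] [Fintype ι] {κ : U → ℝ} (hκ : κ ∈ stdSimplex ℝ U)
    {w : ι → ℝ} (hw : ∀ i, 0 ≤ w i) (G : ι → U → Prop) {θ : ι → ℝ} (hθ0 : ∀ i, 0 ≤ θ i)
    (hθ1 : ∀ i, w i ≠ 0 → θ i ≤ 1) {e : ℝ}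
    (hθ : ∀ i, w i ≠ 0 → e * θ i ≤ ∑ u, if G i u then κ u else 0) (M : ℕ) :
    ∃ u : Fin M → U, ∑ i, w i * (if ∃ j, G i (u j) then 0 else 1) ≤
      ∑ i, w i * (1 - θ i + Real.exp (-(M * e))) := by
  refine exists_le_of_weighted_sum_le (w := blockProb κ (n := M))
    ⟨blockProb_nonneg hκ.1, sum_blockProb hκ⟩ ?_
  simp only [Finset.mul_sum]
  rw [Finset.sum_comm]
  refine Finset.sum_le_sum fun i _ => ?_
  simp only [mul_left_comm _ (w i), ← Finset.mul_sum]
  by_cases hi : w i = 0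
  · simp [hi]
  refine mul_le_mul_of_nonneg_left ?_ (hw i)
  set g := ∑ u, if G i u then κ u else 0 with hg
  have hcompl : ∑ u, (if G i u then 0 else κ u) = 1 - g := by
    rw [hg, ← hκ.2, ← Finset.sum_sub_distrib]
    exact Finset.sum_congr rfl fun u _ => by split_ifs <;> simp
  have h1 : ∑ u : Fin M → U, blockProb κ u * (if ∃ j, G i (u j) then 0 else 1) = (1 - g) ^ M := by
    rw [← hcompl]
    calc _ = ∑ u : Fin M → U, ∏ j, if G i (u j) then 0 else κ (u j) := by
          refine Finset.sum_congr rfl fun u _ => ?_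
          by_cases h : ∃ j, G i (u j)
          · obtain ⟨j, hj⟩ := h
            rw [if_pos ⟨j, hj⟩, mul_zero]
            exact (Finset.prod_eq_zero (Finset.mem_univ j) (by simp [hj])).symm
          · rw [if_neg h, mul_one]
            exact Finset.prod_congr rfl fun j _ => (if_neg fun hj => h ⟨j, hj⟩).symm
      _ = _ := by
          rw [sum_prod_blocks fun _ u => if G i u then 0 else κ u]; simp
  rw [h1]
  refine one_sub_pow_le ?_ (hθ0 i) (hθ1 i hi) (hθ i hi) M
  rw [← hκ.2]
  refine Finset.sum_le_sum fun u _ => ?_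
  have := hκ.1 u
  split_ifs <;> simp [this]

variable {Ω A B C U : Type*} [Fintype Ω] [Fintype A] [Fintype B] [Fintype C] [Fintype U]

lemma sum_eq_sum_fiber [DecidableEq A] (f : Ω → A) (F : A → Ω → ℝ) :
    ∑ ω, F (f ω) ω = ∑ a, ∑ ω, if f ω = a then F a ω else 0 := by
  rw [Finset.sum_comm]
  simp

open Classical in
/-- A quantizer of `B` given `A`, for a source with further components: a test channel `κ₂` from
`(A, B)` to `U` is simulated with a codebook of size `M` drawn from `κ₁`. -/
lemma exists_quantizer {P : Ω → ℝ} (hP : P ∈ stdSimplex ℝ Ω) (α : Ω → A) (β : Ω → B)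
    {κ₁ : A → U → ℝ} {κ₂ : A → B → U → ℝ} (hκ₁ : ∀ a u, 0 ≤ κ₁ a u) (hκ₂ : ∀ a b u, 0 ≤ κ₂ a b u)
    (hκ₁s : ∀ ω, P ω ≠ 0 → ∑ u, κ₁ (α ω) u = 1)
    (hκ₂s : ∀ ω, P ω ≠ 0 → ∑ u, κ₂ (α ω) (β ω) u = 1)
    (bad : Ω → U → Prop) {e δ : ℝ} (hδ : 0 < δ)
    (hbad : ∑ ω, ∑ u, (if bad ω u then P ω * κ₂ (α ω) (β ω) u else 0) ≤ δ ^ 2)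
    (hdens : ∑ ω, ∑ u, (if κ₁ (α ω) u < e * κ₂ (α ω) (β ω) u then
      P ω * κ₂ (α ω) (β ω) u else 0) ≤ δ)
    {M : ℕ} (hM : 0 < M) (hMδ : Real.exp (-(M * e)) ≤ δ) :
    ∃ (u : A → Fin M → U) (φ : A → B → Fin M),
      ∑ ω, (if bad ω (u (α ω) (φ (α ω) (β ω))) then P ω else 0) ≤ 4 * δ := by
  have hP0 := hP.1
  obtain ⟨ω₀, hω₀⟩ : ∃ ω, P ω ≠ 0 := by
    by_contra! h
    have := hP.2
    simp [h] at this
  obtain ⟨u₀⟩ : Nonempty U := by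
    by_contra h
    rw [not_nonempty_iff] at h
    have := hκ₁s ω₀ hω₀
    simp at this
  set W : A → B → ℝ := fun a b => ∑ ω, if (α ω, β ω) = (a, b) then P ω else 0 with hW
  set V : A → B → U → ℝ := fun a b u =>
    ∑ ω, if (α ω, β ω) = (a, b) then (if bad ω u then P ω else 0) else 0 with hV
  have hW0 : ∀ a b, 0 ≤ W a b := fun a b =>
    Finset.sum_nonneg fun ω _ => by split_ifs <;> simp [hP0]
  have hV0 : ∀ a b u, 0 ≤ V a b u := fun a b u =>
    Finset.sum_nonneg fun ω _ => by split_ifs <;> simp [hP0]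
  have hVW : ∀ a b u, V a b u ≤ W a b := fun a b u =>
    Finset.sum_le_sum fun ω _ => by split_ifs <;> simp [hP0]
  have hWne : ∀ a b, W a b ≠ 0 → ∃ ω, P ω ≠ 0 ∧ α ω = a ∧ β ω = b := by
    intro a b h
    obtain ⟨ω, -, hω⟩ := Finset.exists_ne_zero_of_sum_ne_zero h
    by_cases h' : (α ω, β ω) = (a, b)
    · rw [if_pos h'] at hω
      exact ⟨ω, hω, (Prod.mk.inj h').1, (Prod.mk.inj h').2⟩
    · rw [if_neg h'] at hω; exact absurd rfl hω
  have hfib : ∀ F : A → B → Ω → ℝ, ∑ ω, F (α ω) (β ω) ω =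
      ∑ a, ∑ b, ∑ ω, if (α ω, β ω) = (a, b) then F a b ω else 0 := by
    intro F
    rw [sum_eq_sum_fiber (fun ω => (α ω, β ω)) (fun z ω => F z.1 z.2 ω), Fintype.sum_prod_type]
  have hfibW : ∀ F : A → B → ℝ, ∑ ω, P ω * F (α ω) (β ω) = ∑ a, ∑ b, W a b * F a b := by
    intro F
    rw [hfib fun a b ω => P ω * F a b]
    simp only [hW, Finset.sum_mul, ite_mul, zero_mul]
  have hWsum : ∑ a, ∑ b, W a b = 1 := by
    have := hfibW fun _ _ => 1
    simpa [hP.2] using this.symm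
  -- A codeword is good if its density ratio is bounded and if, conditionally on (a, b), the bad
  -- event has probability at most δ. The second requirement averages over the components of ω that
  -- the quantizer does not see, and plays the role of the Markov lemma.
  obtain ⟨G, hG⟩ : ∃ G : A → B → U → Prop, ∀ a b u, G a b u ↔
      e * κ₂ a b u ≤ κ₁ a u ∧ V a b u ≤ δ * W a b := ⟨_, fun _ _ _ => Iff.rfl⟩
  set θ : A → B → ℝ := fun a b => ∑ u, if G a b u then κ₂ a b u else 0 with hθ
  have hθ0 : ∀ a b, 0 ≤ θ a b := fun a b =>
    Finset.sum_nonneg fun u _ => by split_ifs <;> simp [hκ₂]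
  have hκ₂W : ∀ a b, W a b ≠ 0 → ∑ u, κ₂ a b u = 1 := by
    intro a b h
    obtain ⟨ω, h1, rfl, rfl⟩ := hWne a b h
    exact hκ₂s ω h1
  have hθ1 : ∀ a b, W a b ≠ 0 → θ a b ≤ 1 := by
    intro a b h
    rw [← hκ₂W a b h]
    exact Finset.sum_le_sum fun u _ => by split_ifs <;> simp [hκ₂]
  have hcode : ∀ a, ∃ u : Fin M → U, ∑ b, W a b * (if ∃ j, G a b (u j) then 0 else 1) ≤
      ∑ b, W a b * (1 - θ a b + Real.exp (-(M * e))) := by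
    intro a
    by_cases ha : ∃ b, W a b ≠ 0
    · obtain ⟨b, hb⟩ := ha
      obtain ⟨ω, h1, rfl, -⟩ := hWne a b hb
      refine exists_codebook ⟨hκ₁ _, hκ₁s ω h1⟩ (hW0 _) (G (α ω)) (hθ0 _) (hθ1 _) ?_ M
      intro b _
      rw [hθ, Finset.mul_sum]
      refine Finset.sum_le_sum fun u _ => ?_
      by_cases hg : G (α ω) b u
      · rw [if_pos hg, if_pos hg]; exact ((hG _ _ _).1 hg).1
      · rw [if_neg hg, if_neg hg, mul_zero]
    · push Not at ha
      exact ⟨fun _ => u₀, by simp [ha]⟩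
  choose u hu using hcode
  set φ : A → B → Fin M := fun a b =>
    if h : ∃ j, G a b (u a j) then h.choose else ⟨0, hM⟩ with hφ
  refine ⟨u, φ, ?_⟩
  have hφG : ∀ a b, (∃ j, G a b (u a j)) → G a b (u a (φ a b)) := by
    intro a b h
    simp only [hφ, dif_pos h]
    exact h.choose_spec
  -- The test channel itself misses the good words with probability at most 2δ: δ for the density
  -- condition, and δ² / δ by Markov's inequality for the other, which is why the bad event is
  -- assumed to have probability at most δ².
  have hmiss : ∑ a, ∑ b, W a b * (1 - θ a b) ≤ 2 * δ := by
    have h1 : ∀ a b, W a b * (1 - θ a b) ≤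
        ∑ u, (if κ₁ a u < e * κ₂ a b u then W a b * κ₂ a b u else 0) +
          δ⁻¹ * ∑ u, V a b u * κ₂ a b u := by
      intro a b
      have hr : 0 ≤ ∑ u, (if κ₁ a u < e * κ₂ a b u then W a b * κ₂ a b u else 0) +
          δ⁻¹ * ∑ u, V a b u * κ₂ a b u := by
        refine add_nonneg (Finset.sum_nonneg fun u _ => ?_) (mul_nonneg (inv_nonneg.2 hδ.le)
          (Finset.sum_nonneg fun u _ => mul_nonneg (hV0 _ _ _) (hκ₂ _ _ _)))
        have := mul_nonneg (hW0 a b) (hκ₂ a b u)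
        split_ifs <;> simp [this]
      by_cases hw : W a b = 0
      · rw [hw, zero_mul]; simpa only [hw] using hr
      · rw [← hκ₂W a b hw, hθ, ← Finset.sum_sub_distrib, Finset.mul_sum, Finset.mul_sum,
          ← Finset.sum_add_distrib]
        refine Finset.sum_le_sum fun u _ => ?_
        have hk := hκ₂ a b u
        have hwk := mul_nonneg (hW0 a b) hk
        have hvk : 0 ≤ δ⁻¹ * (V a b u * κ₂ a b u) :=
          mul_nonneg (inv_nonneg.2 hδ.le) (mul_nonneg (hV0 a b u) hk)
        by_cases hg : G a b u
        · rw [if_pos hg, sub_self, mul_zero]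
          split_ifs <;> linarith
        · rw [if_neg hg, sub_zero]
          by_cases h1 : κ₁ a u < e * κ₂ a b u
          · rw [if_pos h1]; linarith
          · rw [if_neg h1, zero_add]
            have h2 : δ * W a b ≤ V a b u :=
              (not_le.1 fun h2 => hg ((hG _ _ _).2 ⟨not_lt.1 h1, h2⟩)).le
            rw [← mul_assoc]
            refine mul_le_mul_of_nonneg_right ?_ hk
            rw [le_inv_mul_iff₀ hδ]; exact h2
    have h2 : ∑ a, ∑ b, ∑ u, (if κ₁ a u < e * κ₂ a b u then W a b * κ₂ a b u else 0) ≤ δ := by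
      refine le_trans (le_of_eq ?_) hdens
      have := hfibW fun a b => ∑ u, if κ₁ a u < e * κ₂ a b u then κ₂ a b u else 0
      simp only [Finset.mul_sum, mul_ite, mul_zero] at this
      exact this.symm
    have h3 : ∑ a, ∑ b, ∑ u, V a b u * κ₂ a b u ≤ δ ^ 2 := by
      refine le_trans (le_of_eq ?_) hbad
      rw [hfib fun a b ω => ∑ u, if bad ω u then P ω * κ₂ a b u else 0]
      refine Finset.sum_congr rfl fun a _ => Finset.sum_congr rfl fun b _ => ?_
      simp only [hV, Finset.sum_mul]
      rw [Finset.sum_comm]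
      refine Finset.sum_congr rfl fun ω _ => ?_
      by_cases h : (α ω, β ω) = (a, b)
      · simp only [if_pos h, ite_mul, zero_mul]
      · simp only [if_neg h, zero_mul, Finset.sum_const_zero]
    calc _ ≤ ∑ a, ∑ b, (∑ u, (if κ₁ a u < e * κ₂ a b u then W a b * κ₂ a b u else 0) +
          δ⁻¹ * ∑ u, V a b u * κ₂ a b u) :=
          Finset.sum_le_sum fun a _ => Finset.sum_le_sum fun b _ => h1 a b
      _ = ∑ a, ∑ b, ∑ u, (if κ₁ a u < e * κ₂ a b u then W a b * κ₂ a b u else 0) +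
          δ⁻¹ * ∑ a, ∑ b, ∑ u, V a b u * κ₂ a b u := by
          simp only [Finset.sum_add_distrib, ← Finset.mul_sum]
      _ ≤ δ + δ⁻¹ * δ ^ 2 := by gcongr
      _ = 2 * δ := by field_simp; ring
  have hcov : ∑ a, ∑ b, W a b * (if ∃ j, G a b (u a j) then 0 else 1) ≤ 3 * δ := by
    refine (Finset.sum_le_sum fun a _ => hu a).trans ?_
    simp only [mul_add, Finset.sum_add_distrib, ← Finset.sum_mul, hWsum, one_mul]
    linarith
  calc _ = ∑ a, ∑ b, V a b (u a (φ a b)) := hfib fun a b ω => if bad ω (u a (φ a b)) then P ω else 0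
    _ ≤ ∑ a, ∑ b, (δ * W a b + W a b * (if ∃ j, G a b (u a j) then 0 else 1)) := by
        refine Finset.sum_le_sum fun a _ => Finset.sum_le_sum fun b _ => ?_
        by_cases h : ∃ j, G a b (u a j)
        · rw [if_pos h, mul_zero, add_zero]; exact ((hG _ _ _).1 (hφG a b h)).2
        · rw [if_neg h, mul_one]
          have := mul_nonneg hδ.le (hW0 a b)
          linarith [hVW a b (u a (φ a b))]
    _ ≤ δ + 3 * δ := by
        simp only [Finset.sum_add_distrib, ← Finset.mul_sum, hWsum, mul_one]
        gcongr
    _ = 4 * δ := by ring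

end Covering

/-! ## Random coding: binning -/

section Binning

/-- Once all values of f except f a' are fixed, exactly one choice of f a' collides. The map `e`
covers both plain bins and shifted indices. -/
lemma sum_collision {A J : Type*} [Fintype A] [Fintype J] [Nonempty J] [DecidableEq A]
    [DecidableEq J] {a a' : A} (h : a' ≠ a)
    (e : J → J) :
    ∑ f : A → J, (if f a' = e (f a) then (1 : ℝ) else 0) =
      Fintype.card (A → J) / Fintype.card J := by
  have h1 : ∑ f : A → J, (if f a' = e (f a) then (1 : ℝ) else 0) =
      ∑ z : J × ({j // j ≠ a'} → J), if z.1 = e (z.2 ⟨a, h.symm⟩) then (1 : ℝ) else 0 :=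
    Fintype.sum_equiv (Equiv.funSplitAt a' J) _ _ fun f => rfl
  rw [h1, Fintype.sum_prod_type_right, Fintype.card_congr (Equiv.funSplitAt a' J),
    Fintype.card_prod]
  have hJ : (Fintype.card J : ℝ) ≠ 0 := by exact_mod_cast Fintype.card_ne_zero
  simp only [Finset.sum_ite_eq', Finset.mem_univ, if_true, Finset.sum_const, Finset.card_univ,
    nsmul_eq_mul, mul_one, Nat.cast_mul]
  field_simp

variable {Ω A B C U Z J₁ J₃ : Type*} [Fintype Ω] [Fintype A] [Fintype B]
  [Fintype Z] [AddCommGroup Z] [Fintype J₁] [Fintype J₃] [Nonempty J₁]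
  [Nonempty J₃]

open Classical in
-- For a' ≠ a the three collisions are independent with probabilities 1/|J₁|, 1/|Z| and 1/|J₃|. The
-- random shift is what makes the middle one uniform although φ is arbitrary.
lemma sum_triple_collision_le (φ : A → B → Z) (G : A → B → Prop) {LA : ℝ}
    (hLA : ∑ a, ∑ b, (if G a b then (1 : ℝ) else 0) ≤ LA) (a : A) (b : B) :
    ∑ b₁ : A → J₁, ∑ s : A → Z, ∑ b₃ : A × B → J₃,
      ∑ a', ∑ b', (if G a' b' then (1 : ℝ) else 0) * (if a' ≠ a then
        (if b₁ a' = b₁ a then 1 else 0) * (if s a' = φ a b + s a - φ a' b' then 1 else 0) *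
        (if b₃ (a', b') = b₃ (a, b) then 1 else 0) else 0) ≤
      Fintype.card (A → J₁) * Fintype.card (A → Z) * Fintype.card (A × B → J₃) *
        (LA / (Fintype.card J₁ * Fintype.card Z * Fintype.card J₃)) := by
  calc _ = ∑ a', ∑ b', ∑ b₁ : A → J₁, ∑ s : A → Z, ∑ b₃ : A × B → J₃,
        (if G a' b' then (1 : ℝ) else 0) * (if a' ≠ a then
        (if b₁ a' = b₁ a then 1 else 0) *
        (if s a' = φ a b + s a - φ a' b' then 1 else 0) *
        (if b₃ (a', b') = b₃ (a, b) then 1 else 0) else 0) := by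
        simp only [Finset.sum_comm (s := (Finset.univ : Finset (A × B → J₃)))
            (t := (Finset.univ : Finset A)),
          Finset.sum_comm (s := (Finset.univ : Finset (A × B → J₃)))
            (t := (Finset.univ : Finset B)),
          Finset.sum_comm (s := (Finset.univ : Finset (A → Z)))
            (t := (Finset.univ : Finset A)),
          Finset.sum_comm (s := (Finset.univ : Finset (A → Z)))
            (t := (Finset.univ : Finset B)),
          Finset.sum_comm (s := (Finset.univ : Finset (A → J₁)))
            (t := (Finset.univ : Finset A)),
          Finset.sum_comm (s := (Finset.univ : Finset (A → J₁)))
            (t := (Finset.univ : Finset B))]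
    _ ≤ ∑ a', ∑ b', (if G a' b' then (1 : ℝ) else 0) *
        ((Fintype.card (A → J₁) : ℝ) / Fintype.card J₁ * (Fintype.card (A → Z) / Fintype.card Z) *
          (Fintype.card (A × B → J₃) / Fintype.card J₃)) := by
        refine Finset.sum_le_sum fun a' _ => Finset.sum_le_sum fun b' _ => ?_
        simp only [← Finset.mul_sum]
        refine mul_le_mul_of_nonneg_left ?_ (by positivity)
        by_cases ha : a' = a
        · simp only [ha, ne_eq, not_true_eq_false, if_false, Finset.sum_const_zero]
          positivity
        · have hab : (a', b') ≠ (a, b) := fun h => ha (Prod.mk.inj h).1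
          simp only [ne_eq, ha, not_false_eq_true, if_true, ← Finset.mul_sum]
          rw [sum_collision hab fun x => x,
            ← sum_collision ha fun x => φ a b + x - φ a' b', ← sum_collision ha fun x => x]
          simp only [← Finset.sum_mul, ← Finset.mul_sum]
          exact le_rfl
    _ ≤ LA * ((Fintype.card (A → J₁) : ℝ) / Fintype.card J₁ *
          (Fintype.card (A → Z) / Fintype.card Z) *
          (Fintype.card (A × B → J₃) / Fintype.card J₃)) := by
        simp only [← Finset.sum_mul]
        exact mul_le_mul_of_nonneg_right hLA (by positivity)
    _ = _ := by field_simp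

open Classical in
-- With the same first word, the first bin and the shift coincide automatically, so only the bin in
-- J₃ separates the competitors.
lemma sum_second_collision_le (G : B → Prop) [DecidablePred G] {LC : ℝ}
    (hLC : ∑ b, (if G b then (1 : ℝ) else 0) ≤ LC) (a : A) (b : B) :
    ∑ _b₁ : A → J₁, ∑ _s : A → Z, ∑ b₃ : A × B → J₃,
      ∑ b', (if G b' then (1 : ℝ) else 0) *
        (if b' ≠ b then (if b₃ (a, b') = b₃ (a, b) then 1 else 0) else 0) ≤
      Fintype.card (A → J₁) * Fintype.card (A → Z) * Fintype.card (A × B → J₃) *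
        (LC / Fintype.card J₃) := by
  have h3 : ∑ b₃ : A × B → J₃,
      ∑ b', (if G b' then (1 : ℝ) else 0) *
      (if b' ≠ b then (if b₃ (a, b') = b₃ (a, b) then 1 else 0) else 0) ≤
      (Fintype.card (A × B → J₃) : ℝ) * (LC / (Fintype.card J₃ : ℝ)) := by
    calc _ ≤ ∑ b', (if G b' then (1 : ℝ) else 0) *
          ((Fintype.card (A × B → J₃) : ℝ) / (Fintype.card J₃ : ℝ)) := by
          rw [Finset.sum_comm]
          refine Finset.sum_le_sum fun b' _ => ?_
          rw [← Finset.mul_sum]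
          refine mul_le_mul_of_nonneg_left ?_ (by positivity)
          by_cases hb : b' = b
          · simp only [hb, ne_eq, not_true_eq_false, if_false, Finset.sum_const_zero]
            positivity
          · have hab : (a, b') ≠ (a, b) := fun h => hb (Prod.mk.inj h).2
            simp only [ne_eq, hb, not_false_eq_true, if_true]
            exact (sum_collision hab fun x => x).le
      _ ≤ LC * ((Fintype.card (A × B → J₃) : ℝ) / (Fintype.card J₃ : ℝ)) := by
          rw [← Finset.sum_mul]
          exact mul_le_mul_of_nonneg_right hLC (by positivity)
      _ = (Fintype.card (A × B → J₃) : ℝ) * (LC / Fintype.card J₃) := by ring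
  simp only [Finset.sum_const, Finset.card_univ, nsmul_eq_mul]
  calc _ ≤ (Fintype.card (A → J₁) : ℝ) * (Fintype.card (A → Z) *
        (Fintype.card (A × B → J₃) * (LC / Fintype.card J₃))) := by gcongr
    _ = _ := by ring

open Classical in
/-- Random bins separate the source words from their competitors. -/
lemma exists_bins {P : Ω → ℝ} (hP : P ∈ stdSimplex ℝ Ω) (α : Ω → A) (β : Ω → B) (γ : Ω → C)
    (φ : A → B → Z) (G₂ : A → B → Prop) (G₃ : A → B → C → Prop) {L₂ LA LC : ℝ}
    (hL₂ : ∀ b, ∑ a, (if G₂ a b then (1 : ℝ) else 0) ≤ L₂)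
    (hLA : ∀ c, ∑ a, ∑ b, (if G₃ a b c then (1 : ℝ) else 0) ≤ LA)
    (hLC : ∀ a b c, ∑ b', (if φ a b' = φ a b ∧ G₃ a b' c then (1 : ℝ) else 0) ≤ LC) :
    ∃ (b₁ : A → J₁) (s : A → Z) (b₃ : A × B → J₃),
      ∑ ω, P ω * ((if ∃ a', a' ≠ α ω ∧ G₂ a' (β ω) ∧ b₁ a' = b₁ (α ω) then 1 else 0) +
        (if ∃ a' b', (a', b') ≠ (α ω, β ω) ∧ G₃ a' b' (γ ω) ∧ b₁ a' = b₁ (α ω) ∧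
          φ a' b' + s a' = φ (α ω) (β ω) + s (α ω) ∧ b₃ (a', b') = b₃ (α ω, β ω)
          then 1 else 0)) ≤
      L₂ / Fintype.card J₁ + LA / (Fintype.card J₁ * Fintype.card Z * Fintype.card J₃) +
        LC / Fintype.card J₃ := by
  set n₁ := (Fintype.card J₁ : ℝ) with hn₁
  set nZ := (Fintype.card Z : ℝ) with hnZ
  set n₃ := (Fintype.card J₃ : ℝ) with hn₃
  set c₁ := (Fintype.card (A → J₁) : ℝ) with hc₁
  set cZ := (Fintype.card (A → Z) : ℝ) with hcZ
  set c₃ := (Fintype.card (A × B → J₃) : ℝ) with hc₃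
  set bound := L₂ / n₁ + LA / (n₁ * nZ * n₃) + LC / n₃ with hbound
  set F₂ : (A → J₁) → Ω → ℝ := fun b₁ ω =>
    if ∃ a', a' ≠ α ω ∧ G₂ a' (β ω) ∧ b₁ a' = b₁ (α ω) then 1 else 0 with hF₂
  set F₃ : (A → J₁) → (A → Z) → (A × B → J₃) → Ω → ℝ := fun b₁ s b₃ ω =>
    if ∃ a' b', (a', b') ≠ (α ω, β ω) ∧ G₃ a' b' (γ ω) ∧ b₁ a' = b₁ (α ω) ∧
          φ a' b' + s a' = φ (α ω) (β ω) + s (α ω) ∧ b₃ (a', b') = b₃ (α ω, β ω)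
          then 1 else 0 with hF₃
  have hF₂le : ∀ b₁ ω, F₂ b₁ ω ≤ ∑ a', (if G₂ a' (β ω) then (1 : ℝ) else 0) *
      (if a' ≠ α ω then (if b₁ a' = b₁ (α ω) then 1 else 0) else 0) := by
    intro b₁ ω
    have hnn : ∀ a' ∈ (Finset.univ : Finset A), 0 ≤ (if G₂ a' (β ω) then (1 : ℝ) else 0) *
      (if a' ≠ α ω then (if b₁ a' = b₁ (α ω) then 1 else 0) else 0) := by
      intro a' _; positivity
    by_cases h : ∃ a', a' ≠ α ω ∧ G₂ a' (β ω) ∧ b₁ a' = b₁ (α ω)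
    · simp only [hF₂, if_pos h]
      obtain ⟨a', h1, h2, h3⟩ := h
      refine le_trans (le_of_eq ?_) (Finset.single_le_sum hnn (Finset.mem_univ a'))
      simp [h1, h2, h3]
    · simp only [hF₂, if_neg h]
      exact Finset.sum_nonneg hnn
  -- Union bound, split by whether the first word differs. If it does not, the shifts cancel and the
  -- unshifted indices must agree, which restricts the competitors to one cell of the quantizer.
  have hF₃le : ∀ b₁ s b₃ ω, F₃ b₁ s b₃ ω ≤
      ∑ a', ∑ b', (if G₃ a' b' (γ ω) then (1 : ℝ) else 0) * (if a' ≠ α ω then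
        (if b₁ a' = b₁ (α ω) then 1 else 0) *
        (if s a' = φ (α ω) (β ω) + s (α ω) - φ a' b' then 1 else 0) *
        (if b₃ (a', b') = b₃ (α ω, β ω) then 1 else 0) else 0) +
      ∑ b', (if φ (α ω) b' = φ (α ω) (β ω) ∧ G₃ (α ω) b' (γ ω) then (1 : ℝ) else 0) *
        (if b' ≠ β ω then (if b₃ (α ω, b') = b₃ (α ω, β ω) then 1 else 0) else 0) := by
    intro b₁ s b₃ ω
    have hnn : ∀ a' b', 0 ≤ (if G₃ a' b' (γ ω) then (1 : ℝ) else 0) * (if a' ≠ α ω then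
        (if b₁ a' = b₁ (α ω) then 1 else 0) *
        (if s a' = φ (α ω) (β ω) + s (α ω) - φ a' b' then 1 else 0) *
        (if b₃ (a', b') = b₃ (α ω, β ω) then 1 else 0) else 0) := by
      intro a' b'; positivity
    have hnn' : ∀ b', 0 ≤ (if φ (α ω) b' = φ (α ω) (β ω) ∧ G₃ (α ω) b' (γ ω) then (1 : ℝ) else 0) *
        (if b' ≠ β ω then (if b₃ (α ω, b') = b₃ (α ω, β ω) then 1 else 0) else 0) := by
      intro b'; positivity
    have hs1 := Finset.sum_nonneg fun a' (_ : a' ∈ (Finset.univ : Finset A)) =>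
      Finset.sum_nonneg fun b' (_ : b' ∈ (Finset.univ : Finset B)) => hnn a' b'
    have hs2 := Finset.sum_nonneg fun b' (_ : b' ∈ (Finset.univ : Finset B)) => hnn' b'
    by_cases h : ∃ a' b', (a', b') ≠ (α ω, β ω) ∧ G₃ a' b' (γ ω) ∧ b₁ a' = b₁ (α ω) ∧
          φ a' b' + s a' = φ (α ω) (β ω) + s (α ω) ∧ b₃ (a', b') = b₃ (α ω, β ω)
    · simp only [hF₃, if_pos h]
      obtain ⟨a', b', h1, h2, h3, h4, h5⟩ := h
      by_cases ha : a' = α ω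
      · subst ha
        have hb : b' ≠ β ω := fun hb => h1 (by rw [hb])
        have h6 : φ (α ω) b' = φ (α ω) (β ω) := add_right_cancel h4
        refine le_trans ?_ (le_add_of_nonneg_left hs1)
        refine le_trans (le_of_eq ?_)
          (Finset.single_le_sum (fun b' _ => hnn' b') (Finset.mem_univ b'))
        simp [hb, h2, h5, h6]
      · refine le_trans ?_ (le_add_of_nonneg_right hs2)
        refine le_trans ?_ (Finset.single_le_sum
          (fun a' _ => Finset.sum_nonneg fun b' _ => hnn a' b') (Finset.mem_univ a'))
        refine le_trans (le_of_eq ?_)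
          (Finset.single_le_sum (fun b' _ => hnn a' b') (Finset.mem_univ b'))
        have h6 : s a' = φ (α ω) (β ω) + s (α ω) - φ a' b' := by rw [← h4]; abel
        rw [if_pos h2, if_pos ha, if_pos h3, if_pos h6, if_pos h5]
        norm_num
    · simp only [hF₃, if_neg h]
      exact add_nonneg hs1 hs2
  have hpos : 0 < n₁ ∧ 0 < nZ ∧ 0 < n₃ ∧ 0 < c₁ ∧ 0 < cZ ∧ 0 < c₃ := by
    refine ⟨?_, ?_, ?_, ?_, ?_, ?_⟩ <;> exact Nat.cast_pos.2 Fintype.card_pos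
  obtain ⟨p1, p2, p3, q1, q2, q3⟩ := hpos
  have hS₂ : ∀ ω, ∑ b₁ : A → J₁, ∑ _s : A → Z, ∑ _b₃ : A × B → J₃, F₂ b₁ ω ≤
      c₁ * cZ * c₃ * (L₂ / n₁) := by
    intro ω
    have h1 : ∑ b₁ : A → J₁, F₂ b₁ ω ≤ c₁ * (L₂ / n₁) := by
      calc _ ≤ ∑ b₁ : A → J₁, ∑ a', (if G₂ a' (β ω) then (1 : ℝ) else 0) *
            (if a' ≠ α ω then (if b₁ a' = b₁ (α ω) then 1 else 0) else 0) :=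
            Finset.sum_le_sum fun b₁ _ => hF₂le b₁ ω
        _ ≤ ∑ a', (if G₂ a' (β ω) then (1 : ℝ) else 0) * (c₁ / n₁) := by
            rw [Finset.sum_comm]
            refine Finset.sum_le_sum fun a' _ => ?_
            rw [← Finset.mul_sum]
            refine mul_le_mul_of_nonneg_left ?_ (by positivity)
            by_cases ha : a' = α ω
            · simp only [ha, ne_eq, not_true_eq_false, if_false, Finset.sum_const_zero]
              positivity
            · simp only [ne_eq, ha, not_false_eq_true, if_true]
              exact (sum_collision ha fun x => x).le
        _ ≤ L₂ * (c₁ / n₁) := by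
            rw [← Finset.sum_mul]
            exact mul_le_mul_of_nonneg_right (hL₂ _) (by positivity)
        _ = c₁ * (L₂ / n₁) := by ring
    simp only [Finset.sum_const, Finset.card_univ, nsmul_eq_mul]
    rw [← Finset.mul_sum, ← Finset.mul_sum]
    calc cZ * (c₃ * ∑ b₁ : A → J₁, F₂ b₁ ω) ≤ cZ * (c₃ * (c₁ * (L₂ / n₁))) := by gcongr
      _ = _ := by ring
  have hS₃ : ∀ ω, ∑ b₁ : A → J₁, ∑ s : A → Z, ∑ b₃ : A × B → J₃, F₃ b₁ s b₃ ω ≤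
      c₁ * cZ * c₃ * (LA / (n₁ * nZ * n₃) + LC / n₃) := by
    intro ω
    have h1 := sum_triple_collision_le (J₁ := J₁) (J₃ := J₃) φ (fun a' b' => G₃ a' b' (γ ω))
      (hLA _) (α ω) (β ω)
    have h2 := sum_second_collision_le (J₁ := J₁) (Z := Z) (J₃ := J₃)
      (fun b' => φ (α ω) b' = φ (α ω) (β ω) ∧ G₃ (α ω) b' (γ ω)) (hLC _ _ _) (α ω) (β ω)
    calc _ ≤ _ := Finset.sum_le_sum fun b₁ _ => Finset.sum_le_sum fun s _ =>
          Finset.sum_le_sum fun b₃ _ => hF₃le b₁ s b₃ ω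
      _ ≤ c₁ * cZ * c₃ * (LA / (n₁ * nZ * n₃)) + c₁ * cZ * c₃ * (LC / n₃) := by
          simp only [Finset.sum_add_distrib]
          exact add_le_add h1 h2
      _ = _ := by ring
  -- If every choice of bins and shifts exceeded the bound, so would the sum over all choices,
  -- against the two collision counts.
  by_contra! hcon
  have hlt : ∑ _b₁ : A → J₁, ∑ _s : A → Z, ∑ _b₃ : A × B → J₃, bound <
      ∑ b₁ : A → J₁, ∑ s : A → Z, ∑ b₃ : A × B → J₃, ∑ ω, P ω * (F₂ b₁ ω + F₃ b₁ s b₃ ω) :=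
    Finset.sum_lt_sum_of_nonempty Finset.univ_nonempty fun b₁ _ =>
      Finset.sum_lt_sum_of_nonempty Finset.univ_nonempty fun s _ =>
        Finset.sum_lt_sum_of_nonempty Finset.univ_nonempty fun b₃ _ => hcon b₁ s b₃
  have hle : ∑ b₁ : A → J₁, ∑ s : A → Z, ∑ b₃ : A × B → J₃,
      ∑ ω, P ω * (F₂ b₁ ω + F₃ b₁ s b₃ ω) ≤ c₁ * cZ * c₃ * bound := by
    calc _ = ∑ ω, P ω * (∑ b₁ : A → J₁, ∑ _s : A → Z, ∑ _b₃ : A × B → J₃, F₂ b₁ ω +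
          ∑ b₁ : A → J₁, ∑ s : A → Z, ∑ b₃ : A × B → J₃, F₃ b₁ s b₃ ω) := by
          simp only [Finset.sum_comm (t := (Finset.univ : Finset Ω)), ← Finset.mul_sum,
            Finset.sum_add_distrib]
      _ ≤ ∑ ω, P ω * (c₁ * cZ * c₃ * bound) := by
          refine Finset.sum_le_sum fun ω _ => mul_le_mul_of_nonneg_left ?_ (hP.1 ω)
          refine (add_le_add (hS₂ ω) (hS₃ ω)).trans (le_of_eq ?_)
          rw [hbound]; ring
      _ = _ := by rw [← Finset.sum_mul, hP.2, one_mul]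
  have heq : ∑ _b₁ : A → J₁, ∑ _s : A → Z, ∑ _b₃ : A × B → J₃, bound = c₁ * cZ * c₃ * bound := by
    simp only [Finset.sum_const, Finset.card_univ, nsmul_eq_mul]
    ring
  rw [heq] at hlt
  exact (hlt.trans_le hle).false

open Classical in
/-- A one-shot code: node 1 sends a bin of its word, node 2 decodes it and sends the shifted
index of the quantized word and a bin of its own word. -/
lemma exists_one_shot_code [Nonempty A] [Nonempty B] {P : Ω → ℝ} (hP : P ∈ stdSimplex ℝ Ω)
    (α : Ω → A) (β : Ω → B) (γ : Ω → C) (φ : A → B → Z) (u : A → Z → U) (G₂ : A → B → Prop)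
    (G₃ : A → B → C → Prop) {L₂ LA LC δ₂ δ₃ : ℝ}
    (hL₂ : ∀ b, ∑ a, (if G₂ a b then (1 : ℝ) else 0) ≤ L₂)
    (hLA : ∀ c, ∑ a, ∑ b, (if G₃ a b c then (1 : ℝ) else 0) ≤ LA)
    (hLC : ∀ a b c, ∑ b', (if φ a b' = φ a b ∧ G₃ a b' c then (1 : ℝ) else 0) ≤ LC)
    (h₂ : ∑ ω, (if G₂ (α ω) (β ω) then 0 else P ω) ≤ δ₂)
    (h₃ : ∑ ω, (if G₃ (α ω) (β ω) (γ ω) then 0 else P ω) ≤ δ₃) :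
    ∃ (e₁ : A → J₁) (e₂ : B → J₁ → Z × J₃) (D₁ : A → Z × J₃ → U) (D₂ : B → J₁ → A)
      (D₃ : C → J₁ → Z × J₃ → A × B),
      ∑ ω, (if D₂ (β ω) (e₁ (α ω)) = α ω ∧
          D₁ (α ω) (e₂ (β ω) (e₁ (α ω))) = u (α ω) (φ (α ω) (β ω)) ∧
          D₃ (γ ω) (e₁ (α ω)) (e₂ (β ω) (e₁ (α ω))) = (α ω, β ω) then 0 else P ω) ≤
        δ₂ + δ₃ + (L₂ / Fintype.card J₁ +
          LA / (Fintype.card J₁ * Fintype.card Z * Fintype.card J₃) + LC / Fintype.card J₃) := by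
  obtain ⟨b₁, s, b₃, hb⟩ := exists_bins (J₁ := J₁) (J₃ := J₃) hP α β γ φ G₂ G₃ hL₂ hLA hLC
  set D₂ : B → J₁ → A := fun b j => Classical.epsilon fun a => G₂ a b ∧ b₁ a = j with hD₂
  set e₂ : B → J₁ → Z × J₃ := fun b j => (φ (D₂ b j) b + s (D₂ b j), b₃ (D₂ b j, b)) with he₂
  set D₃ : C → J₁ → Z × J₃ → A × B := fun c j i => Classical.epsilon fun z : A × B =>
    G₃ z.1 z.2 c ∧ b₁ z.1 = j ∧ φ z.1 z.2 + s z.1 = i.1 ∧ b₃ z = i.2 with hD₃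
  -- Node 1 knows its own word, hence the shift, and recovers the index by subtraction.
  refine ⟨b₁, e₂, fun a i => u a (i.1 - s a), D₂, D₃, ?_⟩
  refine (Finset.sum_le_sum fun ω _ => ?_).trans
    ((Finset.sum_add_distrib.trans_le (add_le_add_left Finset.sum_add_distrib.le _)).trans
      (add_le_add (add_le_add h₂ h₃) hb))
  have hp := hP.1 ω
  set E₂ := ∃ a', a' ≠ α ω ∧ G₂ a' (β ω) ∧ b₁ a' = b₁ (α ω) with hE₂
  set E₃ := ∃ a' b', (a', b') ≠ (α ω, β ω) ∧ G₃ a' b' (γ ω) ∧ b₁ a' = b₁ (α ω) ∧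
          φ a' b' + s a' = φ (α ω) (β ω) + s (α ω) ∧ b₃ (a', b') = b₃ (α ω, β ω) with hE₃
  by_cases g₂ : G₂ (α ω) (β ω)
  swap
  · have : 0 ≤ P ω * ((if E₂ then (1 : ℝ) else 0) + if E₃ then 1 else 0) := by positivity
    rw [if_neg g₂]
    split_ifs <;> linarith
  by_cases g₃ : G₃ (α ω) (β ω) (γ ω)
  swap
  · have : 0 ≤ P ω * ((if E₂ then (1 : ℝ) else 0) + if E₃ then 1 else 0) := by positivity
    rw [if_neg g₃, if_pos g₂]
    split_ifs <;> linarith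
  rw [if_pos g₂, if_pos g₃, add_zero, zero_add]
  by_cases hE₂' : E₂
  · rw [if_pos hE₂']
    split_ifs <;> linarith
  by_cases hE₃' : E₃
  · rw [if_pos hE₃']
    split_ifs <;> linarith
  rw [if_neg hE₂', if_neg hE₃', add_zero, mul_zero]
  have k₂ : D₂ (β ω) (b₁ (α ω)) = α ω := by
    have hsp := Classical.epsilon_spec (p := fun a => G₂ a (β ω) ∧ b₁ a = b₁ (α ω))
      ⟨α ω, g₂, rfl⟩
    by_contra hne
    exact hE₂' ⟨_, hne, hsp.1, hsp.2⟩
  have ke : e₂ (β ω) (b₁ (α ω)) = (φ (α ω) (β ω) + s (α ω), b₃ (α ω, β ω)) := by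
    simp only [he₂, k₂]
  have k₃ : D₃ (γ ω) (b₁ (α ω)) (e₂ (β ω) (b₁ (α ω))) = (α ω, β ω) := by
    rw [ke]
    have hsp := Classical.epsilon_spec (p := fun z : A × B => G₃ z.1 z.2 (γ ω) ∧
      b₁ z.1 = b₁ (α ω) ∧ φ z.1 z.2 + s z.1 = φ (α ω) (β ω) + s (α ω) ∧ b₃ z = b₃ (α ω, β ω))
      ⟨(α ω, β ω), g₃, rfl, rfl, rfl⟩
    by_contra hne
    exact hE₃' ⟨_, _, hne, hsp.1, hsp.2.1, hsp.2.2.1, hsp.2.2.2⟩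
  rw [if_pos]
  refine ⟨k₂, ?_, k₃⟩
  simp only [ke, add_sub_cancel_right]

end Binning

/-! ## Codes with a single active round -/

section SingleRound

variable {X₁ X₂ X₃ Y₁ Y₂ 𝒥₁ 𝒥₂ : Type*} [Fintype 𝒥₁] [Fintype 𝒥₂] {n K : ℕ}

/-- The number of an element of a finite type. -/
def toIndex (a : 𝒥₁) : ℕ := Fintype.equivFin 𝒥₁ a

/-- The element of a finite type with a given number. -/
def ofIndex (𝒥₁ : Type*) [Fintype 𝒥₁] [Nonempty 𝒥₁] (i : ℕ) : 𝒥₁ :=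
  (Fintype.equivFin 𝒥₁).symm ⟨i % Fintype.card 𝒥₁, Nat.mod_lt _ Fintype.card_pos⟩

lemma toIndex_mod (a : 𝒥₁) : toIndex a % Fintype.card 𝒥₁ = toIndex a :=
  Nat.mod_eq_of_lt (Fintype.equivFin 𝒥₁ a).2

variable [Nonempty 𝒥₁] [Nonempty 𝒥₂]

lemma ofIndex_toIndex (a : 𝒥₁) : ofIndex 𝒥₁ (toIndex a) = a := by
  simp only [ofIndex, toIndex_mod]
  exact (Fintype.equivFin 𝒥₁).symm_apply_apply a

lemma sum_log_first_round {K : ℕ} (hK : 0 < K) (N : ℕ) :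
    ∑ l : Fin K, Real.log (if l.val = 0 then N else 1 : ℕ) = Real.log N := by
  rw [Finset.sum_eq_single ⟨0, hK⟩]
  · simp
  · intro l _ hl
    rw [if_neg fun h => hl (Fin.ext h)]
    simp
  · simp

/-- A one-round code can be run as a code with any positive number of rounds. -/
lemma exists_code (hK : 0 < K) (e₁ : (Fin n → X₁) → 𝒥₁) (e₂ : (Fin n → X₂) → 𝒥₁ → 𝒥₂)
    (D₁₂ : (Fin n → X₁) → 𝒥₂ → (Fin n → Y₂)) (D₂₁ : (Fin n → X₂) → 𝒥₁ → (Fin n → X₁))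
    (D₃₁ : (Fin n → X₃) → 𝒥₁ → 𝒥₂ → (Fin n → Y₁))
    (D₃₂ : (Fin n → X₃) → 𝒥₁ → 𝒥₂ → (Fin n → X₂)) :
    ∃ c : InteractiveCode X₁ X₂ X₃ Y₁ Y₂ n K,
      ∑ l, Real.log (c.M₁ l) = Real.log (Fintype.card 𝒥₁) ∧
      ∑ l, Real.log (c.M₂ l) = Real.log (Fintype.card 𝒥₂) ∧
      ∀ x : Fin n → X₁ × X₂ × X₃,
        let j₁ := e₁ fun t => (x t).1
        let j₂ := e₂ (fun t => (x t).2.1) j₁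
        c.out₁₂ x = D₁₂ (fun t => (x t).1) j₂ ∧ c.out₂₁ x = D₂₁ (fun t => (x t).2.1) j₁ ∧
        c.out₃₁ x = D₃₁ (fun t => (x t).2.2) j₁ j₂ ∧
        c.out₃₂ x = D₃₂ (fun t => (x t).2.2) j₁ j₂ := by
  set M₁ : Fin K → ℕ := fun l => if l.val = 0 then Fintype.card 𝒥₁ else 1 with hM₁
  set M₂ : Fin K → ℕ := fun l => if l.val = 0 then Fintype.card 𝒥₂ else 1 with hM₂
  have hM₁0 : ∀ l, 0 < M₁ l := by
    intro l; simp only [hM₁]; split_ifs; exacts [Fintype.card_pos, one_pos]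
  have hM₂0 : ∀ l, 0 < M₂ l := by
    intro l; simp only [hM₂]; split_ifs; exacts [Fintype.card_pos, one_pos]
  set l₀ : Fin K := ⟨0, hK⟩
  set c : InteractiveCode X₁ X₂ X₃ Y₁ Y₂ n K :=
    { M₁ := M₁
      M₂ := M₂
      -- The reduction changes nothing in round 0 and yields the only message in the idle rounds, so
      -- one formula serves all rounds.
      f₁ := fun l x _ => ⟨toIndex (e₁ x) % M₁ l, Nat.mod_lt _ (hM₁0 l)⟩
      f₂ := fun l x _ j => ⟨toIndex (e₂ x (ofIndex 𝒥₁ j)) % M₂ l, Nat.mod_lt _ (hM₂0 l)⟩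
      g₁₂ := fun x j => D₁₂ x (ofIndex 𝒥₂ (j l₀))
      g₂₁ := fun x j => D₂₁ x (ofIndex 𝒥₁ (j l₀))
      g₃₁ := fun x i j => D₃₁ x (ofIndex 𝒥₁ (i l₀)) (ofIndex 𝒥₂ (j l₀))
      g₃₂ := fun x i j => D₃₂ x (ofIndex 𝒥₁ (i l₀)) (ofIndex 𝒥₂ (j l₀)) } with hc
  refine ⟨c, sum_log_first_round hK _, sum_log_first_round hK _, fun x => ?_⟩
  have h₁ : ofIndex 𝒥₁ (c.J₁ x l₀) = e₁ fun t => (x t).1 := by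
    rw [InteractiveCode.J₁_eq]
    change ofIndex 𝒥₁ (toIndex (e₁ fun t => (x t).1) % Fintype.card 𝒥₁) = _
    rw [toIndex_mod, ofIndex_toIndex]
  have h₂ : ofIndex 𝒥₂ (c.J₂ x l₀) = e₂ (fun t => (x t).2.1) (e₁ fun t => (x t).1) := by
    rw [← h₁, InteractiveCode.J₂, InteractiveCode.messages]
    change ofIndex 𝒥₂ (toIndex (e₂ (fun t => (x t).2.1) (ofIndex 𝒥₁
      (toIndex (e₁ fun t => (x t).1) % Fintype.card 𝒥₁))) % Fintype.card 𝒥₂) = _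
    rw [toIndex_mod, toIndex_mod, ofIndex_toIndex, ofIndex_toIndex, h₁]
  dsimp only
  rw [← h₂, ← h₁]
  exact ⟨rfl, rfl, rfl, rfl⟩

end SingleRound

/-! ## Conditional probabilities -/

section CondProb

variable {Ω A B S : Type*} [Fintype Ω]

/-- The conditional probability `P(X = a | Y = b)`. -/
def condProb (q : Ω → ℝ) (X : Ω → A) (Y : Ω → B) (a : A) (b : B) : ℝ :=
  prob q (fun ω => (X ω, Y ω)) (a, b) / prob q Y b

variable {q : Ω → ℝ}

lemma condProb_nonneg (hq : ∀ ω, 0 ≤ q ω) (X : Ω → A) (Y : Ω → B) (a : A) (b : B) :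
    0 ≤ condProb q X Y a b :=
  div_nonneg (prob_nonneg hq _ _) (prob_nonneg hq _ _)

lemma prob_pos (hq : ∀ ω, 0 ≤ q ω) (X : Ω → A) {ω : Ω} (hω : q ω ≠ 0) : 0 < prob q X (X ω) :=
  (lt_of_le_of_ne (hq ω) (Ne.symm hω)).trans_le (le_prob hq X ω)

lemma condProb_pos (hq : ∀ ω, 0 ≤ q ω) (X : Ω → A) (Y : Ω → B) {ω : Ω} (hω : q ω ≠ 0) :
    0 < condProb q X Y (X ω) (Y ω) :=
  div_pos (prob_pos hq (fun ω => (X ω, Y ω)) hω) (prob_pos hq Y hω)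

lemma sum_condProb [Fintype A] (X : Ω → A) (Y : Ω → B) (b : B) :
    ∑ a, condProb q X Y a b = prob q Y b / prob q Y b := by
  simp only [condProb, ← Finset.sum_div, sum_prob_pair]

lemma sum_condProb_le_one [Fintype A] (X : Ω → A) (Y : Ω → B) (b : B) :
    ∑ a, condProb q X Y a b ≤ 1 := by
  rw [sum_condProb]; exact div_self_le_one _

lemma condEntropy_eq_sum_log [Fintype A] [Fintype B] (q : Ω → ℝ) (X : Ω → A) (Y : Ω → B) :
    condEntropy q X Y = -∑ ω, q ω * Real.log (condProb q X Y (X ω) (Y ω)) :=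
  condEntropy_eq_sum q X Y

lemma condEntropy_nonneg [Fintype A] [Fintype B] (hq : ∀ ω, 0 ≤ q ω) (X : Ω → A) (Y : Ω → B) :
    0 ≤ condEntropy q X Y := by
  rw [condEntropy_eq_sum_log, ← Finset.sum_neg_distrib]
  refine Finset.sum_nonneg fun ω _ => ?_
  rw [← mul_neg]
  refine mul_nonneg (hq ω) (neg_nonneg.2 (Real.log_nonpos (condProb_nonneg hq _ _ _ _) ?_))
  exact div_le_one_of_le₀ (prob_pair_le hq X Y _ _) (prob_nonneg hq _ _)

open Classical in
/-- The number of blocks of large weight under a product of subprobabilities. -/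
lemma sum_ite_exp_le_prod [Fintype S] {n : ℕ} {κ : Fin n → S → ℝ} (hκ : ∀ t s, 0 ≤ κ t s)
    (hκ1 : ∀ t, ∑ s, κ t s ≤ 1) (γ : ℝ) :
    ∑ x : Fin n → S, (if Real.exp (-γ) ≤ ∏ t, κ t (x t) then (1 : ℝ) else 0) ≤ Real.exp γ := by
  calc _ ≤ ∑ x : Fin n → S, Real.exp γ * ∏ t, κ t (x t) := by
        refine Finset.sum_le_sum fun x _ => ?_
        have h0 : 0 ≤ ∏ t, κ t (x t) := Finset.prod_nonneg fun t _ => hκ t _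
        split_ifs with h
        · calc (1 : ℝ) = Real.exp γ * Real.exp (-γ) := by rw [← Real.exp_add]; simp
            _ ≤ _ := by gcongr
        · positivity
    _ = Real.exp γ * ∏ t, ∑ s, κ t s := by rw [← Finset.mul_sum, sum_prod_blocks]
    _ ≤ Real.exp γ * 1 := by
        gcongr
        exact Finset.prod_le_one (fun t _ => Finset.sum_nonneg fun s _ => hκ t s) fun t _ => hκ1 t
    _ = _ := mul_one _

/-- Since exp r ≥ 1, rounding up costs at most a factor 2, which is negligible in the rate. -/
lemma exists_nat_exp_le {r : ℝ} (hr : 0 ≤ r) :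
    ∃ N : ℕ, 0 < N ∧ Real.exp r ≤ N ∧ Real.log N ≤ r + Real.log 2 := by
  have hN : 0 < ⌈Real.exp r⌉₊ := Nat.ceil_pos.2 (Real.exp_pos r)
  refine ⟨⌈Real.exp r⌉₊, hN, Nat.le_ceil _, ?_⟩
  have h1 : (⌈Real.exp r⌉₊ : ℝ) ≤ Real.exp r * 2 := by
    have h2 := (Nat.ceil_lt_add_one (Real.exp_pos r).le).le
    have h3 := Real.one_le_exp hr
    linarith
  calc _ ≤ Real.log (Real.exp r * 2) := Real.log_le_log (by exact_mod_cast hN) h1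
    _ = _ := by rw [Real.log_mul (Real.exp_pos r).ne' two_ne_zero, Real.log_exp]

end CondProb

/-! ## Achievability -/

section Achievability

variable {X₁ X₂ X₃ Y₁ Y₂ : Type*} [Fintype X₁] [Fintype X₂] [Fintype X₃] {m : ℕ}
  {p : X₁ × X₂ × X₃ → ℝ} {d₁ : X₁ → Y₁ → ℝ} {d₂ : X₂ → Y₂ → ℝ} {D₃₁ D₁₂ R₁ R₂ : ℝ}
  {q : (X₁ × X₂ × X₃) × Fin m → ℝ}

/-- The test channel from `(X₁, X₂)` to `U`. -/
def testChannel (q : (X₁ × X₂ × X₃) × Fin m → ℝ) (a : X₁) (b : X₂) (u : Fin m) : ℝ :=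
  condProb q rvU (fun ω => (rvX₂ ω, rvX₁ ω)) u (b, a)

/-- The Markov condition says that U is generated from (X₁,X₂) alone, so a quantizer at node 2 that
knows X₁ⁿ can simulate it. -/
lemma IsAdmissible.eq_mul_testChannel (hq : IsAdmissible p d₁ d₂ D₃₁ D₁₂ q) (x : X₁ × X₂ × X₃)
    (u : Fin m) : q (x, u) = p x * testChannel q x.1 x.2.1 u := by
  classical
  obtain ⟨a, b, c⟩ := x
  have hq0 := hq.mem_simplex.1
  have hsum : ∀ F : (X₁ × X₂ × X₃) × Fin m → ℝ,
      ∑ ω, F ω = ∑ u, ∑ a, ∑ b, ∑ c, F ((a, b, c), u) := by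
    intro F
    rw [Fintype.sum_prod_type_right]
    simp only [Fintype.sum_prod_type]
  have h := hq.markov u (a, b) c
  have h1 : prob q (fun ω => (rvU ω, (rvX₁ ω, rvX₂ ω), rvX₃ ω)) (u, (a, b), c) =
      q ((a, b, c), u) := by
    rw [prob_eq_sum_ite, hsum]
    simp only [rvU, rvX₁, rvX₂, rvX₃, Prod.mk.injEq, ite_and, Finset.sum_ite_irrel,
      Finset.sum_const_zero, Finset.sum_ite_eq', Finset.mem_univ, if_true]
  have h2 : prob q (fun ω => ((rvX₁ ω, rvX₂ ω), rvX₃ ω)) ((a, b), c) = p (a, b, c) := by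
    have : prob q (fun ω => ((rvX₁ ω, rvX₂ ω), rvX₃ ω)) =
        prob p (fun x => ((x.1, x.2.1), x.2.2)) := by
      rw [← prob_fst_of_marginal hq.marginal, prob_prob]; rfl
    rw [this, prob_eq_sum_ite]
    simp only [Fintype.sum_prod_type, Prod.mk.injEq, ite_and, Finset.sum_ite_irrel,
      Finset.sum_const_zero, Finset.sum_ite_eq', Finset.mem_univ, if_true]
  have h3 : prob q (fun ω => (rvX₂ ω, rvX₁ ω)) (b, a) =
      prob q (fun ω => (rvX₁ ω, rvX₂ ω)) (a, b) := by
    simp only [prob_eq_sum_ite, Prod.mk.injEq, and_comm]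
  have h4 : prob q (fun ω => (rvU ω, rvX₂ ω, rvX₁ ω)) (u, b, a) =
      prob q (fun ω => (rvU ω, (rvX₁ ω, rvX₂ ω))) (u, (a, b)) := by
    simp only [prob_eq_sum_ite, Prod.mk.injEq, and_comm]
  rw [h1, h2] at h
  rw [testChannel, condProb, h3, h4]
  by_cases h0 : prob q (fun ω => (rvX₁ ω, rvX₂ ω)) (a, b) = 0
  · rw [h0, div_zero, mul_zero]
    by_contra hne
    exact (prob_pos hq0 (fun ω => (rvX₁ ω, rvX₂ ω)) hne).ne' h0
  · field_simp
    linarith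

lemma neg_sum_log_div_testChannel (hq0 : ∀ ω, 0 ≤ q ω) :
    -∑ ω, q ω * Real.log (condProb q rvU rvX₁ (rvU ω) (rvX₁ ω) /
      testChannel q (rvX₁ ω) (rvX₂ ω) (rvU ω)) = condMutualInfo q rvU rvX₂ rvX₁ := by
  rw [condMutualInfo, condEntropy_eq_sum_log, condEntropy_eq_sum_log, sub_neg_eq_add,
    ← Finset.sum_neg_distrib, ← Finset.sum_neg_distrib, ← Finset.sum_add_distrib]
  refine Finset.sum_congr rfl fun ω _ => ?_
  by_cases h : q ω = 0
  · simp [h]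
  · rw [testChannel, Real.log_div (condProb_pos hq0 rvU rvX₁ h).ne'
      (condProb_pos hq0 rvU (fun ω => (rvX₂ ω, rvX₁ ω)) h).ne']
    ring

/-- Gibbs' inequality: log x ≤ x − 1 for the density ratio of the two conditional laws of U. -/
lemma IsAdmissible.condMutualInfo_nonneg (hq : IsAdmissible p d₁ d₂ D₃₁ D₁₂ q)
    (hp : p ∈ stdSimplex ℝ (X₁ × X₂ × X₃)) : 0 ≤ condMutualInfo q rvU rvX₂ rvX₁ := by
  have hq0 := hq.mem_simplex.1
  rw [← neg_sum_log_div_testChannel hq0, neg_nonneg]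
  have h : ∀ ω, q ω * Real.log (condProb q rvU rvX₁ (rvU ω) (rvX₁ ω) /
      testChannel q (rvX₁ ω) (rvX₂ ω) (rvU ω)) ≤
      p ω.1 * condProb q rvU rvX₁ (rvU ω) (rvX₁ ω) - q ω := by
    intro ω
    by_cases h0 : q ω = 0
    · rw [h0, zero_mul, sub_zero]
      exact mul_nonneg (hp.1 _) (condProb_nonneg hq0 _ _ _ _)
    · have h1 := condProb_pos hq0 rvU rvX₁ h0
      have h2 : 0 < testChannel q (rvX₁ ω) (rvX₂ ω) (rvU ω) :=
        condProb_pos hq0 rvU (fun ω => (rvX₂ ω, rvX₁ ω)) h0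
      have h3 := mul_le_mul_of_nonneg_left (Real.log_le_sub_one_of_pos (div_pos h1 h2)) (hq0 ω)
      refine h3.trans (le_of_eq ?_)
      have h4 : q ω = p ω.1 * testChannel q (rvX₁ ω) (rvX₂ ω) (rvU ω) :=
        hq.eq_mul_testChannel ω.1 ω.2
      rw [mul_sub, mul_one]
      congr 1
      rw [h4]
      field_simp
  refine (Finset.sum_le_sum fun ω _ => h ω).trans ?_
  rw [Finset.sum_sub_distrib, hq.mem_simplex.2, sub_nonpos, Fintype.sum_prod_type, ← hp.2]
  refine Finset.sum_le_sum fun x _ => ?_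
  simp only [rvU, rvX₁, ← Finset.mul_sum]
  exact mul_le_of_le_one_right (hp.1 x) (sum_condProb_le_one rvU rvX₁ x.1)

end Achievability

/-! ### Quantizers and block codes from an admissible auxiliary variable -/

section Achievability

variable {X₁ X₂ X₃ Y₁ Y₂ : Type*} [Fintype X₁] [Fintype X₂] [Fintype X₃] {m : ℕ}
  {p : X₁ × X₂ × X₃ → ℝ} {d₁ : X₁ → Y₁ → ℝ} {d₂ : X₂ → Y₂ → ℝ} {D₃₁ D₁₂ R₁ R₂ : ℝ}
  {q : (X₁ × X₂ × X₃) × Fin m → ℝ}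

lemma ite_congr_iff {P Q : Prop} {_ : Decidable P} {_ : Decidable Q} (h : P ↔ Q) (a b : ℝ) :
    (if P then a else b) = if Q then a else b :=
  if_congr h rfl rfl

lemma IsAdmissible.sum_block_eq (hq : IsAdmissible p d₁ d₂ D₃₁ D₁₂ q) {n : ℕ}
    (E : Set (Fin n → (X₁ × X₂ × X₃) × Fin m)) [DecidablePred (· ∈ E)] :
    ∑ x : Fin n → X₁ × X₂ × X₃, ∑ u : Fin n → Fin m, (if (fun t => (x t, u t)) ∈ E then
      blockProb p x * ∏ t, testChannel q (x t).1 (x t).2.1 (u t) else (0 : ℝ)) = blockPr q E := by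
  rw [blockPr_eq_sum_ite, sum_blocks_prod (S := X₁ × X₂ × X₃) (T := Fin m)]
  refine Finset.sum_congr rfl fun x _ => Finset.sum_congr rfl fun u _ => ?_
  simp only [blockProb, hq.eq_mul_testChannel, Finset.prod_mul_distrib]

/-- Quantization of blocks: node 1 and node 2 agree on a description of the second source, at a rate
close to `I(U;X₂|X₁)`. -/
lemma IsAdmissible.exists_block_quantizer (hq : IsAdmissible p d₁ d₂ D₃₁ D₁₂ q)
    (hp : p ∈ stdSimplex ℝ (X₁ × X₂ × X₃)) {g : X₁ → Fin m → Y₂}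
    (hg : ∑ ω, q ω * d₂ (rvX₂ ω) (g (rvX₁ ω) (rvU ω)) ≤ D₁₂) {η δ : ℝ} (hη : 0 < η)
    (hδ : 0 < δ) :
    ∃ n₀ : ℕ, ∀ n, n₀ ≤ n → ∀ M : ℕ,
      Real.exp (n * (condMutualInfo q rvU rvX₂ rvX₁ + 2 * η)) ≤ M →
      ∃ (u : (Fin n → X₁) → Fin M → (Fin n → Fin m)) (φ : (Fin n → X₁) → (Fin n → X₂) → Fin M),
        blockPr p {x | ∏ t, condProb q rvX₂ (fun ω => (rvU ω, rvX₁ ω, rvX₃ ω)) (x t).2.1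
              (u (fun t => (x t).1) (φ (fun t => (x t).1) fun t => (x t).2.1) t, (x t).1,
                (x t).2.2) <
              Real.exp (-(n * (condEntropy q rvX₂ (fun ω => (rvU ω, rvX₁ ω, rvX₃ ω)) + η))) ∨
            0 ≤ ∑ t, (d₂ (x t).2.1 (g (x t).1
              (u (fun t => (x t).1) (φ (fun t => (x t).1) fun t => (x t).2.1) t)) -
                (D₁₂ + η))} ≤ 4 * δ := by
  classical
  have hq0 := hq.mem_simplex.1
  set I := condMutualInfo q rvU rvX₂ rvX₁ with hI
  set H₃ := condEntropy q rvX₂ (fun ω => (rvU ω, rvX₁ ω, rvX₃ ω)) with hH₃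
  -- Two bad events, atypicality of X₂ and excess distortion, share the budget δ² of the quantizer.
  have hδ2 : 0 < δ ^ 2 / 2 := by positivity
  obtain ⟨n₁, hn₁⟩ := exists_forall_blockPr_prod_le hq.mem_simplex
    (fun ω => condProb q rvU rvX₁ (rvU ω) (rvX₁ ω) / testChannel q (rvX₁ ω) (rvX₂ ω) (rvU ω))
    (fun ω hω => div_pos (condProb_pos hq0 rvU rvX₁ hω)
      (condProb_pos hq0 rvU (fun ω => (rvX₂ ω, rvX₁ ω)) hω)) I η hη
    (neg_sum_log_div_testChannel hq0).le hδ
  obtain ⟨n₂, hn₂⟩ := exists_forall_blockPr_prod_le hq.mem_simplex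
    (fun ω => condProb q rvX₂ (fun ω => (rvU ω, rvX₁ ω, rvX₃ ω)) (rvX₂ ω)
      (rvU ω, rvX₁ ω, rvX₃ ω)) (fun ω hω => condProb_pos hq0 rvX₂ _ hω) H₃ η hη
    (condEntropy_eq_sum_log q rvX₂ _).ge hδ2
  obtain ⟨n₃, hn₃⟩ := exists_forall_blockPr_le hq.mem_simplex
    (fun ω => d₂ (rvX₂ ω) (g (rvX₁ ω) (rvU ω)) - (D₁₂ + η)) (by
      simp only [mul_sub, Finset.sum_sub_distrib, ← Finset.sum_mul, hq.mem_simplex.2]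
      linarith) hδ2
  obtain ⟨n₄, hn₄⟩ := exists_nat_gt (-Real.log δ / η)
  refine ⟨max (max n₁ n₂) (max n₃ n₄), fun n hn M hM => ?_⟩
  have hn1 : n₁ ≤ n := by omega
  have hn2 : n₂ ≤ n := by omega
  have hn3 : n₃ ≤ n := by omega
  have hn4 : (n₄ : ℝ) ≤ n := by exact_mod_cast (by omega : n₄ ≤ n)
  have hexp : Real.exp (-(n * η)) ≤ δ := by
    rw [← Real.le_log_iff_exp_le hδ]
    rw [div_lt_iff₀ hη] at hn₄
    nlinarith
  set e : ℝ := Real.exp (-(n * (I + η))) with he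
  have hM0 : 0 < M := by
    have := (Real.exp_pos _).trans_le hM
    exact_mod_cast this
  have hMe : Real.exp (-(M * e)) ≤ δ := by
    refine le_trans (Real.exp_le_exp.2 (neg_le_neg ?_)) hexp
    -- The codebook rate exceeds the density exponent by η, so M e grows exponentially; growth like
    -- nη is all that is needed.
    calc (n : ℝ) * η ≤ Real.exp (n * η) := (Real.add_one_le_exp _).trans' (by linarith)
      _ = Real.exp (n * (I + 2 * η)) * e := by rw [he, ← Real.exp_add]; congr 1; ring
      _ ≤ M * e := by gcongr
  have hmarg := prob_fst_of_marginal hq.marginal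
  have hP : blockProb p (n := n) ∈ stdSimplex ℝ (Fin n → X₁ × X₂ × X₃) :=
    ⟨blockProb_nonneg hp.1, sum_blockProb hp⟩
  have hpos₁ : ∀ x : X₁ × X₂ × X₃, p x ≠ 0 → ∑ u, condProb q rvU rvX₁ u x.1 = 1 := by
    intro x hx
    rw [sum_condProb, div_self]
    have h := prob_pos hp.1 Prod.fst hx
    rw [← hmarg, prob_prob] at h
    exact h.ne'
  have hpos₂ : ∀ x : X₁ × X₂ × X₃, p x ≠ 0 → ∑ u, testChannel q x.1 x.2.1 u = 1 := by
    intro x hx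
    simp only [testChannel]
    rw [sum_condProb, div_self]
    have h := prob_pos hp.1 (fun x => (x.2.1, x.1)) hx
    rw [← hmarg, prob_prob] at h
    exact h.ne'
  have key := exists_quantizer hP (fun (x : Fin n → X₁ × X₂ × X₃) t => (x t).1)
    (fun (x : Fin n → X₁ × X₂ × X₃) t => (x t).2.1)
    (κ₁ := fun (a : Fin n → X₁) (u : Fin n → Fin m) => ∏ t, condProb q rvU rvX₁ (u t) (a t))
    (κ₂ := fun (a : Fin n → X₁) (b : Fin n → X₂) (u : Fin n → Fin m) =>
      ∏ t, testChannel q (a t) (b t) (u t))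
    (fun a u => Finset.prod_nonneg fun t _ => condProb_nonneg hq0 _ _ _ _)
    (fun a b u => Finset.prod_nonneg fun t _ => condProb_nonneg hq0 _ _ _ _)
    (fun x hx => by
      rw [sum_prod_blocks fun t (u : Fin m) => condProb q rvU rvX₁ u (x t).1]
      exact Finset.prod_eq_one fun t ht => hpos₁ _ (Finset.prod_ne_zero_iff.1 hx t ht))
    (fun x hx => by
      rw [sum_prod_blocks fun t (u : Fin m) => testChannel q (x t).1 (x t).2.1 u]
      exact Finset.prod_eq_one fun t ht => hpos₂ _ (Finset.prod_ne_zero_iff.1 hx t ht))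
    (fun (x : Fin n → X₁ × X₂ × X₃) (u : Fin n → Fin m) =>
      ∏ t, condProb q rvX₂ (fun ω => (rvU ω, rvX₁ ω, rvX₃ ω)) (x t).2.1
        (u t, (x t).1, (x t).2.2) < Real.exp (-(n * (H₃ + η))) ∨
      0 ≤ ∑ t, (d₂ (x t).2.1 (g (x t).1 (u t)) - (D₁₂ + η))) (e := e) hδ
  obtain ⟨u, φ, h⟩ := key (by
    have h1 := (blockPr_union_le hq0 _ _).trans (add_le_add (hn₂ n hn2) (hn₃ n hn3))
    rw [← hq.sum_block_eq] at h1
    refine le_trans (le_of_eq ?_) (h1.trans (by linarith))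
    exact Finset.sum_congr rfl fun x _ => Finset.sum_congr rfl fun u _ =>
      ite_congr_iff Iff.rfl _ _) (by
    have h1 : blockPr q {z : Fin n → (X₁ × X₂ × X₃) × Fin m |
        ∏ t, condProb q rvU rvX₁ (z t).2 (z t).1.1 <
          e * ∏ t, testChannel q (z t).1.1 (z t).1.2.1 (z t).2} ≤ δ := by
      refine (blockPr_mono hq0 fun z hz hzE => ?_).trans (hn₁ n hn1)
      simp only [Set.mem_ofPred_eq, Finset.prod_div_distrib] at hzE ⊢
      refine (div_lt_iff₀ (Finset.prod_pos fun t ht => ?_)).2 hzE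
      exact condProb_pos hq0 rvU (fun ω => (rvX₂ ω, rvX₁ ω)) (Finset.prod_ne_zero_iff.1 hz t ht)
    rw [← hq.sum_block_eq] at h1
    refine le_trans (le_of_eq ?_) h1
    exact Finset.sum_congr rfl fun x _ => Finset.sum_congr rfl fun u _ =>
      ite_congr_iff Iff.rfl _ _) hM0 hMe
  refine ⟨u, φ, le_trans (le_of_eq ?_) h⟩
  rw [blockPr_eq_sum_ite]
  exact Finset.sum_congr rfl fun x _ => ite_congr_iff Iff.rfl _ _

/-- Block codes with one round of messages. -/
lemma IsAdmissible.exists_block_code (hq : IsAdmissible p d₁ d₂ D₃₁ D₁₂ q)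
    (hp : p ∈ stdSimplex ℝ (X₁ × X₂ × X₃)) (hR : (R₁, R₂) ∈ ratePairs q) {η δ : ℝ} (hη : 0 < η)
    (hδ : 0 < δ) :
    ∃ n₀ : ℕ, ∀ n, n₀ ≤ n → ∃ N₁ M N₃ : ℕ, 0 < N₁ ∧ 0 < M ∧ 0 < N₃ ∧
      Real.log N₁ ≤ n * (R₁ + 2 * η) + Real.log 2 ∧
      Real.log M + Real.log N₃ ≤ n * (R₂ + 4 * η) + 2 * Real.log 2 ∧
      ∃ (e₁ : (Fin n → X₁) → Fin N₁) (e₂ : (Fin n → X₂) → Fin N₁ → Fin M × Fin N₃)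
        (D₁ : (Fin n → X₁) → Fin M × Fin N₃ → (Fin n → Y₂))
        (D₂ : (Fin n → X₂) → Fin N₁ → (Fin n → X₁))
        (D₃ : (Fin n → X₃) → Fin N₁ → Fin M × Fin N₃ → (Fin n → X₁) × (Fin n → X₂)),
        blockPr p {x | ¬ (D₂ (fun t => (x t).2.1) (e₁ fun t => (x t).1) = (fun t => (x t).1) ∧
          ∑ t, d₂ (x t).2.1 (D₁ (fun t => (x t).1)
            (e₂ (fun t => (x t).2.1) (e₁ fun t => (x t).1)) t) ≤ n * (D₁₂ + η) ∧
          D₃ (fun t => (x t).2.2) (e₁ fun t => (x t).1)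
            (e₂ (fun t => (x t).2.1) (e₁ fun t => (x t).1)) =
              (fun t => (x t).1, fun t => (x t).2.1))} ≤ 13 * δ := by
  classical
  obtain ⟨x₀⟩ := nonempty_of_mem_stdSimplex hp
  have hX₁ : Nonempty X₁ := ⟨x₀.1⟩
  have hX₂ : Nonempty X₂ := ⟨x₀.2.1⟩
  have hq0 := hq.mem_simplex.1
  have hmarg := prob_fst_of_marginal hq.marginal
  obtain ⟨g, hg⟩ := hq.dist₁₂
  obtain ⟨hR₁, hR₂, hR₁₂⟩ := hR
  set I := condMutualInfo q rvU rvX₂ rvX₁ with hI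
  set H₃ := condEntropy q rvX₂ (fun ω => (rvU ω, rvX₁ ω, rvX₃ ω)) with hH₃
  dsimp only at hR₁ hR₂ hR₁₂
  have hI0 : 0 ≤ I := hq.condMutualInfo_nonneg hp
  have hH₃0 : 0 ≤ H₃ := condEntropy_nonneg hq0 _ _
  have hR₁0 : 0 ≤ R₁ := (condEntropy_nonneg hq0 _ _).trans hR₁
  obtain ⟨n₁, hn₁⟩ := hq.exists_block_quantizer hp hg hη hδ
  obtain ⟨n₂, hn₂⟩ := exists_forall_blockPr_prod_le hq.mem_simplex
    (fun ω => condProb q rvX₁ rvX₂ (rvX₁ ω) (rvX₂ ω)) (fun ω hω => condProb_pos hq0 _ _ hω) R₁ η hη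
    ((condEntropy_eq_sum_log q rvX₁ rvX₂).ge.trans hR₁) hδ
  obtain ⟨n₃, hn₃⟩ := exists_forall_blockPr_prod_le hq.mem_simplex
    (fun ω => condProb q (fun ω => (rvX₁ ω, rvX₂ ω)) rvX₃ (rvX₁ ω, rvX₂ ω) (rvX₃ ω))
    (fun ω hω => condProb_pos hq0 (fun ω => (rvX₁ ω, rvX₂ ω)) _ hω) (R₁ + R₂) η hη
    ((condEntropy_eq_sum_log q (fun ω => (rvX₁ ω, rvX₂ ω)) rvX₃).ge.trans hR₁₂) hδ
  obtain ⟨n₄, hn₄⟩ := exists_nat_gt (-Real.log δ / η)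
  refine ⟨max (max n₁ n₂) (max n₃ n₄), fun n hn => ?_⟩
  have hn1 : n₁ ≤ n := by omega
  have hn2 : n₂ ≤ n := by omega
  have hn3 : n₃ ≤ n := by omega
  have hn4 : (n₄ : ℝ) ≤ n := by exact_mod_cast (by omega : n₄ ≤ n)
  have hexp : Real.exp (-(n * η)) ≤ δ := by
    rw [← Real.le_log_iff_exp_le hδ]
    rw [div_lt_iff₀ hη] at hn₄
    nlinarith
  have hn0 : (0 : ℝ) ≤ n := Nat.cast_nonneg n
  obtain ⟨N₁, hN₁, hN₁e, hN₁l⟩ := exists_nat_exp_le (r := n * (R₁ + 2 * η)) (by positivity)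
  obtain ⟨M, hM, hMe, hMl⟩ := exists_nat_exp_le (r := n * (I + 2 * η)) (by positivity)
  -- The last bin receives what the index leaves of R₂; this is nonnegative because R₂ − I ≥ H(X₂|U
  -- X₁X₃) ≥ 0.
  obtain ⟨N₃, hN₃, hN₃e, hN₃l⟩ := exists_nat_exp_le (r := n * (R₂ - I + 2 * η))
    (mul_nonneg hn0 (by linarith))
  refine ⟨N₁, M, N₃, hN₁, hM, hN₃, hN₁l, by linarith, ?_⟩
  obtain ⟨u, φ, hbad⟩ := hn₁ n hn1 M hMe
  have : NeZero N₁ := ⟨hN₁.ne'⟩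
  have : NeZero M := ⟨hM.ne'⟩
  have : NeZero N₃ := ⟨hN₃.ne'⟩
  have hP : blockProb p (n := n) ∈ stdSimplex ℝ (Fin n → X₁ × X₂ × X₃) :=
    ⟨blockProb_nonneg hp.1, sum_blockProb hp⟩
  set bad : Set (Fin n → X₁ × X₂ × X₃) := {x |
    ∏ t, condProb q rvX₂ (fun ω => (rvU ω, rvX₁ ω, rvX₃ ω)) (x t).2.1
      (u (fun t => (x t).1) (φ (fun t => (x t).1) fun t => (x t).2.1) t, (x t).1, (x t).2.2) <
        Real.exp (-(n * (H₃ + η))) ∨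
      0 ≤ ∑ t, (d₂ (x t).2.1 (g (x t).1
        (u (fun t => (x t).1) (φ (fun t => (x t).1) fun t => (x t).2.1) t)) - (D₁₂ + η))}
    with hbad_def
  set G₂ : (Fin n → X₁) → (Fin n → X₂) → Prop := fun a b =>
    Real.exp (-(n * (R₁ + η))) ≤ ∏ t, condProb q rvX₁ rvX₂ (a t) (b t) with hG₂
  set T₃ : (Fin n → X₁) → (Fin n → X₂) → (Fin n → X₃) → Prop := fun a b c =>
    Real.exp (-(n * (R₁ + R₂ + η))) ≤
      ∏ t, condProb q (fun ω => (rvX₁ ω, rvX₂ ω)) rvX₃ (a t, b t) (c t) with hT₃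
  set G₃ : (Fin n → X₁) → (Fin n → X₂) → (Fin n → X₃) → Prop := fun a b c =>
    T₃ a b c ∧ Real.exp (-(n * (H₃ + η))) ≤
      ∏ t, condProb q rvX₂ (fun ω => (rvU ω, rvX₁ ω, rvX₃ ω)) (b t) (u a (φ a b) t, a t, c t)
    with hG₃
  have hpush : ∀ E : Set (Fin n → X₁ × X₂ × X₃),
      blockPr q {z : Fin n → (X₁ × X₂ × X₃) × Fin m | (fun t => (z t).1) ∈ E} = blockPr p E := by
    intro E
    rw [blockPr_comp, hmarg]
  have h₂ : blockPr p {x : Fin n → X₁ × X₂ × X₃ |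
      ¬ G₂ (fun t => (x t).1) (fun t => (x t).2.1)} ≤ δ := by
    rw [← hpush]
    refine le_trans (blockPr_mono hq0 fun z _ hz => ?_) (hn₂ n hn2)
    exact not_le.1 hz
  have hT : blockPr p {x : Fin n → X₁ × X₂ × X₃ |
      ¬ T₃ (fun t => (x t).1) (fun t => (x t).2.1) (fun t => (x t).2.2)} ≤ δ := by
    rw [← hpush]
    refine le_trans (blockPr_mono hq0 fun z _ hz => ?_) (hn₃ n hn3)
    exact not_le.1 hz
  have h₃ : blockPr p {x : Fin n → X₁ × X₂ × X₃ |
      ¬ G₃ (fun t => (x t).1) (fun t => (x t).2.1) (fun t => (x t).2.2)} ≤ 5 * δ := by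
    refine (blockPr_mono hp.1 fun x _ hx => ?_).trans ((blockPr_union_le hp.1 _ _).trans
      ((add_le_add hT hbad).trans (by linarith)))
    rcases not_and_or.1 hx with h | h
    · exact Or.inl h
    · exact Or.inr (Or.inl (not_le.1 h))
  have key := exists_one_shot_code (J₁ := Fin N₁) (J₃ := Fin N₃) hP
    (fun x t => (x t).1) (fun x t => (x t).2.1) (fun x t => (x t).2.2) φ u G₂ G₃
    (L₂ := Real.exp (n * (R₁ + η))) (LA := Real.exp (n * (R₁ + R₂ + η)))
    (LC := Real.exp (n * (H₃ + η))) (δ₂ := δ) (δ₃ := 5 * δ)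
  obtain ⟨e₁, e₂, D₁, D₂, D₃, hcode⟩ := key (by
    intro b
    exact sum_ite_exp_le_prod (fun t a => condProb_nonneg hq0 rvX₁ rvX₂ a (b t))
      (fun t => sum_condProb_le_one rvX₁ rvX₂ (b t)) _) (by
    intro c
    refine le_trans ?_ (sum_ite_exp_le_prod
      (fun t (z : X₁ × X₂) => condProb_nonneg hq0 (fun ω => (rvX₁ ω, rvX₂ ω)) rvX₃ z (c t))
      (fun t => sum_condProb_le_one _ rvX₃ (c t)) _)
    rw [sum_blocks_prod]
    refine Finset.sum_le_sum fun a _ => Finset.sum_le_sum fun b _ => ?_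
    by_cases h : G₃ a b c
    · rw [if_pos h, if_pos h.1]
    · rw [if_neg h]; positivity) (by
    intro a b c
    refine le_trans ?_ (sum_ite_exp_le_prod
      (fun t b' => condProb_nonneg hq0 rvX₂ (fun ω => (rvU ω, rvX₁ ω, rvX₃ ω)) b'
        (u a (φ a b) t, a t, c t))
      (fun t => sum_condProb_le_one rvX₂ (fun ω => (rvU ω, rvX₁ ω, rvX₃ ω)) _) _)
    refine Finset.sum_le_sum fun b' _ => ?_
    by_cases h : φ a b' = φ a b ∧ G₃ a b' c
    · rw [if_pos h, if_pos]
      -- Equal indices mean the same codeword of U, so all competitors b' are typical given one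
      -- fixed conditioning word and can be counted.
      rw [← h.1]; exact h.2.2
    · rw [if_neg h]; positivity) (by
    refine le_trans (le_of_eq ?_) h₂
    rw [blockPr_eq_sum_ite]
    refine Finset.sum_congr rfl fun x _ => ?_
    simp only [Set.mem_ofPred_eq, ite_not]) (by
    refine le_trans (le_of_eq ?_) h₃
    rw [blockPr_eq_sum_ite]
    refine Finset.sum_congr rfl fun x _ => ?_
    simp only [Set.mem_ofPred_eq, ite_not]
    congr)
  refine ⟨e₁, e₂, fun a j t => g (a t) (D₁ a j t), D₂, D₃, ?_⟩
  have hN₁' : (0 : ℝ) < N₁ := by exact_mod_cast hN₁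
  have hM' : (0 : ℝ) < M := by exact_mod_cast hM
  have hN₃' : (0 : ℝ) < N₃ := by exact_mod_cast hN₃
  have b₁ : Real.exp (n * (R₁ + η)) / N₁ ≤ δ := by
    rw [div_le_iff₀ hN₁']
    calc Real.exp (n * (R₁ + η)) = Real.exp (-(n * η)) * Real.exp (n * (R₁ + 2 * η)) := by
          rw [← Real.exp_add]; congr 1; ring
      _ ≤ δ * N₁ := by gcongr
  have b₃ : Real.exp (n * (H₃ + η)) / N₃ ≤ δ := by
    rw [div_le_iff₀ hN₃']
    calc Real.exp (n * (H₃ + η)) ≤ Real.exp (-(n * η)) * Real.exp (n * (R₂ - I + 2 * η)) := by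
          rw [← Real.exp_add]
          refine Real.exp_le_exp.2 ?_
          have := mul_le_mul_of_nonneg_left hR₂ hn0
          linarith
      _ ≤ δ * N₃ := by gcongr
  -- The mutual information cancels between index and bin, so only the sum rate matters for wrong
  -- first words.
  have b₂ : Real.exp (n * (R₁ + R₂ + η)) / (N₁ * M * N₃) ≤ δ := by
    rw [div_le_iff₀ (by positivity)]
    calc Real.exp (n * (R₁ + R₂ + η)) ≤ Real.exp (-(n * η)) * (Real.exp (n * (R₁ + 2 * η)) *
          Real.exp (n * (I + 2 * η)) * Real.exp (n * (R₂ - I + 2 * η))) := by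
          rw [← Real.exp_add, ← Real.exp_add, ← Real.exp_add]
          refine Real.exp_le_exp.2 ?_
          have := mul_nonneg hn0 hη.le
          linarith
      _ ≤ δ * (N₁ * M * N₃) := by gcongr
  simp only [Fintype.card_fin] at hcode
  refine (blockPr_mono (F := {x : Fin n → X₁ × X₂ × X₃ |
    ¬ (D₂ (fun t => (x t).2.1) (e₁ fun t => (x t).1) = (fun t => (x t).1) ∧
      D₁ (fun t => (x t).1) (e₂ (fun t => (x t).2.1) (e₁ fun t => (x t).1)) =
        u (fun t => (x t).1) (φ (fun t => (x t).1) fun t => (x t).2.1) ∧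
      D₃ (fun t => (x t).2.2) (e₁ fun t => (x t).1)
        (e₂ (fun t => (x t).2.1) (e₁ fun t => (x t).1)) =
          (fun t => (x t).1, fun t => (x t).2.1))} ∪ bad) hp.1 fun x _ hx => ?_).trans
    -- The total of 13δ is 4δ for the quantizer and 9δ for decoding: δ and 5δ for atypical words,
    -- and 3δ for collisions.
    ((blockPr_union_le hp.1 _ _).trans ((add_le_add (b := 9 * δ) ?_ hbad).trans (by linarith)))
  · by_contra hcon
    rw [Set.mem_union, not_or] at hcon
    obtain ⟨hc₁, hc₂⟩ := hcon
    obtain ⟨k₁, k₂, k₃⟩ := not_not.1 hc₁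
    refine hx ⟨k₁, ?_, k₃⟩
    have k₄ := not_le.1 (not_or.1 hc₂).2
    simp only [k₂]
    rw [Finset.sum_sub_distrib] at k₄
    simp only [Finset.sum_const, Finset.card_univ, Fintype.card_fin, nsmul_eq_mul] at k₄
    linarith
  · refine le_trans (le_of_eq ?_) (hcode.trans (by linarith))
    rw [blockPr_eq_sum_ite]
    refine Finset.sum_congr rfl fun x _ => ?_
    simp only [Set.mem_ofPred_eq, ite_not]
    congr

/-- Turns a guarantee off a rare event into one in expectation; the distortions are bounded, so the
event costs at most C δ. -/
lemma blockExp_le_add (hp : p ∈ stdSimplex ℝ (X₁ × X₂ × X₃)) {n : ℕ}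
    {F G : (Fin n → X₁ × X₂ × X₃) → ℝ} {E : Set (Fin n → X₁ × X₂ × X₃)} {C δ : ℝ} (hC : 0 ≤ C)
    (hE : blockPr p E ≤ δ) (hF : ∀ x, x ∉ E → F x ≤ G x) (hF' : ∀ x, F x ≤ G x + C) :
    blockExp p F ≤ blockExp p G + C * δ := by
  classical
  have h : blockExp p F ≤ blockExp p G + C * blockPr p E := by
    rw [blockPr_eq_sum_ite, blockExp, blockExp, Finset.mul_sum, ← Finset.sum_add_distrib]
    refine Finset.sum_le_sum fun x _ => ?_
    have h0 := blockProb_nonneg hp.1 x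
    by_cases hx : x ∈ E
    · rw [if_pos hx]
      have := mul_le_mul_of_nonneg_left (hF' x) h0
      linarith
    · rw [if_neg hx, mul_zero, add_zero]
      exact mul_le_mul_of_nonneg_left (hF x hx) h0
  exact h.trans (by gcongr)

end Achievability

/-! ### From block codes to the achievability of rates and expected distortions -/

section Achievability

variable {X₁ X₂ X₃ Y₁ Y₂ : Type*} [Fintype X₁] [Fintype X₂] [Fintype X₃] {m : ℕ}
  {p : X₁ × X₂ × X₃ → ℝ} {d₁ : X₁ → Y₁ → ℝ} {d₂ : X₂ → Y₂ → ℝ} {D₃₁ D₁₂ R₁ R₂ : ℝ}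
  {q : (X₁ × X₂ × X₃) × Fin m → ℝ}

lemma blockDist_le {S T : Type*} {d : S → T → ℝ} {n : ℕ} (hn : 0 < n) {x : Fin n → S}
    {y : Fin n → T} {C : ℝ} (h : ∑ t, d (x t) (y t) ≤ n * C) : blockDist d x y ≤ C := by
  rw [blockDist, one_div, inv_mul_le_iff₀ (by exact_mod_cast hn)]
  exact h

lemma blockDist_le_of_forall_le {S T : Type*} {d : S → T → ℝ} {C : ℝ} (hd : ∀ s t, d s t ≤ C)
    {n : ℕ} (hn : 0 < n) (x : Fin n → S) (y : Fin n → T) : blockDist d x y ≤ C :=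
  blockDist_le hn ((Finset.sum_le_sum fun t _ => hd (x t) (y t)).trans (by simp))

lemma blockDist_nonneg {S T : Type*} {d : S → T → ℝ} (hd : ∀ s t, 0 ≤ d s t) {n : ℕ}
    (x : Fin n → S) (y : Fin n → T) : 0 ≤ blockDist d x y :=
  mul_nonneg (by positivity) (Finset.sum_nonneg fun _ _ => hd _ _)

lemma exists_bound_of_fintype {S T : Type*} [Fintype S] [Fintype T] (d : S → T → ℝ) :
    ∃ C : ℝ, 0 ≤ C ∧ ∀ s t, d s t ≤ C :=
  ⟨∑ z : S × T, |d z.1 z.2|, Finset.sum_nonneg fun _ _ => abs_nonneg _, fun s t =>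
    (le_abs_self _).trans (Finset.single_le_sum (f := fun z : S × T => |d z.1 z.2|)
      (fun _ _ => abs_nonneg _) (Finset.mem_univ (s, t)))⟩

/-- Node 3 may recover the first source losslessly, and its reconstruction can then be chosen as a
function of the first source. -/
lemma IsAdmissible.exists_letter_map [Fintype Y₁] (hq : IsAdmissible p d₁ d₂ D₃₁ D₁₂ q) :
    ∃ y : X₁ → Y₁, ∑ x, p x * d₁ x.1 (y x.1) ≤ D₃₁ := by
  obtain ⟨g, hg⟩ := hq.dist₃₁
  obtain ⟨ω₀⟩ := nonempty_of_mem_stdSimplex hq.mem_simplex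
  have : Nonempty Y₁ := ⟨g (rvX₂ ω₀) (rvX₃ ω₀) (rvU ω₀)⟩
  choose y hy using fun a => Finite.exists_min (d₁ a)
  refine ⟨y, le_trans ?_ hg⟩
  have h := sum_mul_comp q Prod.fst fun x => d₁ x.1 (y x.1)
  rw [prob_fst_of_marginal hq.marginal] at h
  rw [← h]
  exact Finset.sum_le_sum fun ω _ => mul_le_mul_of_nonneg_left (hy _ _) (hq.mem_simplex.1 ω)

theorem IsAdmissible.isAchievable [Fintype Y₁] [Fintype Y₂]
    (hq : IsAdmissible p d₁ d₂ D₃₁ D₁₂ q) (hp : p ∈ stdSimplex ℝ (X₁ × X₂ × X₃))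
    (hd₁ : ∀ x y, 0 ≤ d₁ x y) (hd₂ : ∀ x y, 0 ≤ d₂ x y) (hR : (R₁, R₂) ∈ ratePairs q) {K : ℕ}
    (hK : 0 < K) : IsAchievable p d₁ d₂ D₃₁ D₁₂ K R₁ R₂ := by
  intro ε hε
  obtain ⟨y, hy⟩ := hq.exists_letter_map
  obtain ⟨C₁, hC₁, hdC₁⟩ := exists_bound_of_fintype d₁
  obtain ⟨C₂, hC₂, hdC₂⟩ := exists_bound_of_fintype d₂
  -- Ensures that the distortion is at most D₁₂ + η + C₂ even on the bad event.
  have hD₁₂ : 0 ≤ D₁₂ := by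
    obtain ⟨g, hg⟩ := hq.dist₁₂
    exact (Finset.sum_nonneg fun ω _ => mul_nonneg (hq.mem_simplex.1 ω) (hd₂ _ _)).trans hg
  -- The second rate is the tightest use of η: 4η, plus at most 2η for rounding. The choice of δ
  -- makes error probability and extra distortion together at most ε / 2.
  set η : ℝ := ε / 8 with hη
  set δ : ℝ := ε / (26 * (1 + C₁ + C₂)) with hδ
  have hη0 : 0 < η := by positivity
  have hδ0 : 0 < δ := by positivity
  have hδε : (1 + C₁ + C₂) * (13 * δ) = ε / 2 := by rw [hδ]; field_simp; norm_num
  have h0 : 0 ≤ C₁ * (13 * δ) := by positivity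
  have h1 : 0 ≤ C₂ * (13 * δ) := by positivity
  obtain ⟨n₁, hn₁⟩ := hq.exists_block_code hp hR hη0 hδ0
  obtain ⟨n₂, hn₂⟩ := exists_nat_gt (Real.log 2 / η)
  refine ⟨max n₁ n₂, fun n hn => ?_⟩
  have hnpos : 0 < n := by omega
  have hnR : (0 : ℝ) < n := by exact_mod_cast hnpos
  have hlog : Real.log 2 ≤ n * η := by
    rw [div_lt_iff₀ hη0] at hn₂
    have : (n₂ : ℝ) ≤ n := by exact_mod_cast (by omega : n₂ ≤ n)
    nlinarith
  obtain ⟨N₁, M, N₃, hN₁, hM, hN₃, hr₁, hr₂, e₁, e₂, D₁, D₂, D₃, herr⟩ := hn₁ n (by omega)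
  have : NeZero N₁ := ⟨hN₁.ne'⟩
  have : NeZero M := ⟨hM.ne'⟩
  have : NeZero N₃ := ⟨hN₃.ne'⟩
  obtain ⟨c, hc₁, hc₂, hc⟩ := exists_code hK e₁ e₂ D₁ D₂
    (fun z i j t => y ((D₃ z i j).1 t)) fun z i j => (D₃ z i j).2
  dsimp only at hc
  set bad : Set (Fin n → X₁ × X₂ × X₃) :=
    {x | ¬ (D₂ (fun t => (x t).2.1) (e₁ fun t => (x t).1) = (fun t => (x t).1) ∧
      ∑ t, d₂ (x t).2.1 (D₁ (fun t => (x t).1)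
        (e₂ (fun t => (x t).2.1) (e₁ fun t => (x t).1)) t) ≤ n * (D₁₂ + η) ∧
      D₃ (fun t => (x t).2.2) (e₁ fun t => (x t).1)
        (e₂ (fun t => (x t).2.1) (e₁ fun t => (x t).1)) =
          (fun t => (x t).1, fun t => (x t).2.1))} with hbad
  have hM' : (M : ℝ) ≠ 0 := by exact_mod_cast hM.ne'
  have hN₃' : (N₃ : ℝ) ≠ 0 := by exact_mod_cast hN₃.ne'
  refine ⟨c, ?_, ?_, ?_, ?_, ?_, ?_⟩
  · rw [hc₁, Fintype.card_fin, one_div, inv_mul_le_iff₀ hnR]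
    refine hr₁.trans ?_
    have : (n : ℝ) * ε = 8 * (n * η) := by rw [hη]; ring
    nlinarith
  · rw [hc₂, Fintype.card_prod, Fintype.card_fin, Fintype.card_fin, Nat.cast_mul,
      Real.log_mul hM' hN₃', one_div, inv_mul_le_iff₀ hnR]
    refine hr₂.trans ?_
    have : (n : ℝ) * ε = 8 * (n * η) := by rw [hη]; ring
    nlinarith
  · have h := blockExp_le_add hp hC₂ (F := fun x => blockDist d₂ (fun t => (x t).2.1) (c.out₁₂ x))
      (G := fun _ => D₁₂ + η) herr (fun x hx => by
        obtain ⟨-, hx₂, -⟩ := not_not.1 hx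
        rw [(hc x).1]
        exact blockDist_le hnpos hx₂)
      (fun x => by
        have := blockDist_le_of_forall_le hdC₂ hnpos (fun t => (x t).2.1) (c.out₁₂ x)
        linarith)
    refine h.trans ?_
    rw [blockExp, ← Finset.sum_mul, sum_blockProb hp]
    linarith
  · refine (blockPr_mono hp.1 fun x _ hx => ?_).trans (herr.trans (by linarith))
    intro hx'
    refine hx ?_
    rw [(hc x).2.1]
    exact hx'.1.symm
  · have h := blockExp_le_add hp hC₁ (F := fun x => blockDist d₁ (fun t => (x t).1) (c.out₃₁ x))
      (G := fun x => blockDist d₁ (fun t => (x t).1) fun t => y (x t).1) herr (fun x hx => by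
        obtain ⟨-, -, hx₃⟩ := not_not.1 hx
        rw [(hc x).2.2.1, hx₃])
      (fun x => by
        have := blockDist_le_of_forall_le hdC₁ hnpos (fun t => (x t).1) (c.out₃₁ x)
        have := blockDist_nonneg hd₁ (fun t => (x t).1) fun t => y (x t).1
        linarith)
    refine h.trans ?_
    rw [blockExp_blockDist_letter hp hnpos Prod.fst (fun x => y x.1) d₁]
    linarith
  · refine (blockPr_mono hp.1 fun x _ hx => ?_).trans (herr.trans (by linarith))
    intro hx'
    refine hx ?_
    rw [(hc x).2.2.2, hx'.2.2]

end Achievability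

end ReversalDelivery

end

/-- All the regions coincide by a cycle of inclusions: operational, single-letter with bounded
alphabet, single-letter with any alphabet, K rounds, operational. -/
theorem theorem4 {X₁ X₂ X₃ Y₁ Y₂ : Type*} [Fintype X₁] [Fintype X₂] [Fintype X₃]
    [Fintype Y₁] [Fintype Y₂]
    (p : X₁ × X₂ × X₃ → ℝ) (hp : p ∈ stdSimplex ℝ (X₁ × X₂ × X₃))
    (d₁ : X₁ → Y₁ → ℝ) (hd₁ : ∀ x y, 0 ≤ d₁ x y)
    (d₂ : X₂ → Y₂ → ℝ) (hd₂ : ∀ x y, 0 ≤ d₂ x y)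
    (D₃₁ D₁₂ : ℝ) :
    -- the region is the single-letter region, with an auxiliary alphabet of arbitrary finite size
    ReversalDelivery.rateDistortionRegion p d₁ d₂ D₃₁ D₁₂ =
      ReversalDelivery.singleLetterRegion p d₁ d₂ D₃₁ D₁₂ Set.univ ∧
    -- the size of the auxiliary alphabet can be bounded
    ReversalDelivery.singleLetterRegion p d₁ d₂ D₃₁ D₁₂ Set.univ =
      ReversalDelivery.singleLetterRegion p d₁ d₂ D₃₁ D₁₂
        {m | m ≤ Fintype.card X₁ * Fintype.card X₂ + 3} ∧
    -- a single round suffices, and more rounds do not help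
    ∀ K : ℕ, 1 ≤ K → ReversalDelivery.regionWithRounds p d₁ d₂ D₃₁ D₁₂ K =
      ReversalDelivery.rateDistortionRegion p d₁ d₂ D₃₁ D₁₂ := by
  have converse : ReversalDelivery.rateDistortionRegion p d₁ d₂ D₃₁ D₁₂ ⊆
      ReversalDelivery.singleLetterRegion p d₁ d₂ D₃₁ D₁₂
        {m | m ≤ Fintype.card X₁ * Fintype.card X₂ + 3} := by
    rintro R ⟨K, -, hR⟩
    exact ReversalDelivery.mem_singleLetterRegion_of_isAchievable hp hR
  have mono : ReversalDelivery.singleLetterRegion p d₁ d₂ D₃₁ D₁₂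
        {m | m ≤ Fintype.card X₁ * Fintype.card X₂ + 3} ⊆
      ReversalDelivery.singleLetterRegion p d₁ d₂ D₃₁ D₁₂ Set.univ := by
    rintro R ⟨m, -, h⟩
    exact ⟨m, Set.mem_univ m, h⟩
  have direct : ∀ K : ℕ, 1 ≤ K → ReversalDelivery.singleLetterRegion p d₁ d₂ D₃₁ D₁₂ Set.univ ⊆
      ReversalDelivery.regionWithRounds p d₁ d₂ D₃₁ D₁₂ K := by
    rintro K hK R ⟨m, -, q, hq, hR⟩
    exact hq.isAchievable hp hd₁ hd₂ hR hK
  have union : ∀ K : ℕ, 1 ≤ K → ReversalDelivery.regionWithRounds p d₁ d₂ D₃₁ D₁₂ K ⊆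
      ReversalDelivery.rateDistortionRegion p d₁ d₂ D₃₁ D₁₂ := fun K hK R hR => ⟨K, hK, hR⟩
  refine ⟨?_, ?_, fun K hK => ?_⟩
  · exact (converse.trans mono).antisymm ((direct 1 le_rfl).trans (union 1 le_rfl))
  · exact (((direct 1 le_rfl).trans (union 1 le_rfl)).trans converse).antisymm mono
  · exact (union K hK).antisymm ((converse.trans mono).trans (direct K hK))
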